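/- Theorem. There exists a deterministic incremental algorithm (on a word RAM with $\Theta(\log n)$-bit words) that maintains a DFS tree of an undirected graph under an arbitrary online sequence of edge insertions, as follows. The input is a simple undirected graph $G$ with $n\ge 2$ vertices and $m$ edges, given as an arbitrarily ordered list of its edges. Let $G_r$ be $G$ together with a dummy vertex $r$ joined to all vertices of $G$. A DFS tree of $G_r$ rooted at $r$ is a spanning tree of $G_r$, rooted at $r$, such that every edge of $G_r$ outside the tree joins a vertex with one of its ancestors in the tree (so the subtrees at the children of $r$ are DFS trees of the connected components of $G$). The algorithm first preprocesses $G$ and reports a DFS tree of $G_r$ rooted at $r$, in $O((m+n)\log n)$ time; this is $O(m\log n)$ when $G$ is connected. Afterwards, edges are inserted one at a time, each joining two distinct vertices that are not yet adjacent, in an arbitrary order that is not known in advance. After each insertion the algorithm reports (as an array of parent pointers) a DFS tree, rooted at $r$, of the current graph augmented with $r$, in $O(n\log^3 n)$ worst-case time per insertion. The word length is at least a fixed constant times $\log n$, and all constants are absolute. -/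

import Mathlib

namespace IncDFS

section Graphs

variable {V : Type*}

/-- `G` together with a dummy vertex `none` that is joined to every vertex of `G`. -/
def addRoot (G : SimpleGraph V) : SimpleGraph (Option V) :=
  SimpleGraph.fromRel fun a b =>
    match a, b with
    | some u, some v => G.Adj u v
    | none, some _ => True
    | _, none => False

/-- In the tree `T` rooted at `r`, the vertex `u` is a (not necessarily proper) ancestor of `v`:
it lies on the path of `T` from `r` to `v`. -/
def IsAncestor (T : SimpleGraph V) (r u v : V) : Prop :=
  ∃ p : T.Walk r v, p.IsPath ∧ u ∈ p.support

/-- In the tree `T` rooted at `r`, the vertex `p` is the parent of `v`. -/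
def IsParent (T : SimpleGraph V) (r p v : V) : Prop :=
  T.Adj p v ∧ IsAncestor T r p v

/-- `T`, rooted at `r`, is a DFS tree of `H`: a rooted spanning tree such that every non-tree edge
of `H` is a back edge, i.e. joins a vertex with one of its ancestors. -/
def IsDFSTree (H : SimpleGraph V) (r : V) (T : SimpleGraph V) : Prop :=
  T ≤ H ∧ T.IsTree ∧
    ∀ u v, H.Adj u v → ¬ T.Adj u v → IsAncestor T r u v ∨ IsAncestor T r v u

/-- `E` lists every edge of `G` exactly once, in some order and with some orientation. -/
def EnumeratesEdges (E : List (V × V)) (G : SimpleGraph V) : Prop :=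
  (E.map fun e => s(e.1, e.2)).Nodup ∧ ∀ u v, G.Adj u v ↔ s(u, v) ∈ E.map fun e => s(e.1, e.2)

end Graphs

section WordRAM

/-! A word RAM: finitely many registers are used by a program, the memory is addressed by words,
and with word size `w` every computed value is a natural number below `2 ^ w`. Programs are
structured; each elementary instruction and each evaluation of a test takes one step. -/

/-- The arithmetic instructions. -/
inductive Op
  | add | sub | mul | div

/-- Arithmetic on words of `w` bits: sums and products modulo `2 ^ w`, truncated difference,
integer quotient (zero if the divisor is zero). -/
def Op.eval (w : ℕ) : Op → ℕ → ℕ → ℕ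
  | .add, x, y => (x + y) % 2 ^ w
  | .sub, x, y => x - y
  | .mul, x, y => (x * y) % 2 ^ w
  | .div, x, y => x / y

/-- The comparisons. -/
inductive Cmp
  | lt | le | eq | ne

/-- Meaning of the comparisons. -/
def Cmp.Holds : Cmp → ℕ → ℕ → Prop
  | .lt, x, y => x < y
  | .le, x, y => x ≤ y
  | .eq, x, y => x = y
  | .ne, x, y => x ≠ y

/-- Programs. Registers are numbered; `a`, `b`, `d` are register numbers, and `k` is a constant
that is part of the program. -/
inductive Cmd
  /-- do nothing -/
  | skip
  /-- `reg d := k` -/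
  | const (d k : ℕ)
  /-- `reg d := reg a` -/
  | move (d a : ℕ)
  /-- `reg d := reg a ∘ reg b` -/
  | arith (o : Op) (d a b : ℕ)
  /-- `reg d := mem (reg a)` -/
  | load (d a : ℕ)
  /-- `mem (reg a) := reg b` -/
  | store (a b : ℕ)
  /-- first `c₁`, then `c₂` -/
  | seq (c₁ c₂ : Cmd)
  /-- if the comparison of `reg a` with `reg b` holds, then `c₁`, else `c₂` -/
  | ite (o : Cmp) (a b : ℕ) (c₁ c₂ : Cmd)
  /-- while the comparison of `reg a` with `reg b` holds, do `c` -/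
  | loop (o : Cmp) (a b : ℕ) (c : Cmd)

/-- Contents of the registers and of the memory. -/
structure State where
  reg : ℕ → ℕ
  mem : ℕ → ℕ

/-- The state `s` with `reg d` replaced by `x`. -/
def State.setReg (s : State) (d x : ℕ) : State :=
  { s with reg := Function.update s.reg d x }

/-- The state `s` with the content of the memory cell `i` replaced by `x`. -/
def State.setMem (s : State) (i x : ℕ) : State :=
  { s with mem := Function.update s.mem i x }

/-- `Exec w c s t s'`: with word size `w`, the program `c`, started in the state `s`, terminates
after exactly `t` steps in the state `s'`. -/
inductive Exec (w : ℕ) : Cmd → State → ℕ → State → Prop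
  | skip (s) : Exec w .skip s 1 s
  | const (d k s) : Exec w (.const d k) s 1 (s.setReg d (k % 2 ^ w))
  | move (d a s) : Exec w (.move d a) s 1 (s.setReg d (s.reg a))
  | arith (o d a b s) :
      Exec w (.arith o d a b) s 1 (s.setReg d (o.eval w (s.reg a) (s.reg b)))
  | load (d a s) : Exec w (.load d a) s 1 (s.setReg d (s.mem (s.reg a)))
  | store (a b s) : Exec w (.store a b) s 1 (s.setMem (s.reg a) (s.reg b))
  | seq {c₁ c₂ s t₁ s₁ t₂ s₂} :
      Exec w c₁ s t₁ s₁ → Exec w c₂ s₁ t₂ s₂ → Exec w (.seq c₁ c₂) s (t₁ + t₂) s₂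
  | ite_true {o a b c₁ c₂ s t s'} :
      o.Holds (s.reg a) (s.reg b) → Exec w c₁ s t s' → Exec w (.ite o a b c₁ c₂) s (1 + t) s'
  | ite_false {o a b c₁ c₂ s t s'} :
      ¬ o.Holds (s.reg a) (s.reg b) → Exec w c₂ s t s' → Exec w (.ite o a b c₁ c₂) s (1 + t) s'
  | loop_true {o a b c s t₁ s₁ t₂ s₂} :
      o.Holds (s.reg a) (s.reg b) → Exec w c s t₁ s₁ → Exec w (.loop o a b c) s₁ t₂ s₂ →
      Exec w (.loop o a b c) s (1 + t₁ + t₂) s₂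
  | loop_false {o a b c s} :
      ¬ o.Holds (s.reg a) (s.reg b) → Exec w (.loop o a b c) s 1 s

end WordRAM

section DynamicDFS

variable {n : ℕ}

/-- The initial state: register `0` holds `n`, register `1` the number of edges, the memory cells
`2 * i` and `2 * i + 1` hold the end vertices of the `i`-th edge of the list `E`, and all else
is `0`. -/
def initState (n : ℕ) (E : List (Fin n × Fin n)) : State where
  reg i := if i = 0 then n else if i = 1 then E.length else 0
  mem i := (E.flatMap fun e => [(e.1 : ℕ), (e.2 : ℕ)]).getD i 0

/-- The number that stands for a vertex of `addRoot G`; the dummy vertex has the number `n`. -/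
def vertexCode : Option (Fin n) → ℕ
  | none => n
  | some v => v

/-- The state `s` reports a DFS tree of `addRoot G`, rooted at the dummy vertex: register `2` holds
the address of an array whose `v`-th entry, for every vertex `v` of `G`, is the parent of `v`. -/
def ReportsDFSTree (G : SimpleGraph (Fin n)) (s : State) : Prop :=
  ∃ T : SimpleGraph (Option (Fin n)), IsDFSTree (addRoot G) none T ∧
    ∀ v : Fin n, ∃ p, IsParent T none p (some v) ∧ s.mem (s.reg 2 + v) = vertexCode p

/-- The program `upd` handles the edge insertions `(u₁, v₁), (u₂, v₂), …`, which arrive one by one,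
when it starts from the graph `G` and the state `s`: if each of them is a new edge, then for each,
`upd` is run on the current state with `uᵢ` and `vᵢ` put into the registers `0` and `1`,
terminates within `B` steps, and reports a DFS tree of the current graph. -/
def HandlesInsertions (w : ℕ) (upd : Cmd) (B : ℝ) :
    SimpleGraph (Fin n) → State → List (Fin n × Fin n) → Prop
  | _, _, [] => True
  | G, s, (u, v) :: l => u ≠ v → ¬ G.Adj u v →
      ∃ (t : ℕ) (s' : State), Exec w upd ((s.setReg 0 u).setReg 1 v) t s' ∧ (t : ℝ) ≤ B ∧
        ReportsDFSTree (G ⊔ SimpleGraph.edge u v) s' ∧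
        HandlesInsertions w upd B (G ⊔ SimpleGraph.edge u v) s' l

end DynamicDFS

end IncDFS

set_option linter.constructorNameAsVariable false
set_option linter.unusedSimpArgs false

namespace IncDFS

/-! ### A language with named variables and arrays on top of the word RAM -/

/-! A DFS tree of an older graph makes it cheap to find one of the current graph while only O(n)
edges are more recent. Number the vertices of the old (base) tree in preorder, so that subtrees are
intervals, and keep for every vertex the sorted list of the numbers of its old neighbours. When the
new search enters an unvisited region at `z`, it walks along the base tree from `z` up to the
topmost unvisited vertex `w`. What remains of the subtree of `w` falls into subtrees hanging from
this path, and no old edge joins two of them, since old edges are back edges. For each hanging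
subtree one old edge is enough: the one whose end on the path is topmost, that is, visited last. The
recent edges are all listed in addition.

The reason is the invariant `conn` of `Round`: if an unvisited `x` has a visited neighbour `y`, then
the unvisited component of `x` is listed at a vertex of the stack that was visited no earlier than
`y`. So a vertex with an exhausted list has no unvisited neighbour and may be left (`Round.leave`);
walking along a path keeps the invariant (`Round.enter`). Hence the search, although it sees few
edges, is a genuine depth first search of the whole graph, and `Search.finished` extracts its
preorder intervals and back edges.

Time: the edge for a hanging subtree is found by one binary search per vertex of that subtree, or
one per vertex of the path above it. If the subtree has at most half the size of the subtree of `w`,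
the subtree is scanned, which is paid from a potential of order s log s per unvisited subtree of
size s. Otherwise the path is scanned; this occurs for at most one hanging subtree per path, and is
charged to the vertices of the path, each visited only once (`child_cost`, `childCode_spec`,
`enterCode_spec`). With the logarithm of the binary search this gives O(n log² n) plus the number of
recent edges for a search (`searchCode_spec`, `treeReserve_le`); the bound with log³ leaves slack.

To make this a worst-case bound, two base trees are kept in two buffers. The tree reported at some
moment is stored as the next base tree, and its sorted lists are built during the following n
insertions, one vertex in each: the vertices are taken in the order of their numbers, and each
appends its number to the lists of its neighbours, so no sorting is needed. Then the buffers change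
roles (`updCode_spec`). At any time at most 2n edges are more recent than the base tree. The
preprocessing is the same search with the edgeless graph as the old graph: its tree is a star, all
edges count as recent, and the subtrees have size 1, so the potential is only O(n log n)
(`starCode_spec`, `preCode_spec`).

The program is written in a small language with named variables, arrays and exact arithmetic, and is
compiled to the word RAM with a constant factor in time (`Run.compile`). Its correctness and cost
are proved together by weakest preconditions with time credits, so that the amortized analysis is
part of the loop invariants. -/

/-- The variables; each of them lives in a register. -/
inductive Var
  | r0 | r1 | out | n | m | N | e | s0 | s1 | T | g | k | i | u | v | p | j | c | x | w | q
  | prev | z | t | cur | best | bz | lo | hi | mid | res | y | si | sl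
  deriving DecidableEq

/-- The arrays. The array `raw` is the initial segment of the memory. -/
inductive Arr
  | raw | ahead | anext | ato | ord | inv | P | E | D | cnt | snap | head | next | dst
  | num | fin | Q | tnum | tpar | tfin
  deriving DecidableEq

theorem Var.ctorIdx_injective {x y : Var} (h : x.ctorIdx = y.ctorIdx) : x = y := by
  rw [← Var.ofNat_ctorIdx x, h, Var.ofNat_ctorIdx]

theorem Arr.ctorIdx_injective {x y : Arr} (h : x.ctorIdx = y.ctorIdx) : x = y := by
  rw [← Arr.ofNat_ctorIdx x, h, Arr.ofNat_ctorIdx]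

/-- Register 90 is reserved for the start of the arrays and the registers from 100 on for evaluating
expressions, so variables must stay below 90. The order of the constructors puts `r0`, `r1` and
`out` into the registers 0, 1 and 2 through which the machine receives its input and reports. -/
theorem Var.ctorIdx_lt (x : Var) : x.ctorIdx < 90 := by cases x <;> decide

theorem Arr.ctorIdx_lt (f : Arr) : f.ctorIdx < 32 := by cases f <;> decide

/-- Values of the variables and contents of the arrays. -/
structure Store where
  v : Var → ℕ
  a : Arr → ℕ → ℕ

/-- Assignment to a variable. -/
def Store.setv (σ : Store) (x : Var) (k : ℕ) : Store :=
  ⟨fun y => if y = x then k else σ.v y, σ.a⟩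

/-- Assignment to an entry of an array. -/
def Store.seta (σ : Store) (f : Arr) (i k : ℕ) : Store :=
  ⟨σ.v, fun g => if g = f then Function.update (σ.a f) i k else σ.a g⟩

@[simp] theorem Store.setv_v (σ : Store) (x y : Var) (k : ℕ) :
    (σ.setv x k).v y = if y = x then k else σ.v y := rfl

@[simp] theorem Store.setv_a (σ : Store) (x : Var) (k : ℕ) : (σ.setv x k).a = σ.a := rfl

@[simp] theorem Store.seta_v (σ : Store) (f : Arr) (i k : ℕ) : (σ.seta f i k).v = σ.v := rfl

@[simp] theorem Store.seta_a (σ : Store) (f h : Arr) (i k : ℕ) :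
    (σ.seta f i k).a h = if h = f then Function.update (σ.a f) i k else σ.a h := rfl

/-- Word size, start of the arrays in the memory, and a bound for all values that occur. -/
structure Env where
  w : ℕ
  B : ℕ
  M : ℕ
  le_pow : B + 32 * M + 32 ≤ 2 ^ w

/-- The number of entries of an array. -/
def Env.len (env : Env) : Arr → ℕ
  | .raw => env.B
  | _ => env.M

/-- Address of an array entry. -/
def Env.addr (env : Env) : Arr → ℕ → ℕ
  | .raw, i => i
  | f, i => env.B + 32 * i + f.ctorIdx

/-- The array `raw` fills the cells below `B`; the other arrays are interleaved above `B` with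
stride 32. As their indices are below 32, the remainder modulo 32 determines the array and the
quotient the entry. -/
theorem Env.addr_ne (env : Env) {f h : Arr} {i j : ℕ} (hi : i < env.len f) (hj : j < env.len h)
    (hne : ¬ (f = h ∧ i = j)) : env.addr f i ≠ env.addr h j := by
  have hf := f.ctorIdx_lt
  have hh := h.ctorIdx_lt
  have key : ∀ i j, env.B + 32 * i + f.ctorIdx = env.B + 32 * j + h.ctorIdx → f = h ∧ i = j := by
    intro i j hij
    have : f.ctorIdx = h.ctorIdx := by omega
    exact ⟨Arr.ctorIdx_injective this, by omega⟩
  intro heq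
  by_cases hr : f = .raw
  · subst hr
    by_cases hr' : h = .raw
    · subst hr'; exact hne ⟨rfl, heq⟩
    · have : env.addr h j = env.B + 32 * j + h.ctorIdx := by
        cases h <;> first | rfl | exact absurd rfl hr'
      rw [this] at heq
      simp only [addr, len] at heq hi
      omega
  · have h1 : env.addr f i = env.B + 32 * i + f.ctorIdx := by
      cases f <;> first | rfl | exact absurd rfl hr
    by_cases hr' : h = .raw
    · subst hr'
      rw [h1] at heq
      simp only [addr, len] at heq hj
      omega
    · have : env.addr h j = env.B + 32 * j + h.ctorIdx := by
        cases h <;> first | rfl | exact absurd rfl hr'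
      exact hne (key i j (by rw [← h1, ← this, heq]))

/-- The machine state `s` stores `σ`. -/
structure Rep (env : Env) (s : State) (σ : Store) : Prop where
  reg : ∀ x : Var, s.reg x.ctorIdx = σ.v x
  mem : ∀ f i, i < env.len f → s.mem (env.addr f i) = σ.a f i
  base : s.reg 90 = env.B

/-- Expressions. -/
inductive Ex
  | lit (k : ℕ)
  | var (x : Var)
  | op (o : Op) (a b : Ex)
  | get (f : Arr) (i : Ex)

/-- Arithmetic without overflow. -/
def Op.exact : Op → ℕ → ℕ → ℕ
  | .add, x, y => x + y
  | .sub, x, y => x - y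
  | .mul, x, y => x * y
  | .div, x, y => x / y

/-- Value of an expression. -/
def Ex.eval (σ : Store) : Ex → ℕ
  | .lit k => k
  | .var x => σ.v x
  | .op o a b => o.exact (a.eval σ) (b.eval σ)
  | .get f i => σ.a f (i.eval σ)

/-- The evaluation of the expression does not overflow, and all indices are in range. -/
def Ex.Ok (env : Env) (σ : Store) : Ex → Prop
  | .lit k => k ≤ env.M
  | .var _ => True
  | .op .add a b => a.Ok env σ ∧ b.Ok env σ ∧ a.eval σ + b.eval σ ≤ env.M
  | .op .mul a b => a.Ok env σ ∧ b.Ok env σ ∧ a.eval σ * b.eval σ ≤ env.M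
  | .op _ a b => a.Ok env σ ∧ b.Ok env σ
  | .get f i => i.Ok env σ ∧ i.eval σ < env.len f

/-- Code that replaces the index of an entry of `f` in register `d` by its address. -/
def Arr.addrCode (f : Arr) (d : ℕ) : Cmd :=
  if f = .raw then .skip else
    .seq (.const (d + 1) 32) (.seq (.arith .mul d d (d + 1))
      (.seq (.arith .add d d 90) (.seq (.const (d + 1) f.ctorIdx) (.arith .add d d (d + 1)))))

/-- Code that puts the value of an expression into register `d`, using only registers from `d` on. -/
def Ex.comp : Ex → ℕ → Cmd
  | .lit k, d => .const d k
  | .var x, d => .move d x.ctorIdx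
  | .op o a b, d => .seq (a.comp d) (.seq (b.comp (d + 1)) (.arith o d d (d + 1)))
  | .get f i, d => .seq (i.comp d) (.seq (f.addrCode d) (.load d d))

/-- Number of steps for the evaluation of an expression. -/
def Ex.cost : Ex → ℕ
  | .lit _ => 1
  | .var _ => 1
  | .op _ a b => a.cost + (b.cost + 1)
  | .get _ i => i.cost + 6

/-- Statements. -/
inductive Stmt
  | skip
  | set (x : Var) (e : Ex)
  | put (f : Arr) (i e : Ex)
  | seq (c d : Stmt)
  | ite (o : Cmp) (a b : Ex) (c d : Stmt)
  | loop (o : Cmp) (a b : Ex) (c : Stmt)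

/-- `Run env c σ t σ'`: the statement `c` takes the store `σ` to `σ'` without overflow, executing
`t` assignments and tests. -/
inductive Run (env : Env) : Stmt → Store → ℕ → Store → Prop
  | skip (σ) : Run env .skip σ 1 σ
  | set {x e σ} : e.Ok env σ → Run env (.set x e) σ 1 (σ.setv x (e.eval σ))
  | put {f i e σ} : i.Ok env σ → e.Ok env σ → i.eval σ < env.len f →
      Run env (.put f i e) σ 1 (σ.seta f (i.eval σ) (e.eval σ))
  | seq {c d σ t₁ σ₁ t₂ σ₂} :
      Run env c σ t₁ σ₁ → Run env d σ₁ t₂ σ₂ → Run env (.seq c d) σ (t₁ + t₂) σ₂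
  | ite_true {o a b c d σ t σ'} : a.Ok env σ → b.Ok env σ → o.Holds (a.eval σ) (b.eval σ) →
      Run env c σ t σ' → Run env (.ite o a b c d) σ (1 + t) σ'
  | ite_false {o a b c d σ t σ'} : a.Ok env σ → b.Ok env σ → ¬ o.Holds (a.eval σ) (b.eval σ) →
      Run env d σ t σ' → Run env (.ite o a b c d) σ (1 + t) σ'
  | loop_true {o a b c σ t₁ σ₁ t₂ σ₂} : a.Ok env σ → b.Ok env σ →
      o.Holds (a.eval σ) (b.eval σ) → Run env c σ t₁ σ₁ → Run env (.loop o a b c) σ₁ t₂ σ₂ →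
      Run env (.loop o a b c) σ (1 + t₁ + t₂) σ₂
  | loop_false {o a b c σ} : a.Ok env σ → b.Ok env σ → ¬ o.Holds (a.eval σ) (b.eval σ) →
      Run env (.loop o a b c) σ 1 σ

/-- The RAM program for a statement. -/
def Stmt.comp : Stmt → Cmd
  | .skip => .skip
  | .set x e => .seq (e.comp 100) (.move x.ctorIdx 100)
  | .put f i e => .seq (i.comp 100) (.seq (f.addrCode 100) (.seq (e.comp 101) (.store 100 101)))
  | .seq c d => .seq c.comp d.comp
  | .ite o a b c d => .seq (a.comp 100) (.seq (b.comp 101) (.ite o 100 101 c.comp d.comp))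
  | .loop o a b c => .seq (.seq (a.comp 100) (b.comp 101))
      (.loop o 100 101 (.seq c.comp (.seq (a.comp 100) (b.comp 101))))

/-- The factor between running times of a statement and of its RAM program. -/
def Stmt.width : Stmt → ℕ
  | .skip => 1
  | .set _ e => e.cost + 1
  | .put _ i e => i.cost + e.cost + 6
  | .seq c d => c.width + d.width
  | .ite _ a b c d => a.cost + b.cost + 1 + c.width + d.width
  | .loop _ a b c => a.cost + b.cost + 1 + c.width

/-! ### Correctness of the compiler. -/

theorem Rep.of_eq {env : Env} {s s' : State} {σ : Store} (h : Rep env s σ) (hm : s'.mem = s.mem)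
    (hr : ∀ r < 100, s'.reg r = s.reg r) : Rep env s' σ :=
  ⟨fun x => by rw [hr _ (x.ctorIdx_lt.trans (by norm_num)), h.reg], fun f i hi => by
    rw [hm, h.mem f i hi], by rw [hr _ (by norm_num), h.base]⟩

theorem addr_of_ne_raw (env : Env) {f : Arr} (hf : f ≠ .raw) (i : ℕ) :
    env.addr f i = env.B + 32 * i + f.ctorIdx := by
  cases f <;> first | rfl | exact absurd rfl hf

theorem len_of_ne_raw (env : Env) {f : Arr} (hf : f ≠ .raw) : env.len f = env.M := by
  cases f <;> first | rfl | exact absurd rfl hf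

theorem addrCode_spec {env : Env} {s : State} (f : Arr) {d i : ℕ} (hd : 100 ≤ d)
    (hB : s.reg 90 = env.B) (hr : s.reg d = i) (hi : i < env.len f) :
    ∃ t s', Exec env.w (f.addrCode d) s t s' ∧ t ≤ 5 ∧ s'.mem = s.mem ∧
      (∀ r < d, s'.reg r = s.reg r) ∧ s'.reg d = env.addr f i := by
  have hle := env.le_pow
  by_cases hf : f = .raw
  · subst hf
    refine ⟨1, s, ?_, by norm_num, rfl, fun _ _ => rfl, hr⟩
    rw [Arr.addrCode, if_pos rfl]
    exact .skip s
  · have hlt := f.ctorIdx_lt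
    rw [len_of_ne_raw env hf] at hi
    rw [Arr.addrCode, if_neg hf]
    refine ⟨_, _, .seq (.const _ _ _) (.seq (.arith _ _ _ _ _) (.seq (.arith _ _ _ _ _)
        (.seq (.const _ _ _) (.arith _ _ _ _ _)))), by norm_num, ?_⟩
    · have h1 : (90 : ℕ) ≠ d := by omega
      have h2 : (90 : ℕ) ≠ d + 1 := by omega
      have e1 : 32 % 2 ^ env.w = 32 := Nat.mod_eq_of_lt (by omega)
      have e2 : f.ctorIdx % 2 ^ env.w = f.ctorIdx := Nat.mod_eq_of_lt (by omega)
      have e3 : i * 32 % 2 ^ env.w = i * 32 := Nat.mod_eq_of_lt (by omega)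
      have e4 : (i * 32 + env.B) % 2 ^ env.w = i * 32 + env.B := Nat.mod_eq_of_lt (by omega)
      have e5 : (i * 32 + env.B + f.ctorIdx) % 2 ^ env.w = i * 32 + env.B + f.ctorIdx :=
        Nat.mod_eq_of_lt (by omega)
      refine ⟨rfl, ?_, ?_⟩
      · intro r hrd
        have h3 : r ≠ d := by omega
        have h4 : r ≠ d + 1 := by omega
        simp [State.setReg, Function.update_apply, h3, h4]
      · rw [addr_of_ne_raw env hf]
        simp [State.setReg, Function.update_apply, h1, h2, hr, hB, Op.eval, e1, e2, e3, e4, e5]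
        omega

/-- Registers are used as a stack: the value of the first operand waits in register `d` while the
second is computed from `d + 1` on. That nothing below `d` changes is what makes the induction work,
and also what protects the variables. -/
theorem Ex.comp_spec {env : Env} {σ : Store} (e : Ex) : ∀ {s : State} {d : ℕ}, Rep env s σ →
    e.Ok env σ → 100 ≤ d → ∃ t s', Exec env.w (e.comp d) s t s' ∧ t ≤ e.cost ∧ s'.mem = s.mem ∧
      (∀ r < d, s'.reg r = s.reg r) ∧ s'.reg d = e.eval σ := by
  have hle := env.le_pow
  induction e with
  | lit k =>
    intro s d _ hok _
    refine ⟨_, _, .const _ _ _, le_rfl, rfl, fun r hr => ?_, ?_⟩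
    · simp [State.setReg, Function.update_apply, hr.ne]
    · simp only [State.setReg, Function.update_self, Ex.eval]
      simp only [Ex.Ok] at hok
      exact Nat.mod_eq_of_lt (by omega)
  | var x =>
    intro s d h _ _
    refine ⟨_, _, .move _ _ _, le_rfl, rfl, fun r hr => ?_, ?_⟩
    · simp [State.setReg, Function.update_apply, hr.ne]
    · simp [State.setReg, Function.update_self, Ex.eval, h.reg]
  | op o a b iha ihb =>
    intro s d h hok hd
    have hab : a.Ok env σ ∧ b.Ok env σ := by
      cases o <;> simp only [Ex.Ok] at hok <;> tauto
    obtain ⟨t1, s1, h1, hc1, hm1, hr1, hv1⟩ := iha h hab.1 hd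
    have hR1 : Rep env s1 σ := h.of_eq hm1 fun r hr => hr1 r (by omega)
    obtain ⟨t2, s2, h2, hc2, hm2, hr2, hv2⟩ := ihb (d := d + 1) hR1 hab.2 (by omega)
    refine ⟨_, _, .seq h1 (.seq h2 (.arith _ _ _ _ _)), by simp only [Ex.cost]; omega,
      by rw [← hm1, ← hm2]; rfl, fun r hr => ?_, ?_⟩
    · simp only [State.setReg, Function.update_apply, hr.ne, if_false]
      rw [hr2 r (by omega), hr1 r hr]
    · simp only [State.setReg, Function.update_self, Ex.eval]
      rw [hv2, hr2 d (by omega), hv1]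
      cases o <;> simp only [Ex.Ok] at hok <;> simp only [Op.eval, Op.exact]
      · exact Nat.mod_eq_of_lt (by omega)
      · exact Nat.mod_eq_of_lt (by omega)
  | get f i ih =>
    intro s d h hok hd
    obtain ⟨t1, s1, h1, hc1, hm1, hr1, hv1⟩ := ih h hok.1 hd
    have hR1 : Rep env s1 σ := h.of_eq hm1 fun r hr => hr1 r (by omega)
    obtain ⟨t2, s2, h2, hc2, hm2, hr2, hv2⟩ := addrCode_spec f hd hR1.base hv1 hok.2
    refine ⟨_, _, .seq h1 (.seq h2 (.load _ _ _)), by simp only [Ex.cost]; omega,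
      by rw [← hm1, ← hm2]; rfl, fun r hr => ?_, ?_⟩
    · simp only [State.setReg, Function.update_apply, hr.ne, if_false]
      rw [hr2 r hr, hr1 r hr]
    · simp only [State.setReg, Function.update_self, Ex.eval]
      rw [hv2, hm2, hm1]
      exact h.mem f _ hok.2

theorem Rep.setv {env : Env} {s : State} {σ : Store} (h : Rep env s σ) (x : Var) (k : ℕ) :
    Rep env (s.setReg x.ctorIdx k) (σ.setv x k) := by
  refine ⟨fun y => ?_, fun f i hi => h.mem f i hi, ?_⟩
  · by_cases hy : y = x
    · subst hy; simp [State.setReg]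
    · have : y.ctorIdx ≠ x.ctorIdx := fun h => hy (Var.ctorIdx_injective h)
      simp [State.setReg, Function.update_apply, this, hy, h.reg]
  · have : 90 ≠ x.ctorIdx := x.ctorIdx_lt.ne'
    simp [State.setReg, Function.update_apply, this, h.base]

theorem Rep.seta {env : Env} {s : State} {σ : Store} (h : Rep env s σ) (f : Arr) {i : ℕ} (k : ℕ)
    (hi : i < env.len f) : Rep env (s.setMem (env.addr f i) k) (σ.seta f i k) := by
  refine ⟨h.reg, fun f' j hj => ?_, h.base⟩
  by_cases hne : f' = f ∧ j = i
  · obtain ⟨rfl, rfl⟩ := hne; simp [State.setMem]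
  · have h1 := env.addr_ne hj hi hne
    simp only [State.setMem, Function.update_apply, h1, if_false, h.mem f' j hj, Store.seta_a]
    by_cases hf : f' = f
    · subst hf
      have : j ≠ i := fun h => hne ⟨rfl, h⟩
      simp [this]
    · simp [hf]

theorem comp_pair_spec {env : Env} {σ : Store} {s : State} (a b : Ex) (h : Rep env s σ)
    (ha : a.Ok env σ) (hb : b.Ok env σ) :
    ∃ t s', Exec env.w (.seq (a.comp 100) (b.comp 101)) s t s' ∧ t ≤ a.cost + b.cost ∧
      Rep env s' σ ∧ s'.reg 100 = a.eval σ ∧ s'.reg 101 = b.eval σ := by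
  obtain ⟨t1, s1, h1, hc1, hm1, hr1, hv1⟩ := a.comp_spec h ha le_rfl
  have hR1 : Rep env s1 σ := h.of_eq hm1 hr1
  obtain ⟨t2, s2, h2, hc2, hm2, hr2, hv2⟩ := b.comp_spec (d := 101) hR1 hb (by norm_num)
  exact ⟨_, _, .seq h1 h2, by omega, hR1.of_eq hm2 fun r hr => hr2 r (by omega),
    by rw [hr2 _ (by norm_num), hv1], hv2⟩

/-- The machine tests registers 100 and 101, so the compiled loop starts with both operands
evaluated and evaluates them again at the end of each round. The summand `a.cost + b.cost` on the
left is the allowance for the evaluation before the loop. -/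
theorem Run.compile_loop {env : Env} {o : Cmp} {a b : Ex} {c : Stmt} {σ σ' : Store} {t : ℕ}
    (hc : ∀ {σ σ' : Store} {t : ℕ} {s : State}, Run env c σ t σ' → Rep env s σ →
      ∃ t' s', Exec env.w c.comp s t' s' ∧ t' ≤ c.width * t ∧ Rep env s' σ')
    {l : Stmt} (hl : l = .loop o a b c) (h : Run env l σ t σ') : ∀ {s : State}, Rep env s σ →
    s.reg 100 = a.eval σ → s.reg 101 = b.eval σ →
    ∃ t' s', Exec env.w (.loop o 100 101 (.seq c.comp (.seq (a.comp 100) (b.comp 101)))) s t' s' ∧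
      t' + (a.cost + b.cost) ≤ (a.cost + b.cost + 1 + c.width) * t ∧ Rep env s' σ' := by
  induction h with
  | loop_false ha hb hn =>
    cases hl
    intro s hs h0 h1
    exact ⟨1, s, .loop_false (by rwa [h0, h1]), by omega, hs⟩
  | @loop_true _ _ _ _ σ t₁ σ₁ t₂ σ₂ ha hb hh h1 h2 _ ih =>
    cases hl
    intro s hs hr0 hr1
    obtain ⟨u1, s1, e1, l1, R1⟩ := hc h1 hs
    have hok : a.Ok env σ₁ ∧ b.Ok env σ₁ := by cases h2 <;> exact ⟨‹_›, ‹_›⟩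
    obtain ⟨u2, s2, e2, l2, R2, v2, v2'⟩ := comp_pair_spec a b R1 hok.1 hok.2
    obtain ⟨u3, s3, e3, l3, R3⟩ := ih rfl R2 v2 v2'
    refine ⟨_, s3, .loop_true (by rwa [hr0, hr1]) (.seq e1 e2) e3, ?_, R3⟩
    nlinarith [Nat.zero_le (c.width), Nat.zero_le ((a.cost + b.cost) * t₁)]
  | _ => cases hl

theorem Run.compile {env : Env} (c : Stmt) : ∀ {σ σ' : Store} {t : ℕ} {s : State},
    Run env c σ t σ' → Rep env s σ →
    ∃ t' s', Exec env.w c.comp s t' s' ∧ t' ≤ c.width * t ∧ Rep env s' σ' := by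
  induction c with
  | skip =>
    intro σ σ' t s h hs
    cases h
    exact ⟨1, s, .skip s, le_rfl, hs⟩
  | set x e =>
    intro σ σ' t s h hs
    cases h with
    | set hok =>
    obtain ⟨t1, s1, h1, hc1, hm1, hr1, hv1⟩ := e.comp_spec hs hok le_rfl
    refine ⟨_, _, .seq h1 (.move _ _ _), by simp only [Stmt.width]; omega, ?_⟩
    rw [hv1]
    exact (hs.of_eq hm1 hr1).setv x _
  | put f i e =>
    intro σ σ' t s h hs
    cases h with
    | put hi he hlt =>
    obtain ⟨t1, s1, h1, hc1, hm1, hr1, hv1⟩ := i.comp_spec hs hi le_rfl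
    have hR1 := hs.of_eq hm1 hr1
    obtain ⟨t2, s2, h2, hc2, hm2, hr2, hv2⟩ := addrCode_spec f le_rfl hR1.base hv1 hlt
    have hR2 := hR1.of_eq hm2 hr2
    obtain ⟨t3, s3, h3, hc3, hm3, hr3, hv3⟩ := e.comp_spec (d := 101) hR2 he (by norm_num)
    have hR3 := hR2.of_eq hm3 fun r hr => hr3 r (by omega)
    refine ⟨_, _, .seq h1 (.seq h2 (.seq h3 (.store _ _ _))), by simp only [Stmt.width]; omega, ?_⟩
    rw [hv3, hr3 _ (by norm_num), hv2]
    exact hR3.seta f _ hlt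
  | seq c d ihc ihd =>
    intro σ σ' t s h hs
    cases h with
    | @seq _ _ _ t₁ σ₁ t₂ _ h1 h2 =>
    obtain ⟨u1, s1, e1, l1, R1⟩ := ihc h1 hs
    obtain ⟨u2, s2, e2, l2, R2⟩ := ihd h2 R1
    refine ⟨_, s2, .seq e1 e2, ?_, R2⟩
    simp only [Stmt.width]
    nlinarith [Nat.zero_le (c.width * t₂), Nat.zero_le (d.width * t₁)]
  | ite o a b c d ihc ihd =>
    intro σ σ' t s h hs
    cases h with
    | @ite_true _ _ _ _ _ _ t _ ha hb hh h1 =>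
      obtain ⟨t1, s1, h1', hc1, hm1, hr1, hv1⟩ := a.comp_spec hs ha le_rfl
      have hR1 := hs.of_eq hm1 hr1
      obtain ⟨t2, s2, h2', hc2, hm2, hr2, hv2⟩ := b.comp_spec (d := 101) hR1 hb (by norm_num)
      have hR2 := hR1.of_eq hm2 fun r hr => hr2 r (by omega)
      obtain ⟨u1, s3, e1, l1, R1⟩ := ihc h1 hR2
      refine ⟨_, s3, .seq h1' (.seq h2' (.ite_true ?_ e1)), ?_, R1⟩
      · rw [hv2, hr2 _ (by norm_num), hv1]; exact hh
      · simp only [Stmt.width]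
        nlinarith [Nat.zero_le (c.width), Nat.zero_le (d.width * t), Nat.zero_le (d.width),
          Nat.zero_le ((a.cost + b.cost) * t)]
    | @ite_false _ _ _ _ _ _ t _ ha hb hh h1 =>
      obtain ⟨t1, s1, h1', hc1, hm1, hr1, hv1⟩ := a.comp_spec hs ha le_rfl
      have hR1 := hs.of_eq hm1 hr1
      obtain ⟨t2, s2, h2', hc2, hm2, hr2, hv2⟩ := b.comp_spec (d := 101) hR1 hb (by norm_num)
      have hR2 := hR1.of_eq hm2 fun r hr => hr2 r (by omega)
      obtain ⟨u1, s3, e1, l1, R1⟩ := ihd h1 hR2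
      refine ⟨_, s3, .seq h1' (.seq h2' (.ite_false ?_ e1)), ?_, R1⟩
      · rw [hv2, hr2 _ (by norm_num), hv1]; exact hh
      · simp only [Stmt.width]
        nlinarith [Nat.zero_le (c.width), Nat.zero_le (c.width * t), Nat.zero_le (d.width),
          Nat.zero_le ((a.cost + b.cost) * t)]
  | loop o a b c ihc =>
    intro σ σ' t s h hs
    have hok : a.Ok env σ ∧ b.Ok env σ := by cases h <;> exact ⟨‹_›, ‹_›⟩
    obtain ⟨u2, s2, e2, l2, R2, v2, v2'⟩ := comp_pair_spec a b hs hok.1 hok.2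
    obtain ⟨u3, s3, e3, l3, R3⟩ := Run.compile_loop ihc rfl h R2 v2 v2'
    exact ⟨_, s3, .seq e2 e3, by simp only [Stmt.width]; omega, R3⟩

/-! ### Weakest preconditions with time credits -/

/-- Started in the store `σ` with `a` time credits, `c` terminates in a store and with a remaining
number of credits that satisfy `Q`. -/
def WP (env : Env) (c : Stmt) (σ : Store) (a : ℤ) (Q : Store → ℤ → Prop) : Prop :=
  ∃ t σ', Run env c σ t σ' ∧ Q σ' (a - t)

theorem WP_skip {env : Env} {σ : Store} {a : ℤ} {Q : Store → ℤ → Prop} :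
    WP env .skip σ a Q ↔ Q σ (a - 1) := by
  constructor
  · rintro ⟨t, σ', h, hq⟩; cases h; exact hq
  · exact fun h => ⟨1, σ, .skip σ, h⟩

theorem WP_set {env : Env} {x : Var} {e : Ex} {σ : Store} {a : ℤ} {Q : Store → ℤ → Prop} :
    WP env (.set x e) σ a Q ↔ e.Ok env σ ∧ Q (σ.setv x (e.eval σ)) (a - 1) := by
  constructor
  · rintro ⟨t, σ', h, hq⟩; cases h; exact ⟨‹_›, hq⟩
  · exact fun h => ⟨1, _, .set h.1, h.2⟩

theorem WP_put {env : Env} {f : Arr} {i e : Ex} {σ : Store} {a : ℤ} {Q : Store → ℤ → Prop} :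
    WP env (.put f i e) σ a Q ↔ i.Ok env σ ∧ e.Ok env σ ∧ i.eval σ < env.len f ∧
      Q (σ.seta f (i.eval σ) (e.eval σ)) (a - 1) := by
  constructor
  · rintro ⟨t, σ', h, hq⟩; cases h; exact ⟨‹_›, ‹_›, ‹_›, hq⟩
  · exact fun h => ⟨1, _, .put h.1 h.2.1 h.2.2.1, h.2.2.2⟩

theorem WP_seq {env : Env} {c d : Stmt} {σ : Store} {a : ℤ} {Q : Store → ℤ → Prop} :
    WP env (.seq c d) σ a Q ↔ WP env c σ a fun σ' b => WP env d σ' b Q := by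
  constructor
  · rintro ⟨t, σ', h, hq⟩
    cases h with
    | seq h1 h2 =>
    refine ⟨_, _, h1, _, _, h2, ?_⟩
    push_cast at hq
    rwa [← sub_sub] at hq
  · rintro ⟨t, σ', h, t', σ'', h', hq⟩
    refine ⟨_, _, .seq h h', ?_⟩
    push_cast
    rwa [← sub_sub]

theorem WP_ite {env : Env} {o : Cmp} {x y : Ex} {c d : Stmt} {σ : Store} {a : ℤ}
    {Q : Store → ℤ → Prop} :
    WP env (.ite o x y c d) σ a Q ↔ x.Ok env σ ∧ y.Ok env σ ∧
      (o.Holds (x.eval σ) (y.eval σ) → WP env c σ (a - 1) Q) ∧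
      (¬ o.Holds (x.eval σ) (y.eval σ) → WP env d σ (a - 1) Q) := by
  constructor
  · rintro ⟨t, σ', h, hq⟩
    cases h with
    | ite_true h1 h2 h3 h4 =>
      push_cast at hq; rw [← sub_sub] at hq
      exact ⟨h1, h2, fun _ => ⟨_, _, h4, hq⟩, fun h => absurd h3 h⟩
    | ite_false h1 h2 h3 h4 =>
      push_cast at hq; rw [← sub_sub] at hq
      exact ⟨h1, h2, fun h => absurd h h3, fun _ => ⟨_, _, h4, hq⟩⟩
  · rintro ⟨h1, h2, h3, h4⟩
    by_cases h : o.Holds (x.eval σ) (y.eval σ)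
    · obtain ⟨t, σ', hr, hq⟩ := h3 h
      refine ⟨_, _, .ite_true h1 h2 h hr, ?_⟩
      push_cast; rwa [← sub_sub]
    · obtain ⟨t, σ', hr, hq⟩ := h4 h
      refine ⟨_, _, .ite_false h1 h2 h hr, ?_⟩
      push_cast; rwa [← sub_sub]

/-- The loop rule. The invariant has a natural number that decreases in each round. -/
theorem WP_loop {env : Env} {o : Cmp} {x y : Ex} {c : Stmt} (I : ℕ → Store → ℤ → Prop)
    (hI : ∀ k σ a, I k σ a → ∀ Q' : Store → ℤ → Prop, (∀ k' σ' b, k' < k → I k' σ' b → Q' σ' b) →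
      x.Ok env σ ∧ y.Ok env σ ∧ (o.Holds (x.eval σ) (y.eval σ) → WP env c σ (a - 1) Q')) :
    ∀ k {σ a} {Q : Store → ℤ → Prop}, I k σ a →
      (∀ k σ' b, I k σ' b → ¬ o.Holds (x.eval σ') (y.eval σ') → Q σ' (b - 1)) →
      WP env (.loop o x y c) σ a Q := by
  intro k
  induction k using Nat.strong_induction_on with
  | _ k ih =>
  intro σ a Q hk hQ
  -- The hypothesis is stated for an arbitrary postcondition so that its users meet a goal without
  -- existential quantifiers; here the postcondition becomes the invariant with a smaller index.
  obtain ⟨h1, h2, h3⟩ := hI k σ a hk (fun σ' b => ∃ k' < k, I k' σ' b)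
    fun k' σ' b h h' => ⟨k', h, h'⟩
  by_cases h : o.Holds (x.eval σ) (y.eval σ)
  · obtain ⟨t, σ', hr, k', hk', hI'⟩ := h3 h
    obtain ⟨t', σ'', hr', hq⟩ := ih k' hk' hI' hQ
    refine ⟨_, _, .loop_true h1 h2 h hr hr', ?_⟩
    push_cast
    rwa [show a - (1 + (t : ℤ) + t') = a - 1 - t - t' by ring]
  · exact ⟨1, σ, .loop_false h1 h2 h, by simpa using hQ k σ a hk h⟩

attribute [irreducible] WP

/-! ### Notation for programs, evaluation of expressions, and frames. -/

instance : Add Ex := ⟨.op .add⟩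
instance : Sub Ex := ⟨.op .sub⟩
instance : Mul Ex := ⟨.op .mul⟩
instance : Div Ex := ⟨.op .div⟩
instance (k : ℕ) : OfNat Ex k := ⟨.lit k⟩

prefix:max "‡" => Ex.var

infixr:30 " ;; " => Stmt.seq

variable {env : Env} {σ : Store}

@[simp] theorem eval_add (a b : Ex) : (a + b).eval σ = a.eval σ + b.eval σ := rfl
@[simp] theorem eval_sub (a b : Ex) : (a - b).eval σ = a.eval σ - b.eval σ := rfl
@[simp] theorem eval_mul (a b : Ex) : (a * b).eval σ = a.eval σ * b.eval σ := rfl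
@[simp] theorem eval_div (a b : Ex) : (a / b).eval σ = a.eval σ / b.eval σ := rfl
@[simp] theorem eval_lit (k : ℕ) : (ofNat(k) : Ex).eval σ = ofNat(k) := rfl
@[simp] theorem eval_var (x : Var) : (Ex.var x).eval σ = σ.v x := rfl
@[simp] theorem eval_get (f : Arr) (i : Ex) : (Ex.get f i).eval σ = σ.a f (i.eval σ) := rfl
@[simp] theorem ok_add (a b : Ex) : (a + b).Ok env σ ↔
    a.Ok env σ ∧ b.Ok env σ ∧ a.eval σ + b.eval σ ≤ env.M := Iff.rfl
@[simp] theorem ok_sub (a b : Ex) : (a - b).Ok env σ ↔ a.Ok env σ ∧ b.Ok env σ := Iff.rfl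
@[simp] theorem ok_mul (a b : Ex) : (a * b).Ok env σ ↔
    a.Ok env σ ∧ b.Ok env σ ∧ a.eval σ * b.eval σ ≤ env.M := Iff.rfl
@[simp] theorem ok_div (a b : Ex) : (a / b).Ok env σ ↔ a.Ok env σ ∧ b.Ok env σ := Iff.rfl
@[simp] theorem ok_lit (k : ℕ) : (ofNat(k) : Ex).Ok env σ ↔ ofNat(k) ≤ env.M := Iff.rfl
@[simp] theorem ok_var (x : Var) : (Ex.var x).Ok env σ := trivial
@[simp] theorem ok_get (f : Arr) (i : Ex) : (Ex.get f i).Ok env σ ↔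
    i.Ok env σ ∧ i.eval σ < env.len f := Iff.rfl

@[simp] theorem holds_lt (x y : ℕ) : Cmp.Holds .lt x y ↔ x < y := Iff.rfl
@[simp] theorem holds_le (x y : ℕ) : Cmp.Holds .le x y ↔ x ≤ y := Iff.rfl
@[simp] theorem holds_eq (x y : ℕ) : Cmp.Holds .eq x y ↔ x = y := Iff.rfl
@[simp] theorem holds_ne (x y : ℕ) : Cmp.Holds .ne x y ↔ x ≠ y := Iff.rfl

/-- `σ'` differs from `σ` at most in the variables `vs` and the arrays `fs`. -/
structure Frame (vs : List Var) (fs : List Arr) (σ σ' : Store) : Prop where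
  v : ∀ x, x ∉ vs → σ'.v x = σ.v x
  a : ∀ f, f ∉ fs → σ'.a f = σ.a f

theorem Frame.refl (vs : List Var) (fs : List Arr) (σ : Store) : Frame vs fs σ σ :=
  ⟨fun _ _ => rfl, fun _ _ => rfl⟩

theorem Frame.setv {vs : List Var} {fs : List Arr} {σ σ' : Store} (h : Frame vs fs σ σ') {x : Var}
    (hx : x ∈ vs) (k : ℕ) : Frame vs fs σ (σ'.setv x k) :=
  ⟨fun y hy => by
    have : y ≠ x := fun h => hy (h ▸ hx)
    simp [this, h.v y hy], h.a⟩

theorem Frame.seta {vs : List Var} {fs : List Arr} {σ σ' : Store} (h : Frame vs fs σ σ') {f : Arr}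
    (hf : f ∈ fs) (i k : ℕ) : Frame vs fs σ (σ'.seta f i k) :=
  ⟨h.v, fun g hg => by
    have : g ≠ f := fun h => hg (h ▸ hf)
    simp [this, h.a g hg]⟩

theorem Frame.trans {vs vs' : List Var} {fs fs' : List Arr} {σ σ' σ'' : Store}
    (h : Frame vs fs σ σ') (h' : Frame vs' fs' σ' σ'') (hv : vs' ⊆ vs) (hf : fs' ⊆ fs) :
    Frame vs fs σ σ'' :=
  ⟨fun x hx => (h'.v x fun hm => hx (hv hm)).trans (h.v x hx),
    fun f hx => (h'.a f fun hm => hx (hf hm)).trans (h.a f hx)⟩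


/-! ### Trees on `1, …, N`, numbered in preorder -/

/-- `P` and `E` describe a tree on `1, …, N`, numbered in preorder: `P j` is the parent of `j`, and
the descendants of `i` are `i, …, E i - 1`. -/
structure NumTree (N : ℕ) (P E : ℕ → ℕ) : Prop where
  one_le : ∀ j, 2 ≤ j → j ≤ N → 1 ≤ P j
  lt : ∀ j, 2 ≤ j → j ≤ N → P j < j
  lt_end : ∀ i, 1 ≤ i → i ≤ N → i < E i
  end_le : ∀ i, 1 ≤ i → i ≤ N → E i ≤ N + 1
  end_one : E 1 = N + 1
  mem : ∀ i j, 1 ≤ i → i ≤ N → 2 ≤ j → j ≤ N → ((i < j ∧ j < E i) ↔ (i ≤ P j ∧ P j < E i))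

section NumTree

variable {N : ℕ} {P E : ℕ → ℕ}

/-- Induction on `k`: the parent of a proper descendant `k` of `j` is a descendant of `j`, hence by
induction of `i`, and the axiom `mem` for `i` carries this back to `k`. -/
theorem NumTree.sub (h : NumTree N P E) {i j k : ℕ} (hi : 1 ≤ i) (hiN : i ≤ N) (hij : i ≤ j)
    (hj : j < E i) (hjk : j ≤ k) (hk : k < E j) : k < E i := by
  induction k using Nat.strong_induction_on with
  | _ k ih =>
  have hE := h.end_le i hi hiN
  have hE' := h.end_le j (by omega) (by omega)
  rcases hjk.eq_or_lt with rfl | hlt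
  · exact hj
  · have h1 := (h.mem j k (by omega) (by omega) (by omega) (by omega)).1 ⟨hlt, hk⟩
    have h2 := h.lt k (by omega) (by omega)
    have h3 := ih (P k) h2 h1.1 h1.2
    exact ((h.mem i k hi hiN (by omega) (by omega)).2 ⟨by omega, h3⟩).2

theorem NumTree.end_le_end (h : NumTree N P E) {i j : ℕ} (hi : 1 ≤ i) (hiN : i ≤ N) (hij : i ≤ j)
    (hj : j < E i) : E j ≤ E i := by
  have hE := h.end_le i hi hiN
  have := h.lt_end j (by omega) (by omega)
  have := h.sub hi hiN hij hj (k := E j - 1) (by omega) (by omega)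
  omega

/-- The next child: if `x < c < E x` and everything between `x` and `c` has its descendants
below `c`, then `c` is a child of `x`. -/
theorem NumTree.child (h : NumTree N P E) {x c : ℕ} (hx : 1 ≤ x) (hxN : x ≤ N) (hxc : x < c)
    (hc : c < E x) (hall : ∀ j, x < j → j < c → E j ≤ c) : P c = x := by
  have hE := h.end_le x hx hxN
  have h1 := (h.mem x c hx hxN (by omega) (by omega)).1 ⟨hxc, hc⟩
  have h2 := h.lt c (by omega) (by omega)
  -- Otherwise the parent of `c` lies strictly between `x` and `c`; its interval should contain `c`,
  -- but by hypothesis it ends at `c` or before.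
  by_contra hne
  have h3 := hall (P c) (by omega) h2
  have h4 := h.lt_end (P c) (by omega) (by omega)
  have := (h.mem (P c) c (by omega) (by omega) (by omega) (by omega)).2 ⟨le_rfl, h4⟩
  omega

/-- Siblings are enumerated by jumping from `c` to `E c`; this keeps the hypothesis of
`NumTree.child` true after the jump. -/
theorem NumTree.next_child (h : NumTree N P E) {x c : ℕ} (hx : 1 ≤ x) (hxN : x ≤ N) (hxc : x < c)
    (hc : c < E x) (hall : ∀ j, x < j → j < c → E j ≤ c) :
    ∀ j, x < j → j < E c → E j ≤ E c := by
  intro j hj hjc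
  have hE := h.end_le x hx hxN
  have h4 := h.lt_end c (by omega) (by omega)
  by_cases hlt : j < c
  · have := hall j hj hlt
    omega
  · exact h.end_le_end (by omega) (by omega) (by omega) hjc

/-- A proper ancestor of `x` is an ancestor of the parent of `x`. -/
theorem NumTree.le_par (h : NumTree N P E) {y x : ℕ} (hy : 1 ≤ y) (hxN : x ≤ N) (hyx : y < x)
    (hx : x < E y) : y ≤ P x :=
  ((h.mem y x hy (by omega) (by omega) hxN).1 ⟨hyx, hx⟩).1

theorem NumTree.par_lt_end (h : NumTree N P E) {y x : ℕ} (hy : 1 ≤ y) (hxN : x ≤ N) (hyx : y < x)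
    (hx : x < E y) : P x < E y :=
  ((h.mem y x hy (by omega) (by omega) hxN).1 ⟨hyx, hx⟩).2

theorem NumTree.lt_end_par (h : NumTree N P E) {x : ℕ} (hx : 2 ≤ x) (hxN : x ≤ N) : x < E (P x) := by
  have h1 := h.one_le x hx hxN
  have h2 := h.lt x hx hxN
  exact ((h.mem (P x) x h1 (by omega) hx hxN).2 ⟨le_rfl, h.lt_end _ h1 (by omega)⟩).2

end NumTree

/-- A base tree, the nontree edges `R` of its graph without the root, all of which are back edges,
and further edges `U`. -/
structure DFSBase (N : ℕ) (P E : ℕ → ℕ) (R U : ℕ → ℕ → Prop) : Prop where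
  tree : NumTree N P E
  one_le : 1 ≤ N
  R_symm : ∀ i j, R i j → R j i
  R_rng : ∀ i j, R i j → 2 ≤ i ∧ i ≤ N
  R_back : ∀ i j, R i j → i < j → j < E i
  par : ∀ j, 2 ≤ j → j ≤ N → P j = 1 ∨ R (P j) j
  U_symm : ∀ i j, U i j → U j i
  U_rng : ∀ i j, U i j → 2 ≤ i ∧ i ≤ N

/-- The edges of the graph with edges `R` and `U` on `2, …, N` and the root `1`. -/
def Edge (N : ℕ) (R U : ℕ → ℕ → Prop) (i j : ℕ) : Prop :=
  R i j ∨ U i j ∨ (i = 1 ∧ 2 ≤ j ∧ j ≤ N) ∨ (j = 1 ∧ 2 ≤ i ∧ i ≤ N)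

theorem DFSBase.edge_symm {N : ℕ} {P E : ℕ → ℕ} {R U : ℕ → ℕ → Prop} (h : DFSBase N P E R U)
    {i j : ℕ} (hij : Edge N R U i j) : Edge N R U j i := by
  rcases hij with h1 | h1 | h1 | h1
  · exact .inl (h.R_symm _ _ h1)
  · exact .inr (.inl (h.U_symm _ _ h1))
  · exact .inr (.inr (.inr h1))
  · exact .inr (.inr (.inl h1))

theorem DFSBase.edge_rng {N : ℕ} {P E : ℕ → ℕ} {R U : ℕ → ℕ → Prop} (h : DFSBase N P E R U)
    {i j : ℕ} (hij : Edge N R U i j) : 1 ≤ i ∧ i ≤ N := by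
  have := h.one_le
  rcases hij with h1 | h1 | h1 | h1
  · have := h.R_rng _ _ h1; omega
  · have := h.U_rng _ _ h1; omega
  · omega
  · omega

theorem DFSBase.edge_par {N : ℕ} {P E : ℕ → ℕ} {R U : ℕ → ℕ → Prop} (h : DFSBase N P E R U)
    {j : ℕ} (hj : 2 ≤ j) (hjN : j ≤ N) : Edge N R U (P j) j := by
  rcases h.par j hj hjN with h1 | h1
  · exact .inr (.inr (.inl ⟨h1, hj, hjN⟩))
  · exact .inl h1

/-! ### Partial depth first searches: visiting and leaving a vertex. -/

/-- End of the interval of descendants during a search. -/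
def curEnd (fin : ℕ → ℕ) (t x : ℕ) : ℕ := if fin x = 0 then t else fin x

/-- A partial depth first search of the graph with edge relation `H` on `1, …, N`. The vertex `x`
has been visited if `num x ≠ 0`, as the vertex number `num x`; it has been left if `fin x ≠ 0`;
`Q` is the parent, `t` the next number, `cur` the current vertex (`0` after the end), and `L y`
lists edges to be explored from `y`, among them all unexplored edges of `U`. -/
structure Search (N : ℕ) (H U : ℕ → ℕ → Prop) (num fin Q : ℕ → ℕ) (t cur : ℕ)
    (L : ℕ → List ℕ) : Prop where
  rng : ∀ x, num x ≠ 0 → 1 ≤ x ∧ x ≤ N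
  lt : ∀ x, num x < t
  inj : ∀ x y, num x ≠ 0 → num x = num y → x = y
  card : ((Finset.Icc 1 N).filter fun x => num x ≠ 0).card + 1 = t
  fin_rng : ∀ x, fin x ≠ 0 → num x ≠ 0 ∧ num x < fin x ∧ fin x ≤ t
  num_one : num 1 = 1
  Q_one : Q 1 = 0
  cur_stk : cur ≠ 0 → num cur ≠ 0 ∧ fin cur = 0
  stk_le : ∀ x, num x ≠ 0 → fin x = 0 → cur ≠ 0 ∧ num x ≤ num cur
  stk_par : ∀ x, num x ≠ 0 → fin x = 0 → x ≠ 1 → fin (Q x) = 0 ∧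
    ∀ y, num y ≠ 0 → fin y = 0 → num y < num x → num y ≤ num (Q x)
  par : ∀ x, num x ≠ 0 → x ≠ 1 → num (Q x) ≠ 0 ∧ num (Q x) < num x ∧ H (Q x) x
  mem : ∀ x j, num x ≠ 0 → num j ≠ 0 → j ≠ 1 → ((num x < num j ∧ num j < curEnd fin t x) ↔
    (num x ≤ num (Q j) ∧ num (Q j) < curEnd fin t x))
  fin_stk : ∀ x y, fin x ≠ 0 → num y ≠ 0 → fin y = 0 → num x ≤ num y → fin x ≤ num y
  back : ∀ a b, H a b → num a ≠ 0 → num a < num b → num b < curEnd fin t a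
  snd : ∀ y z, z ∈ L y → H y z
  cmp : ∀ y z, U y z → num y = 0 → z ∈ L y
  front : ∀ x y, num x = 0 → num y ≠ 0 → H x y → fin y = 0

section Search

variable {N : ℕ} {H U : ℕ → ℕ → Prop} {num fin Q : ℕ → ℕ} {t cur : ℕ} {L : ℕ → List ℕ}

theorem Search.num_zero (h : Search N H U num fin Q t cur L) : num 0 = 0 := by
  by_contra h0
  have := h.rng 0 h0
  omega

theorem Search.t_le (h : Search N H U num fin Q t cur L) : t ≤ N + 1 := by
  rw [← h.card]
  have := Finset.card_filter_le (Finset.Icc 1 N) fun x => num x ≠ 0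
  simp only [Nat.card_Icc] at this
  omega

theorem Search.setL (h : Search N H U num fin Q t cur L) {L' : ℕ → List ℕ}
    (hs : ∀ y z, z ∈ L' y → H y z) (hc : ∀ y z, U y z → num y = 0 → z ∈ L' y) :
    Search N H U num fin Q t cur L' :=
  { h with snd := hs, cmp := hc }

/-- Visiting a new vertex. -/
theorem Search.visit (h : Search N H U num fin Q t cur L) (hsymm : ∀ i j, H i j → H j i)
    {x : ℕ} (hx1 : 1 ≤ x) (hxN : x ≤ N) (hc : cur ≠ 0) (hx : num x = 0) (hH : H cur x) :
    Search N H U (Function.update num x t) fin (Function.update Q x cur) (t + 1) x L := by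
  have ht : t ≠ 0 := by have := h.card; omega
  have hxc : cur ≠ x := by rintro rfl; exact (h.cur_stk hc).1 hx
  have hx1' : x ≠ 1 := by rintro rfl; have := h.num_one; omega
  have hfx : fin x = 0 := by
    by_contra hf; exact (h.fin_rng x hf).1 hx
  have hup : ∀ y, num y ≠ 0 → Function.update num x t y = num y := by
    intro y hy
    rw [Function.update_of_ne]; rintro rfl; exact hy hx
  have hupQ : ∀ y, num y ≠ 0 → Function.update Q x cur y = Q y := by
    intro y hy
    rw [Function.update_of_ne]; rintro rfl; exact hy hx
  have hQne : ∀ y, num y ≠ 0 → y ≠ 1 → Q y ≠ x := by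
    rintro y hy hy1 rfl; exact (h.par y hy hy1).1 hx
  have hendt : ∀ y, fin y ≠ 0 → curEnd fin t y = fin y ∧ curEnd fin (t + 1) y = fin y := by
    intro y hy; simp [curEnd, hy]
  have hends : ∀ y, fin y = 0 → curEnd fin t y = t ∧ curEnd fin (t + 1) y = t + 1 := by
    intro y hy; simp [curEnd, hy]
  have hlt := h.lt
  have hnew : ∀ y, Function.update num x t y ≠ 0 → y = x ∨ num y ≠ 0 := by
    intro y hy
    by_cases hyx : y = x
    · exact .inl hyx
    · rw [Function.update_of_ne hyx] at hy; exact .inr hy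
  constructor
  · intro y hy
    rcases hnew y hy with rfl | hy
    · exact ⟨hx1, hxN⟩
    · exact h.rng y hy
  · intro y
    by_cases hyx : y = x
    · subst hyx; simp
    · rw [Function.update_of_ne hyx]; have := hlt y; omega
  · intro y y' hy hyy
    rcases hnew y hy with rfl | hy0
    · rw [Function.update_self] at hyy
      by_contra hne
      rw [Function.update_of_ne (Ne.symm hne)] at hyy
      have := hlt y'; omega
    · rw [hup y hy0] at hyy
      by_cases hyx : y' = x
      · subst hyx; rw [Function.update_self] at hyy; have := hlt y; omega
      · rw [Function.update_of_ne hyx] at hyy; exact h.inj y y' hy0 hyy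
  · have : (Finset.Icc 1 N).filter (fun y => Function.update num x t y ≠ 0) =
        insert x ((Finset.Icc 1 N).filter fun y => num y ≠ 0) := by
      ext y
      simp only [Finset.mem_filter, Finset.mem_insert, Finset.mem_Icc]
      by_cases hyx : y = x
      · subst hyx; simp [ht, hx1, hxN]
      · simp [hyx]
    rw [this, Finset.card_insert_of_notMem (by simp [hx]), h.card]
  · intro y hy
    have h1 := h.fin_rng y hy
    rw [hup y h1.1]
    omega
  · rw [hup 1 (by have := h.num_one; omega), h.num_one]
  · rw [Function.update_of_ne (Ne.symm hx1'), h.Q_one]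
  · intro _
    simp [ht, hfx]
  · intro y hy hfy
    refine ⟨by omega, ?_⟩
    rw [Function.update_self]
    rcases hnew y hy with rfl | hy0
    · simp
    · rw [hup y hy0]; exact (hlt y).le
  · intro y hy hfy hy1
    rcases hnew y hy with rfl | hy0
    · rw [Function.update_self, Function.update_self]
      refine ⟨(h.cur_stk hc).2, fun y' hy' hfy' hlt' => ?_⟩
      rw [hup cur (h.cur_stk hc).1]
      rcases hnew y' hy' with rfl | hy'0
      · simp at hlt'
      · rw [hup y' hy'0]; exact (h.stk_le y' hy'0 hfy').2
    · rw [hupQ y hy0, hup y hy0]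
      have h1 := h.stk_par y hy0 hfy hy1
      refine ⟨h1.1, fun y' hy' hfy' hlt' => ?_⟩
      rw [hup (Q y) (h.par y hy0 hy1).1]
      rcases hnew y' hy' with rfl | hy'0
      · rw [Function.update_self] at hlt'; have := hlt y; omega
      · rw [hup y' hy'0] at hlt' ⊢; exact h1.2 y' hy'0 hfy' hlt'
  · intro y hy hy1
    rcases hnew y hy with rfl | hy0
    · rw [Function.update_self, Function.update_self, hup cur (h.cur_stk hc).1]
      exact ⟨(h.cur_stk hc).1, hlt cur, hH⟩
    · rw [hupQ y hy0, hup y hy0, hup (Q y) (h.par y hy0 hy1).1]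
      exact h.par y hy0 hy1
  · intro y j hy hj hj1
    rcases hnew j hj with rfl | hj0
    · rw [Function.update_self, Function.update_self, hup cur (h.cur_stk hc).1]
      rcases hnew y hy with rfl | hy0
      · rw [Function.update_self]
        have := hlt cur; omega
      · rw [hup y hy0]
        by_cases hfy : fin y = 0
        · rw [(hends y hfy).2]
          have := h.stk_le y hy0 hfy; have := hlt y; have := hlt cur; omega
        · rw [(hendt y hfy).2]
          have := h.fin_rng y hfy
          -- If `y` has been left, neither side holds: its interval ends at or before `t`, and if it
          -- starts at or before the stack vertex `cur`, it also ends at or before it.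
          have := h.fin_stk y cur hfy (h.cur_stk hc).1 (h.cur_stk hc).2
          omega
    · rw [hup j hj0, hupQ j hj0, hup (Q j) (h.par j hj0 hj1).1]
      have := hlt j
      have := hlt (Q j)
      rcases hnew y hy with rfl | hy0
      · rw [Function.update_self]; omega
      · rw [hup y hy0]
        have hm := h.mem y j hy0 hj0 hj1
        by_cases hfy : fin y = 0
        · rw [(hends y hfy).1] at hm; rw [(hends y hfy).2]; omega
        · rw [(hendt y hfy).1] at hm; rw [(hendt y hfy).2]; omega
  · intro y y' hfy hy' hfy' hle
    have h1 := h.fin_rng y hfy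
    rw [hup y h1.1] at hle
    rcases hnew y' hy' with rfl | hy0
    · rw [Function.update_self]; omega
    · rw [hup y' hy0] at hle ⊢; exact h.fin_stk y y' hfy hy0 hfy' hle
  · intro a b hab ha hltab
    rcases hnew a ha with rfl | ha0
    · rw [Function.update_self] at hltab
      by_cases hba : b = a
      · subst hba; simp at hltab
      · rw [Function.update_of_ne hba] at hltab; have := hlt b; omega
    · by_cases hbx : b = x
      · subst hbx
        -- This is where edges become back edges: `b` was unvisited until now, so its visited
        -- neighbour `a` is still on the stack, and its open interval takes in the new number `t`.
        have := h.front b a hx ha0 (hsymm _ _ hab)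
        rw [Function.update_self, (hends a this).2]; omega
      · rw [Function.update_of_ne hbx] at hltab ⊢
        rw [hup a ha0] at hltab
        have := h.back a b hab ha0 hltab
        have := hlt b
        by_cases hfa : fin a = 0
        · rw [(hends a hfa).2]; omega
        · rw [(hendt a hfa).2]; rw [(hendt a hfa).1] at *; omega
  · exact h.snd
  · intro y z hyz hy
    by_cases hyx : y = x
    · subst hyx; simp [ht] at hy
    · rw [Function.update_of_ne hyx] at hy; exact h.cmp y z hyz hy
  · intro y y' hy hy' hyy
    have hyx : y ≠ x := by rintro rfl; simp [ht] at hy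
    rw [Function.update_of_ne hyx] at hy
    rcases hnew y' hy' with rfl | hy0
    · exact hfx
    · exact h.front y y' hy hy0 hyy

/-- Leaving the current vertex. -/
theorem Search.leave (h : Search N H U num fin Q t cur L) (hc : cur ≠ 0)
    (hn : ∀ x, num x = 0 → ¬ H x cur) :
    Search N H U num (Function.update fin cur t) Q t (Q cur) L := by
  have ht : t ≠ 0 := by have := h.card; omega
  have hcs := h.cur_stk hc
  have hnew : ∀ y, Function.update fin cur t y = 0 → y ≠ cur ∧ fin y = 0 := by
    intro y hy
    by_cases hyc : y = cur
    · subst hyc; simp [ht] at hy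
    · rw [Function.update_of_ne hyc] at hy; exact ⟨hyc, hy⟩
  -- The current vertex has the strictly largest number on the stack.
  have hlt' : ∀ y, num y ≠ 0 → fin y = 0 → y ≠ cur → num y < num cur := by
    intro y hy hfy hyc
    have h1 := (h.stk_le y hy hfy).2
    have h2 : num y ≠ num cur := fun he => hyc (h.inj _ _ hy he)
    omega
  -- The interval of `cur` was open and counted as ending at `t`; closing it at `t` changes no
  -- current end.
  have hend : ∀ y, curEnd (Function.update fin cur t) t y = curEnd fin t y := by
    intro y
    by_cases hyc : y = cur
    · subst hyc; simp [curEnd, hcs.2]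
    · simp [curEnd, Function.update_of_ne hyc]
  have hlt := h.lt
  refine { h with
    fin_rng := ?_, cur_stk := ?_, stk_le := ?_, stk_par := ?_, mem := ?_, fin_stk := ?_
    back := ?_, front := ?_ }
  · intro y hy
    by_cases hyc : y = cur
    · subst hyc; simp only [Function.update_self]; exact ⟨hcs.1, hlt y, le_rfl⟩
    · rw [Function.update_of_ne hyc] at hy ⊢; exact h.fin_rng y hy
  · intro hq
    have h1 : cur ≠ 1 := by intro he; rw [he] at hq; exact hq h.Q_one
    have h2 := h.par cur hcs.1 h1
    refine ⟨h2.1, ?_⟩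
    rw [Function.update_of_ne (by intro he; rw [he] at h2; omega)]
    exact (h.stk_par cur hcs.1 hcs.2 h1).1
  · intro y hy hfy
    obtain ⟨hyc, hfy⟩ := hnew y hfy
    have h0 := hlt' y hy hfy hyc
    have h1 : cur ≠ 1 := by intro he; rw [he, h.num_one] at h0; omega
    have h2 := (h.stk_par cur hcs.1 hcs.2 h1).2 y hy hfy h0
    refine ⟨fun he => ?_, h2⟩
    rw [he, h.num_zero] at h2; omega
  · intro y hy hfy hy1
    obtain ⟨hyc, hfy⟩ := hnew y hfy
    have h1 := h.stk_par y hy hfy hy1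
    refine ⟨?_, fun y' hy' hfy' hl => h1.2 y' hy' (hnew y' hfy').2 hl⟩
    rw [Function.update_of_ne]
    · exact h1.1
    · intro he
      have := (h.par y hy hy1).2.1
      have := hlt' y hy hfy hyc
      rw [he] at *; omega
  · intro y j hy hj hj1
    rw [hend]; exact h.mem y j hy hj hj1
  · intro y y' hfy hy' hfy' hle
    obtain ⟨hyc', hfz⟩ := hnew y' hfy'
    by_cases hyc : y = cur
    · have := hlt' y' hy' hfz hyc'
      rw [hyc] at hle; omega
    · rw [Function.update_of_ne hyc] at hfy ⊢; exact h.fin_stk y y' hfy hy' hfz hle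
  · intro a b hab ha hl
    rw [hend]; exact h.back a b hab ha hl
  · intro y y' hy hy' hyy
    by_cases hyc : y' = cur
    · subst hyc; exact absurd hyy (hn y hy)
    · rw [Function.update_of_ne hyc]; exact h.front y y' hy hy' hyy

end Search

/-! ### Searches that see only listed edges. -/

/-- The edges between unvisited vertices. -/
def Free (H : ℕ → ℕ → Prop) (num : ℕ → ℕ) (x y : ℕ) : Prop := H x y ∧ num x = 0 ∧ num y = 0

/-- A partial depth first search between two rounds of the algorithm: the visited vertices are
closed under taking parents in the base tree, and for every edge from an unvisited vertex `x` to
`y`, the component of `x` is listed at `y` or lower on the stack. -/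
structure Round (N : ℕ) (P : ℕ → ℕ) (H U : ℕ → ℕ → Prop) (num fin Q : ℕ → ℕ) (t cur : ℕ)
    (L : ℕ → List ℕ) : Prop extends Search N H U num fin Q t cur L where
  closed : ∀ j, 2 ≤ j → j ≤ N → num j ≠ 0 → num (P j) ≠ 0
  conn : ∀ x y, num x = 0 → num y ≠ 0 → H x y → ∃ y' z', num y' ≠ 0 ∧ fin y' = 0 ∧
    num y ≤ num y' ∧ z' ∈ L y' ∧ num z' = 0 ∧ Relation.ReflTransGen (Free H num) x z'

section Round

variable {N : ℕ} {P E : ℕ → ℕ} {R U : ℕ → ℕ → Prop} {num fin Q num' Q' : ℕ → ℕ} {t cur t' : ℕ}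
  {L L' : ℕ → List ℕ}

/-- Leaving the current vertex after its list has been worked off. -/
theorem Round.leave {H : ℕ → ℕ → Prop} (h : Round N P H U num fin Q t cur L) (hc : cur ≠ 0)
    (hL : L cur = []) : Round N P H U num (Function.update fin cur t) Q t (Q cur) L := by
  -- An unvisited neighbour would, by `conn`, be represented in the list of a stack vertex with
  -- number at least `num cur`. The only such vertex is `cur`, whose list is empty.
  have hn : ∀ x, num x = 0 → ¬ H x cur := by
    intro x hx hxc
    obtain ⟨y', z', h1, h2, h3, h4, -, -⟩ := h.conn x cur hx (h.cur_stk hc).1 hxc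
    have h5 := (h.stk_le y' h1 h2).2
    have : y' = cur := h.inj _ _ h1 (by omega)
    rw [this, hL] at h4
    simp at h4
  refine { h.toSearch.leave hc hn with closed := h.closed, conn := ?_ }
  intro x y hx hy hxy
  obtain ⟨y', z', h1, h2, h3, h4, h5⟩ := h.conn x y hx hy hxy
  refine ⟨y', z', h1, ?_, h3, h4, h5⟩
  rw [Function.update_of_ne]
  · exact h2
  · rintro rfl
    rw [hL] at h4; simp at h4

/-- Dropping a visited vertex from the list of the current vertex. -/
theorem Round.drop {H : ℕ → ℕ → Prop} (h : Round N P H U num fin Q t cur L) (hc : cur ≠ 0) {z : ℕ}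
    {l : List ℕ} (hL : L cur = z :: l) (hz : num z ≠ 0) :
    Round N P H U num fin Q t cur (Function.update L cur l) := by
  have hs : ∀ y z', z' ∈ Function.update L cur l y → z' ∈ L y := by
    intro y z' hz'
    by_cases hy : y = cur
    · subst hy; rw [Function.update_self] at hz'; rw [hL]; exact List.mem_cons_of_mem _ hz'
    · rwa [Function.update_of_ne hy] at hz'
  refine { h.toSearch.setL (fun y z' hz' => h.snd y z' (hs y z' hz')) ?_ with
    closed := h.closed, conn := ?_ }
  · intro y z' hu hy
    rw [Function.update_of_ne]
    · exact h.cmp y z' hu hy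
    · rintro rfl; exact (h.cur_stk hc).1 hy
  · intro x y hx hy hxy
    obtain ⟨y', z', h1, h2, h3, h4, h5, h6⟩ := h.conn x y hx hy hxy
    refine ⟨y', z', h1, h2, h3, ?_, h5, h6⟩
    by_cases hy : y' = cur
    · subst hy
      rw [Function.update_self]
      rw [hL] at h4
      rcases List.mem_cons.1 h4 with rfl | h4
      · exact absurd h5 hz
      · exact h4
    · rwa [Function.update_of_ne hy]

/-- In a base tree, the descendants of unvisited vertices are unvisited. -/
theorem Round.unvisited {H : ℕ → ℕ → Prop} (h : Round N P H U num fin Q t cur L)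
    (hT : NumTree N P E) {w v : ℕ} (hw : 2 ≤ w) (hwN : w ≤ N) (h0 : num w = 0) (hwv : w ≤ v)
    (hv : v < E w) : num v = 0 := by
  induction v using Nat.strong_induction_on with
  | _ v ih =>
  rcases hwv.eq_or_lt with rfl | hlt
  · exact h0
  · have hE := hT.end_le w (by omega) hwN
    have h1 := (hT.mem w v (by omega) hwN (by omega) (by omega)).1 ⟨hlt, hv⟩
    have h2 := hT.lt v (by omega) (by omega)
    by_contra hne
    exact h.closed v (by omega) (by omega) hne (ih (P v) h2 h1.1 h1.2)

theorem Free.reach_zero {H : ℕ → ℕ → Prop} {num : ℕ → ℕ} {x z : ℕ}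
    (h : Relation.ReflTransGen (Free H num) x z) (hx : num x = 0) : num z = 0 := by
  induction h with
  | refl => exact hx
  | tail _ h _ => exact h.2.2

theorem Free.reach_symm {H : ℕ → ℕ → Prop} {num : ℕ → ℕ} (hH : ∀ i j, H i j → H j i) {x z : ℕ}
    (h : Relation.ReflTransGen (Free H num) x z) : Relation.ReflTransGen (Free H num) z x := by
  induction h with
  | refl => exact .refl
  | tail _ h ih => exact .head ⟨hH _ _ h.1, h.2.2, h.2.1⟩ ih

/-- A path among the unvisited vertices stays among them or meets a newly visited vertex. -/
theorem Free.reach_split {H : ℕ → ℕ → Prop} {num num' : ℕ → ℕ} {x z : ℕ}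
    (h : Relation.ReflTransGen (Free H num) x z) (hx : num' x = 0) :
    Relation.ReflTransGen (Free H num') x z ∨ ∃ x₁ y₁, Relation.ReflTransGen (Free H num') x x₁ ∧
      H x₁ y₁ ∧ num' x₁ = 0 ∧ num' y₁ ≠ 0 ∧ num y₁ = 0 := by
  induction h with
  | refl => exact .inl .refl
  | @tail b c _ hbc ih =>
    rcases ih with ih | ih
    · have hb := Free.reach_zero ih hx
      by_cases hc : num' c = 0
      · exact .inl (ih.tail ⟨hbc.1, hb, hc⟩)
      · exact .inr ⟨b, c, ih, hbc.1, hb, hc, hbc.2.2⟩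
    · exact .inr ih

/-- `y` lies on the path of the base tree from `z` up to `w`. -/
def OnPath (E : ℕ → ℕ) (w z y : ℕ) : Prop := w ≤ y ∧ y ≤ z ∧ z < E y

/-- If there is an edge between the subtree of `c` and the proper ancestors of `c` up to `w`, then
one with the topmost possible ancestor is listed. -/
def Queried (E : ℕ → ℕ) (R : ℕ → ℕ → Prop) (L : ℕ → List ℕ) (w c : ℕ) : Prop :=
  ∀ y v, R y v → w ≤ y → y < c → c ≤ v → v < E c →
    ∃ y' v', w ≤ y' ∧ y' ≤ y ∧ c < E y' ∧ v' ∈ L y' ∧ c ≤ v' ∧ v' < E c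

/-- The path from `z` to `w` is visited upwards, so higher vertices get larger numbers (`hord`). An
edge from a remaining unvisited vertex to the path is either recent, hence listed at its path end by
`cmp`, or goes into a hanging subtree. Such a subtree is connected through its own unvisited tree
edges, so the one edge listed for it, with the topmost end on the path, represents all its edges to
the path. -/
theorem Round.enter (hB : DFSBase N P E R U) (h : Round N P (Edge N R U) U num fin Q t cur L)
    (hc : cur ≠ 0) {z w : ℕ} {l : List ℕ} (hL : L cur = z :: l) (hw : 2 ≤ w) (hwN : w ≤ N)
    (hw0 : num w = 0) (hPw : num (P w) ≠ 0) (hwz : w ≤ z) (hz : z < E w)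
    (hS : Search N (Edge N R U) U num' fin Q' t' w L')
    (hvis : ∀ y, num' y ≠ 0 ↔ num y ≠ 0 ∨ OnPath E w z y)
    (hold : ∀ y, num y ≠ 0 → num' y = num y)
    (hnew : ∀ y, OnPath E w z y → t ≤ num' y)
    (hord : ∀ y y', OnPath E w z y → OnPath E w z y' → y' ≤ y → num' y ≤ num' y')
    (hLL : ∀ y, y ≠ cur → L y ⊆ L' y) (hLc : l ⊆ L' cur)
    (hcov : ∀ v, w ≤ v → v < E w → ¬ OnPath E w z v → ∃ c, 2 ≤ c ∧ c ≤ N ∧ OnPath E w z (P c) ∧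
      c ≤ v ∧ v < E c ∧ (∀ v', c ≤ v' → v' < E c → ¬ OnPath E w z v') ∧ Queried E R L' w c) :
    Round N P (Edge N R U) U num' fin Q' t' w L' := by
  have hT := hB.tree
  have hEw := hT.end_le w (by omega) hwN
  have hun : ∀ v, w ≤ v → v < E w → num v = 0 := fun v h1 h2 => h.unvisited hT hw hwN hw0 h1 h2
  have hpath : ∀ y, OnPath E w z y → y < E w ∧ num y = 0 := fun y hy =>
    ⟨lt_of_le_of_lt hy.2.1 hz, hun y hy.1 (lt_of_le_of_lt hy.2.1 hz)⟩
  have hz' : ∀ y, num' y = 0 ↔ num y = 0 ∧ ¬ OnPath E w z y := by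
    intro y
    have := hvis y
    tauto
  have hfin : ∀ y, OnPath E w z y → fin y = 0 := by
    intro y hy
    by_contra hf
    exact (h.fin_rng y hf).1 (hpath y hy).2
  -- edges to the new path
  have key : ∀ x y, num' x = 0 → OnPath E w z y → Edge N R U x y → ∃ y' z', OnPath E w z y' ∧
      num' y ≤ num' y' ∧ z' ∈ L' y' ∧ num' z' = 0 ∧
        Relation.ReflTransGen (Free (Edge N R U) num') x z' := by
    intro x y hx hy hxy
    obtain ⟨hx0, hxp⟩ := (hz' x).1 hx
    obtain ⟨hyE, hy0⟩ := hpath y hy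
    rcases hxy with hR | hU | hr | hr
    · obtain ⟨hx2, hxN⟩ := hB.R_rng _ _ hR
      -- Otherwise `x` would be a base ancestor of `y`. From `w` downwards these lie on the path;
      -- above `w`, the vertex `P w` would be in the subtree of the unvisited `x`, although it is
      -- visited.
      have hyx : y < x := by
        by_contra hle
        have hne : x ≠ y := fun he => hxp (he ▸ hy)
        have hyx := hB.R_back x y hR (by omega)
        have hEy := hT.end_le_end (i := x) (j := y) (by omega) hxN (by omega) hyx
        obtain ⟨hy1, hy2, hy3⟩ := hy
        by_cases hwx : w ≤ x
        · exact hxp ⟨hwx, by omega, by omega⟩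
        · have h1 := (hT.mem x w (by omega) hxN hw hwN).1 ⟨by omega, by omega⟩
          exact hPw (h.unvisited hT hx2 hxN hx0 h1.1 h1.2)
      have hxy := hB.R_back y x (hB.R_symm _ _ hR) hyx
      have hEy := hT.end_le_end (i := w) (j := y) (by omega) hwN hy.1 hyE
      obtain ⟨c, hc2, hcN, hPc, hcx, hxc, hcp, hq⟩ := hcov x (by have := hy.1; omega) (by omega) hxp
      have hyc : y < c := by
        by_contra hle
        exact hcp y (by omega) (by omega) hy
      -- The listed edge ends at `y' ≤ y`, hence higher on the path and visited no earlier than `y`,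
      -- as `conn` demands.
      obtain ⟨y', v', h1, h2, h3, h4, h5, h6⟩ := hq y x (hB.R_symm _ _ hR) hy.1 hyc hcx hxc
      have hPc1 := (hT.mem y' c (by omega) (by omega) hc2 hcN).1 ⟨by omega, h3⟩
      have hPcN := hT.lt c hc2 hcN
      have hEP := hT.end_le_end (i := y') (j := P c) (by omega) (by omega) hPc1.1 hPc1.2
      have hy' : OnPath E w z y' := ⟨h1, by have := hy.2.1; omega, by have := hPc.2.2; omega⟩
      have hEc : E c ≤ E w := by
        have hl := hT.lt_end_par hc2 hcN
        have a1 := hPc.1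
        have a2 := (hpath _ hPc).1
        have a3 := hT.end_le_end (i := w) (j := P c) (by omega) hwN a1 a2
        exact hT.end_le_end (by omega) hwN (by omega) (by omega)
      have hwc : w ≤ c := by have := hPc.1; omega
      have hfree : ∀ v, c ≤ v → v < E c → num' v = 0 := fun v a b =>
        (hz' v).2 ⟨hun v (by omega) (by omega), hcp v a b⟩
      have hup : ∀ v, c ≤ v → v < E c →
          Relation.ReflTransGen (Free (Edge N R U) num') v c := by
        intro v
        induction v using Nat.strong_induction_on with
        | _ v ih =>
        intro a b
        rcases a.eq_or_lt with rfl | hlt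
        · exact .refl
        · have b1 := (hT.mem c v (by omega) hcN (by omega) (by omega)).1 ⟨hlt, b⟩
          have b2 := hT.lt v (by omega) (by omega)
          exact .head ⟨hB.edge_symm (hB.edge_par (by omega) (by omega)), hfree v a b,
            hfree _ b1.1 b1.2⟩ (ih (P v) b2 b1.1 b1.2)
      refine ⟨y', v', hy', hord y y' hy hy' h2, h4, hfree v' h5 h6, (hup x hcx hxc).trans ?_⟩
      exact Free.reach_symm (fun _ _ => hB.edge_symm) (hup v' h5 h6)
    -- A recent edge: `y` was unvisited until now, so all its recent edges are still in its list.
    · have hyc : y ≠ cur := by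
        rintro rfl; exact (h.cur_stk hc).1 hy0
      exact ⟨y, x, hy, le_rfl, hLL y hyc (h.cmp y x (hB.U_symm _ _ hU) hy0), hx, .refl⟩
    · rw [hr.1, h.num_one] at hx0; omega
    · have := hy.1; omega
  refine { hS with closed := ?_, conn := ?_ }
  · intro j hj hjN hj0
    rcases (hvis j).1 hj0 with h1 | h1
    · exact (hvis _).2 (.inl (h.closed j hj hjN h1))
    · rcases h1.1.eq_or_lt with rfl | hlt
      · exact (hvis _).2 (.inl hPw)
      · have b1 := (hT.mem w j (by omega) hwN hj hjN).1 ⟨hlt, (hpath j h1).1⟩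
        have b2 := hT.lt j hj hjN
        have b3 := hT.lt_end_par hj hjN
        have b4 := hT.end_le_end (i := P j) (j := j) (by omega) (by omega) b2.le b3
        exact (hvis _).2 (.inr ⟨b1.1, by have := h1.2.1; omega, by have := h1.2.2; omega⟩)
  · intro x y hx hy hxy
    obtain ⟨hx0, hxp⟩ := (hz' x).1 hx
    rcases (hvis y).1 hy with hy0 | hyp
    · obtain ⟨y', z', h1, h2, h3, h4, h5, h6⟩ := h.conn x y hx0 hy0 hxy
      -- The old connection between `x` and a listed vertex may be cut by the new path. Then its
      -- first edge to the path is used instead; it yields a listing at a path vertex, whose number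
      -- is at least `t` and so exceeds that of `y`.
      rcases Free.reach_split (num' := num') h6 hx with h7 | ⟨x₁, y₁, h7, h8, h9, h10, h11⟩
      · have hz0 := Free.reach_zero h7 hx
        refine ⟨y', z', (hvis y').2 (.inl h1), h2, by rw [hold y hy0, hold y' h1]; exact h3, ?_, hz0,
          h7⟩
        by_cases hyc : y' = cur
        · subst hyc
          rw [hL] at h4
          rcases List.mem_cons.1 h4 with rfl | h4
          · exact absurd ⟨hwz, le_rfl, by
              have := hT.lt_end z' (by omega) (by omega); exact this⟩ ((hz' z').1 hz0).2
          · exact hLc h4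
        · exact hLL y' hyc h4
      · have hy₁ : OnPath E w z y₁ := by
          rcases (hvis y₁).1 h10 with h | h
          · exact absurd h11 h
          · exact h
        obtain ⟨y'', z'', k1, k2, k3, k4, k5⟩ := key x₁ y₁ h9 hy₁ h8
        refine ⟨y'', z'', (hvis _).2 (.inr k1), hfin _ k1, ?_, k3, k4, h7.trans k5⟩
        rw [hold y hy0]
        exact (h.lt y).le.trans (hnew _ k1)
    · obtain ⟨y'', z'', k1, k2, k3, k4, k5⟩ := key x y hx hyp hxy
      exact ⟨y'', z'', (hvis _).2 (.inr k1), hfin _ k1, k2, k3, k4, k5⟩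

/-- The initial state of the search. -/
theorem Round.init (hB : DFSBase N P E R U) {num fin Q : ℕ → ℕ} {L : ℕ → List ℕ}
    (hnum : ∀ x, num x = if x = 1 then 1 else 0) (hfin : ∀ x, fin x = 0) (hQ : Q 1 = 0)
    (hs : ∀ y z, z ∈ L y → Edge N R U y z) (hc : ∀ y z, U y z → z ∈ L y)
    (h1 : ∀ z, 2 ≤ z → z ≤ N → z ∈ L 1) : Round N P (Edge N R U) U num fin Q 2 1 L := by
  have hone := hB.one_le
  have hn : ∀ x, num x ≠ 0 ↔ x = 1 := by intro x; rw [hnum]; split_ifs <;> simp_all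
  have hn0 : ∀ x, num x = 0 ↔ x ≠ 1 := by intro x; rw [hnum]; split_ifs <;> simp_all
  have hend : ∀ x, curEnd fin 2 x = 2 := by intro x; simp [curEnd, hfin]
  constructor
  · constructor
    · intro x hx; rw [hn] at hx; omega
    · intro x; rw [hnum]; split_ifs <;> omega
    · intro x y hx hxy
      rw [hn] at hx
      have : num y ≠ 0 := by rw [← hxy, hn]; exact hx
      rw [hn] at this; omega
    · have : (Finset.Icc 1 N).filter (fun x => num x ≠ 0) = {1} := by
        ext x; simp only [Finset.mem_filter, Finset.mem_Icc, hn, Finset.mem_singleton]; omega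
      rw [this]; simp
    · intro x hx; exact absurd (hfin x) hx
    · simp [hnum]
    · exact hQ
    · intro _; exact ⟨(hn 1).2 rfl, hfin 1⟩
    · intro x hx _; rw [hn] at hx; subst hx; simp
    · intro x hx _ h; exact absurd ((hn x).1 hx) h
    · intro x hx h; exact absurd ((hn x).1 hx) h
    · intro x j _ hj h; exact absurd ((hn j).1 hj) h
    · intro x _ hx; exact absurd (hfin x) hx
    · intro a b _ ha hab
      rw [hend, hnum b]; split_ifs <;> omega
    · exact hs
    · intro y z hyz _; exact hc y z hyz
    · intro _ y _ _ _; exact hfin y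
  · intro j hj _ h; rw [hn] at h; omega
  · intro x y hx hy hxy
    rw [hn] at hy
    subst hy
    have hx' := hB.edge_rng hxy
    rw [hn0] at hx
    refine ⟨1, x, (hn 1).2 rfl, hfin 1, le_rfl, h1 x (by omega) hx'.2, (hn0 x).2 hx, .refl⟩

end Round


/-! ### Search for the first neighbour from some number on -/

/-- The number `N` of vertices, including the root, is small enough for the memory. -/
structure Env.Fits (env : Env) (N : ℕ) : Prop where
  three_le : 3 ≤ N
  B_eq : env.B = N * N
  le_M : 64 * ((N + 1) * (N + 1)) ≤ env.M

/-- The store contains, in the buffer `g`, the tree `P`, `E` and, in increasing order, the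
neighbours of each vertex other than the root with respect to `R`. -/
structure HasTree (N g : ℕ) (P E : ℕ → ℕ) (R : ℕ → ℕ → Prop) (σ : Store) : Prop where
  N_eq : σ.v .N = N
  g_eq : σ.v .g = g
  g_le : g ≤ 1
  P_eq : ∀ i, 1 ≤ i → i ≤ N → σ.a .P (2 * i + g) = P i
  E_eq : ∀ i, 1 ≤ i → i ≤ N → σ.a .E (2 * i + g) = E i
  cnt_le : ∀ i, 2 ≤ i → i ≤ N → σ.a .cnt (2 * i + g) ≤ N
  mono : ∀ i, 2 ≤ i → i ≤ N → ∀ k l, k < l → l < σ.a .cnt (2 * i + g) →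
    σ.a .D (2 * (i * (N + 1) + k) + g) < σ.a .D (2 * (i * (N + 1) + l) + g)
  mem : ∀ i, 2 ≤ i → i ≤ N → ∀ r, R i r ↔
    ∃ k < σ.a .cnt (2 * i + g), σ.a .D (2 * (i * (N + 1) + k) + g) = r

theorem HasTree.congr {N g : ℕ} {P E : ℕ → ℕ} {R : ℕ → ℕ → Prop} {σ σ' : Store}
    (h : HasTree N g P E R σ) (hN : σ'.v .N = σ.v .N) (hg : σ'.v .g = σ.v .g)
    (hP : σ'.a .P = σ.a .P) (hE : σ'.a .E = σ.a .E) (hc : σ'.a .cnt = σ.a .cnt)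
    (hD : σ'.a .D = σ.a .D) : HasTree N g P E R σ' := by
  constructor
  · rw [hN, h.N_eq]
  · rw [hg, h.g_eq]
  · exact h.g_le
  · rw [hP]; exact h.P_eq
  · rw [hE]; exact h.E_eq
  · rw [hc]; exact h.cnt_le
  · rw [hc, hD]; exact h.mono
  · rw [hc, hD]; exact h.mem

theorem HasTree.frame {N g : ℕ} {P E : ℕ → ℕ} {R : ℕ → ℕ → Prop} {σ σ' : Store}
    {vs : List Var} {fs : List Arr} (h : HasTree N g P E R σ) (hF : Frame vs fs σ σ')
    (hv : Var.N ∉ vs ∧ Var.g ∉ vs := by decide)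
    (hf : Arr.P ∉ fs ∧ Arr.E ∉ fs ∧ Arr.cnt ∉ fs ∧ Arr.D ∉ fs := by decide) :
    HasTree N g P E R σ' :=
  h.congr (hF.v _ hv.1) (hF.v _ hv.2) (hF.a _ hf.1) (hF.a _ hf.2.1) (hF.a _ hf.2.2.1)
    (hF.a _ hf.2.2.2)

/-- The entry for `i` in an array with two buffers. -/
def Ex.buf (f : Arr) (i : Ex) : Ex := .get f (2 * i + ‡.g)

/-- The entry `k` of the list of neighbours of `i`. -/
def Ex.row (i k : Ex) : Ex := .get .D (2 * (i * (‡.N + 1) + k) + ‡.g)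

/-- Finds the first neighbour of `si` with number at least `sl`. -/
def succCode : Stmt :=
  .set .lo 0 ;; .set .hi (.buf .cnt ‡.si) ;;
  .loop .lt ‡.lo ‡.hi (
    .set .mid ((‡.lo + ‡.hi) / 2) ;;
    .ite .lt (.row ‡.si ‡.mid) ‡.sl (.set .lo (‡.mid + 1)) (.set .hi ‡.mid)) ;;
  .ite .lt ‡.lo (.buf .cnt ‡.si) (.set .res (.row ‡.si ‡.lo)) (.set .res (‡.N + 1))

/-- `Nat.size` is the number of binary digits; it measures the progress of binary search and the
halving of subtrees alike. -/
theorem size_half {m : ℕ} (hm : 0 < m) : (m / 2).size + 1 ≤ m.size := by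
  have h1 : 0 < m.size := Nat.size_pos.2 hm
  have h2 : (m / 2).size ≤ m.size - 1 := by
    rw [Nat.size_le]
    have h3 := Nat.lt_size_self m
    have h4 : 2 ^ m.size = 2 ^ (m.size - 1) * 2 := by rw [← pow_succ]; congr 1; omega
    omega
  omega

theorem row_index_le {N i k g : ℕ} (hi : i ≤ N) (hk : k ≤ N) (hg : g ≤ 1) :
    i * (N + 1) ≤ (N + 1) * (N + 1) ∧ i * (N + 1) + k ≤ (N + 1) * (N + 1) ∧
      2 * (i * (N + 1) + k) + g ≤ 2 * ((N + 1) * (N + 1)) + 1 := by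
  have : i * (N + 1) ≤ N * (N + 1) := Nat.mul_le_mul_right _ hi
  have h2 : (N + 1) * (N + 1) = N * (N + 1) + N + 1 := by ring
  refine ⟨?_, ?_, ?_⟩ <;> omega

theorem Env.Fits.bounds {env : Env} {N : ℕ} (h : env.Fits N) :
    64 * ((N + 1) * (N + 1)) ≤ env.M ∧ 64 * (N + 1) ≤ env.M ∧ 256 ≤ env.M := by
  have h1 : (N + 1) * 1 ≤ (N + 1) * (N + 1) := Nat.mul_le_mul_left _ (by omega)
  have h2 := h.le_M
  have h3 := h.three_le
  omega

/-- Binary search in a sorted row: entries before `lo` are below `sl`, entries from `hi` on are not.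
A round costs 4 and shortens `hi - lo` by a binary digit, and 5 covers the rest. The value `N + 1`,
larger than every number, signals that there is no such neighbour. -/
theorem succCode_spec {env : Env} {N g : ℕ} (hfit : env.Fits N) {P E : ℕ → ℕ} {R : ℕ → ℕ → Prop}
    {σ : Store} (h : HasTree N g P E R σ) (hs : 2 ≤ σ.v .si) (hsN : σ.v .si ≤ N) {a : ℤ}
    {Q : Store → ℤ → Prop} (hQ : ∀ σ' b, Frame [.lo, .hi, .mid, .res] [] σ σ' →
      a - (4 * N.size + 5) ≤ b →
      (σ'.v .res = N + 1 ∨ (R (σ.v .si) (σ'.v .res) ∧ σ.v .sl ≤ σ'.v .res)) →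
      (∀ r, R (σ.v .si) r → σ.v .sl ≤ r → σ'.v .res ≤ r) → Q σ' b) : WP env succCode σ a Q := by
  obtain ⟨hM2, hM, hM0⟩ := hfit.bounds
  have hg := h.g_eq
  have hg1 := h.g_le
  have hN := h.N_eq
  have h3 := hfit.three_le
  have hcnt := h.cnt_le _ hs hsN
  have hmono := h.mono _ hs hsN
  have hmem := h.mem _ hs hsN
  generalize hsi : σ.v .si = si at *
  generalize hsl : σ.v .sl = sl at *
  generalize hc : σ.a .cnt (2 * si + g) = c at *
  have hidx : ∀ k, k ≤ N → si * (N + 1) ≤ env.M ∧ si * (N + 1) + k ≤ env.M ∧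
      2 * (si * (N + 1) + k) ≤ env.M ∧ 2 * (si * (N + 1) + k) + g ≤ env.M ∧
      2 * (si * (N + 1) + k) + g < env.M := by
    intro k hk
    obtain ⟨h1, h2, h3⟩ := row_index_le hsN hk hg1
    omega
  simp only [succCode, WP_seq, WP_set, Ex.buf, Ex.row]
  simp [hg, hN, hsi, hc, Env.len]
  repeat refine ⟨by omega, ?_⟩
  refine WP_loop (fun k σ' b => Frame [.lo, .hi, .mid, .res] [] σ σ' ∧ k = σ'.v .hi - σ'.v .lo ∧
    σ'.v .lo ≤ σ'.v .hi ∧ σ'.v .hi ≤ c ∧ a - 2 - 4 * N.size + 4 * (k.size : ℤ) ≤ b ∧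
    (∀ k < σ'.v .lo, σ.a .D (2 * (si * (N + 1) + k) + g) < sl) ∧
    (∀ k, σ'.v .hi ≤ k → k < c → sl ≤ σ.a .D (2 * (si * (N + 1) + k) + g))) ?_ c ?_ ?_
  · rintro k σ' b ⟨hF, rfl, hlh, hhc, hb, hlo, hhi⟩ Q' hQ'
    have e1 := hF.v .N (by decide)
    have e2 := hF.v .g (by decide)
    have e3 := hF.v .si (by decide)
    have e4 := hF.v .sl (by decide)
    have e5 := hF.a .D (by decide)
    simp only [WP_seq, WP_set, WP_ite]
    simp [e1, e2, e3, e4, e5, hg, hN, hsi, hsl, Env.len]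
    intro hlt
    have hx := hidx ((σ'.v .lo + σ'.v .hi) / 2) (by omega)
    repeat refine ⟨by omega, ?_⟩
    refine ⟨fun hD => ⟨by omega, hQ' _ _ _ ?_ ⟨(hF.setv (by decide) _).setv (by decide) _, rfl, ?_⟩⟩,
      fun hD => hQ' _ _ _ ?_ ⟨(hF.setv (by decide) _).setv (by decide) _, rfl, ?_⟩⟩
    · simp; omega
    · have h1 := size_half (m := σ'.v .hi - σ'.v .lo) (by omega)
      have h2 := Nat.size_le_size
        (show σ'.v .hi - ((σ'.v .lo + σ'.v .hi) / 2 + 1) ≤ (σ'.v .hi - σ'.v .lo) / 2 by omega)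
      simp
      refine ⟨by omega, by omega, by omega, ?_, hhi⟩
      intro k hk
      rcases (show k ≤ (σ'.v .lo + σ'.v .hi) / 2 by omega).eq_or_lt with rfl | hlt'
      · exact hD
      · exact (hmono k _ hlt' (by omega)).trans hD
    · simp; omega
    · have h1 := size_half (m := σ'.v .hi - σ'.v .lo) (by omega)
      have h2 := Nat.size_le_size
        (show (σ'.v .lo + σ'.v .hi) / 2 - σ'.v .lo ≤ (σ'.v .hi - σ'.v .lo) / 2 by omega)
      simp
      refine ⟨by omega, by omega, by omega, hlo, ?_⟩
      intro k hk hkc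
      rcases hk.eq_or_lt with rfl | hlt'
      · exact hD
      · exact hD.trans (hmono _ k hlt' hkc).le
  · refine ⟨((Frame.refl _ _ σ).setv (by decide) _).setv (by decide) _, ?_, ?_, ?_, ?_, ?_, ?_⟩
    · simp
    · simp
    · simp
    · have := Nat.size_le_size hcnt
      omega
    · simp
    · simp; intro k h1 h2; omega
  · rintro k σ' b ⟨hF, rfl, hlh, hhc, hb, hlo, hhi⟩ hnlt
    have e1 := hF.v .N (by decide)
    have e2 := hF.v .g (by decide)
    have e3 := hF.v .si (by decide)
    have e5 := hF.a .D (by decide)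
    have e6 := hF.a .cnt (by decide)
    simp at hnlt
    simp only [WP_seq, WP_set, WP_ite]
    simp [e1, e2, e3, e5, e6, hg, hN, hsi, Env.len, hc]
    repeat refine ⟨by omega, ?_⟩
    constructor
    · intro hlt
      have hx := hidx (σ'.v .lo) (by omega)
      refine ⟨by omega, hQ _ _ (hF.setv (by decide) _) (by omega)
        (.inr (by simpa using ⟨(hmem _).2 ⟨_, hlt, rfl⟩, hhi _ (by omega) hlt⟩)) ?_⟩
      intro r hr hle
      obtain ⟨k, hk, rfl⟩ := (hmem r).1 hr
      simp
      by_contra hcon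
      by_cases hk' : k < σ'.v .lo
      · have := hlo k hk'; omega
      · rcases (show σ'.v .lo ≤ k by omega).eq_or_lt with rfl | hlt'
        · omega
        · have := hmono _ k hlt' hk; omega
    · intro hle'
      refine ⟨by omega, hQ _ _ (hF.setv (by decide) _) (by omega) (.inl (by simp)) ?_⟩
      intro r hr hle
      obtain ⟨k, hk, rfl⟩ := (hmem r).1 hr
      have := hlo k (by omega)
      omega


/-! ### Linked lists -/

/-- The linked list that starts at the cell `p` has the entries `l`; its cells are below `k`. -/
inductive IsList (nx dst : ℕ → ℕ) (k : ℕ) : ℕ → List ℕ → Prop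
  | nil : IsList nx dst k 0 []
  | cons {p l} : p ≠ 0 → p < k → IsList nx dst k (nx p) l → IsList nx dst k p (dst p :: l)

/-- New cells are taken from `k` on and old cells are never overwritten, so a list survives later
insertions. Therefore a copy of the head pointers is a snapshot of all lists. -/
theorem IsList.congr {nx dst nx' dst' : ℕ → ℕ} {k k' p : ℕ} {l : List ℕ} (h : IsList nx dst k p l)
    (hk : k ≤ k') (hn : ∀ i < k, nx' i = nx i) (hd : ∀ i < k, dst' i = dst i) :
    IsList nx' dst' k' p l := by
  induction h with
  | nil => exact .nil
  | @cons p l h0 hp _ ih =>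
    rw [← hd p hp]
    refine .cons h0 (by omega) ?_
    rwa [hn p hp]

/-- Linked lists for `y < m` that start at the cells `head y`. -/
def Lists (head nx dst : ℕ → ℕ) (m k : ℕ) (L : ℕ → List ℕ) : Prop :=
  k ≠ 0 ∧ ∀ y < m, IsList nx dst k (head y) (L y)

theorem Lists.push {head nx dst : ℕ → ℕ} {m k : ℕ} {L : ℕ → List ℕ} (h : Lists head nx dst m k L)
    (y z : ℕ) :
    Lists (Function.update head y k) (Function.update nx k (head y)) (Function.update dst k z) m
      (k + 1) (Function.update L y (z :: L y)) := by
  refine ⟨by omega, fun y' hy' => ?_⟩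
  have hc : ∀ p l, IsList nx dst k p l → IsList (Function.update nx k (head y))
      (Function.update dst k z) (k + 1) p l := fun p l hl =>
    hl.congr (by omega) (fun i hi => by rw [Function.update_of_ne (by omega)])
      (fun i hi => by rw [Function.update_of_ne (by omega)])
  by_cases hyy : y' = y
  · subst hyy
    rw [Function.update_self, Function.update_self]
    have := IsList.cons (nx := Function.update nx k (head y')) (dst := Function.update dst k z)
      (k := k + 1) (p := k) (l := L y') h.1 (by omega)
      (by rw [Function.update_self]; exact hc _ _ (h.2 y' hy'))
    rwa [Function.update_self] at this
  · rw [Function.update_of_ne hyy, Function.update_of_ne hyy]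
    exact hc _ _ (h.2 y' hy')

theorem Lists.pop {head nx dst : ℕ → ℕ} {m k : ℕ} {L : ℕ → List ℕ} (h : Lists head nx dst m k L)
    {y : ℕ} (hy : y < m) (h0 : head y ≠ 0) : ∃ l, L y = dst (head y) :: l ∧ head y < k ∧
      Lists (Function.update head y (nx (head y))) nx dst m k (Function.update L y l) := by
  have hl := h.2 y hy
  generalize hp : head y = p at *
  generalize hly : L y = ly at *
  cases hl with
  | nil => exact absurd rfl h0
  | @cons _ l _ hpk hl =>
  refine ⟨l, rfl, hpk, h.1, fun y' hy' => ?_⟩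
  by_cases hyy : y' = y
  · subst hyy; rwa [Function.update_self, Function.update_self]
  · rw [Function.update_of_ne hyy, Function.update_of_ne hyy]; exact h.2 y' hy'

theorem Lists.eq_nil {head nx dst : ℕ → ℕ} {m k : ℕ} {L : ℕ → List ℕ} (h : Lists head nx dst m k L)
    {y : ℕ} (hy : y < m) (h0 : head y = 0) : L y = [] := by
  have hl := h.2 y hy
  rw [h0] at hl
  generalize L y = ly at *
  generalize hp : (0 : ℕ) = p at *
  cases hl with
  | nil => rfl
  | cons h1 => exact absurd hp.symm h1

/-- Inserts `z` into the list of `y`. -/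
def pushCode (y z : Ex) : Stmt :=
  .put .dst ‡.k z ;; .put .next ‡.k (.get .head y) ;; .put .head y ‡.k ;; .set .k (‡.k + 1)

/-! ### Queries for edges between a subtree and a path -/

/-- Finds the edge between the subtree of `c` and the path from the parent of `c` up to `w` whose
end on the path is topmost. -/
def findCode : Stmt :=
  .set .best ‡.c ;;
  .ite .le (2 * (.buf .E ‡.c - ‡.c)) (.buf .E ‡.w - ‡.w)
    (.set .j ‡.c ;;
    .loop .lt ‡.j (.buf .E ‡.c) (
      .set .si ‡.j ;; .set .sl ‡.w ;; succCode ;;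
      .ite .lt ‡.res ‡.best (.set .best ‡.res ;; .set .bz ‡.j) .skip ;;
      .set .j (‡.j + 1)))
    (.set .y (.buf .P ‡.c) ;;
    .loop .le ‡.w ‡.y (
      .set .si ‡.y ;; .set .sl ‡.c ;; succCode ;;
      .ite .lt ‡.res (.buf .E ‡.c) (.set .best ‡.y ;; .set .bz ‡.res) .skip ;;
      .set .y (.buf .P ‡.y)))

/-- The edge between `best` and `bz` is as required from `findCode`; there is no such edge if
`best = c`. -/
def Found (E : ℕ → ℕ) (R : ℕ → ℕ → Prop) (w c best bz : ℕ) : Prop :=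
  (best ≤ c ∧ (best < c → R best bz ∧ w ≤ best ∧ c ≤ bz ∧ bz < E c)) ∧
    ∀ y v, R y v → w ≤ y → y < c → c ≤ v → v < E c → best ≤ y

/-- Depth increases along the tree. -/
theorem NumTree.dep_mono {N : ℕ} {P E : ℕ → ℕ} (hT : NumTree N P E) {dep : ℕ → ℕ}
    (hdep : ∀ j, 2 ≤ j → j ≤ N → dep j = dep (P j) + 1) {y x : ℕ} (hy : 1 ≤ y) (hx : x ≤ N)
    (hyx : y ≤ x) (hxy : x < E y) : dep y ≤ dep x := by
  induction x using Nat.strong_induction_on with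
  | _ x ih =>
  rcases hyx.eq_or_lt with rfl | hlt
  · exact le_rfl
  · have b1 := hT.le_par hy hx hlt hxy
    have b2 := hT.lt x (by omega) hx
    have b3 := hT.par_lt_end hy hx hlt hxy
    have := ih (P x) b2 (by omega) b1 b3
    have := hdep x (by omega) hx
    omega

/-- A bound for the time of `findCode` if it scans a path with the vertices from depth `dw` to
depth `dc`. -/
def findCost (N : ℕ) (E : ℕ → ℕ) (w c dw dc : ℕ) : ℕ :=
  if 2 * (E c - c) ≤ E w - w then (4 * N.size + 12) * (E c - c) + 8
  else (4 * N.size + 12) * (dc + 1 - dw) + 8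

/-- An old neighbour numbered from `w` to `c - 1` of a vertex in the subtree of `c` lies on the
path, because old edges are back edges. In a light subtree, the first neighbour from `w` on is thus
found for every vertex, and the least one kept. For a heavy subtree the path is climbed from `P c`
to `w`: a vertex has an edge into the subtree if its first neighbour from `c` on is below `E c`, and
later finds are higher. One round costs at most `4 * N.size + 12`. -/
theorem findCode_spec {env : Env} {N g : ℕ} (hfit : env.Fits N) {P E : ℕ → ℕ}
    {R U : ℕ → ℕ → Prop} (hB : DFSBase N P E R U) {dep : ℕ → ℕ}
    (hdep : ∀ j, 2 ≤ j → j ≤ N → dep j = dep (P j) + 1) {σ : Store} (h : HasTree N g P E R σ)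
    {w c : ℕ} (hw : σ.v .w = w) (hc : σ.v .c = c) (hw2 : 2 ≤ w) (hcN : c ≤ N) (hwP : w ≤ P c)
    (hPw : P c < E w) (hPc : P c < c) {a : ℤ} {Q : Store → ℤ → Prop}
    (hQ : ∀ σ' b, Frame [.best, .j, .y, .bz, .si, .sl, .lo, .hi, .mid, .res] [] σ σ' →
      a - findCost N E w c (dep w) (dep (P c)) ≤ b → Found E R w c (σ'.v .best) (σ'.v .bz) →
        Q σ' b) : WP env findCode σ a Q := by
  obtain ⟨hM2, hM, hM0⟩ := hfit.bounds
  have hT := hB.tree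
  have hg := h.g_eq
  have hg1 := h.g_le
  have hN := h.N_eq
  have hEc := h.E_eq c (by omega) hcN
  have hEw := h.E_eq w (by omega) (by omega)
  have hPc' := h.P_eq c (by omega) hcN
  have h1 := hT.lt_end c (by omega) hcN
  have h2 := hT.end_le c (by omega) hcN
  have h3 := hT.lt_end w (by omega) (by omega)
  have h4 := hT.end_le w (by omega) (by omega)
  simp only [findCode, WP_seq, WP_set, WP_ite, Ex.buf]
  simp [hg, hN, hw, hc, Env.len, hEc, hEw]
  repeat refine ⟨by omega, ?_⟩
  unfold findCost at hQ
  constructor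
  · intro hlight
    rw [if_pos hlight] at hQ
    refine WP_loop (fun k σ' b => Frame [.best, .j, .y, .bz, .si, .sl, .lo, .hi, .mid, .res] [] σ σ' ∧
      c ≤ σ'.v .j ∧ σ'.v .j ≤ E c ∧ k = E c - σ'.v .j ∧
      a - 3 - (4 * N.size + 12 : ℕ) * (σ'.v .j - c) ≤ b ∧
      (σ'.v .best ≤ c ∧ (σ'.v .best < c → R (σ'.v .best) (σ'.v .bz) ∧ w ≤ σ'.v .best ∧
        c ≤ σ'.v .bz ∧ σ'.v .bz < E c)) ∧
      (∀ y v, R y v → w ≤ y → y < c → c ≤ v → v < σ'.v .j → σ'.v .best ≤ y)) ?_ (E c - c) ?_ ?_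
    · rintro k σ' b ⟨hF, hcj, hjE, rfl, hb, hbest, hall⟩ Q' hQ'
      have e1 := hF.v .N (by decide)
      have e2 := hF.v .g (by decide)
      have e3 := hF.v .w (by decide)
      have e4 := hF.v .c (by decide)
      have e5 := hF.a .E (by decide)
      simp only [WP_seq, WP_set, WP_ite]
      simp [e1, e2, e3, e4, e5, hg, hN, hw, hc, Env.len, hEc]
      repeat refine ⟨by omega, ?_⟩
      intro hlt
      refine succCode_spec hfit (h := (h.frame hF).frame (((Frame.refl [.si, .sl] [] σ').setv
        (by decide) _).setv (by decide) _)) ?_ ?_ ?_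
      · simp; omega
      · simp; omega
      intro σ₁ b₁ hF₁ hb₁ hres hmin
      simp at hres hmin
      have f1 := hF₁.v .best (by decide)
      have f2 := hF₁.v .j (by decide)
      simp at f1 f2
      have hFF : Frame [.best, .j, .y, .bz, .si, .sl, .lo, .hi, .mid, .res] [] σ σ₁ :=
        (((hF.setv (by decide) _).setv (by decide) _).trans hF₁ (by decide) (by decide))
      have hmul : ((4 * N.size + 12 : ℕ) : ℤ) * ((σ'.v .j + 1 : ℕ) - c) =
          (4 * N.size + 12 : ℕ) * (σ'.v .j - c) + (4 * N.size + 12 : ℕ) := by push_cast; ring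
      have hpair : ∀ y v, R y v → w ≤ y → y < c → c ≤ v → v < σ'.v .j + 1 →
          σ'.v .best ≤ y ∨ σ₁.v .res ≤ y := by
        intro y v hR hwy hyc hcv hv
        by_cases hvj : v < σ'.v .j
        · exact .inl (hall y v hR hwy hyc hcv hvj)
        · obtain rfl : v = σ'.v .j := by omega
          exact .inr (hmin y (hB.R_symm _ _ hR) hwy)
      simp only [WP_seq, WP_set, WP_ite, WP_skip]
      simp [f1, f2, Env.len]
      constructor
      · intro hlt'
        refine ⟨by omega, hQ' _ _ _ ?_ ⟨((hFF.setv (by decide) _).setv (by decide) _).setv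
          (by decide) _, ?_, ?_, rfl, ?_, ?_, ?_⟩⟩
        · simp; omega
        · simp; omega
        · simp; omega
        · simp only [Store.setv_v, if_true]; omega
        · simp
          have hR : R (σ'.v .j) (σ₁.v .res) ∧ w ≤ σ₁.v .res := by
            rcases hres with h | h
            · omega
            · exact h
          exact ⟨by omega, fun _ => ⟨hB.R_symm _ _ hR.1, hR.2, hcj, hlt⟩⟩
        · simp
          intro y v hR hwy hyc hcv hv
          have := hpair y v hR hwy hyc hcv (by omega)
          omega
      · intro hle
        refine ⟨by omega, hQ' _ _ _ ?_ ⟨hFF.setv (by decide) _, ?_, ?_, rfl, ?_, ?_, ?_⟩⟩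
        · simp; omega
        · simp; omega
        · simp; omega
        · simp only [Store.setv_v, if_true]; omega
        · have f3 := hF₁.v .bz (by decide)
          simp at f3
          simp [f1, f3]; exact hbest
        · simp [f1]
          intro y v hR hwy hyc hcv hv
          have := hpair y v hR hwy hyc hcv (by omega)
          omega
    · refine ⟨((Frame.refl _ _ σ).setv (by decide) _).setv (by decide) _, ?_, ?_, ?_, ?_, ?_, ?_⟩
      · simp
      · simp; omega
      · simp
      · simp; omega
      · simp
      · simp; intro y v _ _ _ _ _; omega
    · rintro k σ' b ⟨hF, hcj, hjE, rfl, hb, hbest, hall⟩ hn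
      have e2 := hF.v .g (by decide)
      have e4 := hF.v .c (by decide)
      have e5 := hF.a .E (by decide)
      simp [e2, e4, e5, hg, hc, hEc] at hn
      have hj : σ'.v .j = E c := by omega
      rw [hj] at hall hb
      refine hQ _ _ hF ?_ ⟨hbest, hall⟩
      have : (((4 * N.size + 12) * (E c - c) + 8 : ℕ) : ℤ) =
        (4 * N.size + 12 : ℕ) * ((E c : ℤ) - c) + 8 := by push_cast [Nat.cast_sub h1.le]; ring
      rw [this]; omega
  · intro hheavy
    rw [if_neg (by omega)] at hQ
    repeat refine ⟨by omega, ?_⟩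
    rw [hPc']
    -- The value `P w` of `y` occurs once the path is exhausted. Until then `y` runs over the
    -- ancestors of `P c` from `w` downwards, and all edges ending strictly below `y` have been
    -- taken into account.
    refine WP_loop (fun k σ' b => Frame [.best, .j, .y, .bz, .si, .sl, .lo, .hi, .mid, .res] [] σ σ' ∧
      k = σ'.v .y ∧ (σ'.v .y = P w ∨ (w ≤ σ'.v .y ∧ σ'.v .y ≤ P c ∧ P c < E (σ'.v .y))) ∧
      a - 3 - (4 * N.size + 12 : ℕ) * (dep (P c) - dep (σ'.v .y)) ≤ b ∧
      (σ'.v .best ≤ c ∧ (σ'.v .best < c → R (σ'.v .best) (σ'.v .bz) ∧ w ≤ σ'.v .best ∧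
        c ≤ σ'.v .bz ∧ σ'.v .bz < E c)) ∧
      (∀ y v, R y v → w ≤ y → y < c → c ≤ v → v < E c → σ'.v .y < y → σ'.v .best ≤ y))
      ?_ (P c) ?_ ?_
    · rintro k σ' b ⟨hF, rfl, hy, hb, hbest, hall⟩ Q' hQ'
      have e1 := hF.v .N (by decide)
      have e2 := hF.v .g (by decide)
      have e3 := hF.v .w (by decide)
      have e4 := hF.v .c (by decide)
      have e5 := hF.a .E (by decide)
      simp only [WP_seq, WP_set, WP_ite]
      simp [e1, e2, e3, e4, e5, hg, hN, hw, hc, Env.len, hEc]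
      intro hwy
      have hPww := hT.lt w (by omega) (by omega)
      obtain ⟨-, hyP, hPy⟩ : w ≤ σ'.v .y ∧ σ'.v .y ≤ P c ∧ P c < E (σ'.v .y) := by
        rcases hy with h | h
        · omega
        · exact h
      refine succCode_spec hfit (h := (h.frame hF).frame (((Frame.refl [.si, .sl] [] σ').setv
        (by decide) _).setv (by decide) _)) ?_ ?_ ?_
      · simp; omega
      · simp; omega
      intro σ₁ b₁ hF₁ hb₁ hres hmin
      simp at hres hmin
      have f1 := hF₁.v .best (by decide)
      have f2 := hF₁.v .y (by decide)
      have f4 := hF₁.v .g (by decide)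
      have f5 := hF₁.v .c (by decide)
      have f6 := hF₁.a .E (by decide)
      have f7 := hF₁.a .P (by decide)
      have e6 := hF.a .P (by decide)
      simp [e2, e4, e5, e6, hg, hc] at f1 f2 f4 f5 f6 f7
      have hFF : Frame [.best, .j, .y, .bz, .si, .sl, .lo, .hi, .mid, .res] [] σ σ₁ :=
        (((hF.setv (by decide) _).setv (by decide) _).trans hF₁ (by decide) (by decide))
      have hPy' := h.P_eq (σ'.v .y) (by omega) (by omega)
      have hlt := hT.lt (σ'.v .y) (by omega) (by omega)
      have hd := hdep (σ'.v .y) (by omega) (by omega)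
      have hmul : ((4 * N.size + 12 : ℕ) : ℤ) * (dep (P c) - dep (P (σ'.v .y))) =
          (4 * N.size + 12 : ℕ) * (dep (P c) - dep (σ'.v .y)) + (4 * N.size + 12 : ℕ) := by
        rw [hd]; push_cast; ring
      have hnext : P (σ'.v .y) = P w ∨ (w ≤ P (σ'.v .y) ∧ P (σ'.v .y) ≤ P c ∧
          P c < E (P (σ'.v .y))) := by
        rcases hwy.eq_or_lt with h | h
        · rw [← h]; exact .inl rfl
        · have b1 := hT.le_par (y := w) (x := σ'.v .y) (by omega) (by omega) h (by omega)
          have b3 := hT.lt_end_par (x := σ'.v .y) (by omega) (by omega)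
          have b4 := hT.end_le_end (i := P (σ'.v .y)) (j := σ'.v .y) (by omega) (by omega) hlt.le b3
          exact .inr ⟨b1, by omega, by omega⟩
      -- The upper end of such an edge is an ancestor of `c`, and no ancestor of `c` lies strictly
      -- between the current vertex and its parent. So one round adds only the edges at the current
      -- vertex.
      have hpair : ∀ y v, R y v → w ≤ y → y < c → c ≤ v → v < E c → P (σ'.v .y) < y →
          σ'.v .y < y ∨ (y = σ'.v .y ∧ σ₁.v .res < E c) := by
        intro y v hR hwy hyc hcv hv hPlt
        by_cases hyv : σ'.v .y < y
        · exact .inl hyv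
        · have b1 := hB.R_back y v hR (by omega)
          have b2 := hT.par_lt_end (y := y) (x := c) (by omega) hcN hyc (by omega)
          by_cases hyy : y = σ'.v .y
          · subst hyy
            have := hmin v hR hcv
            exact .inr ⟨rfl, by omega⟩
          · have := hT.le_par (y := y) (x := σ'.v .y) (by omega) (by omega) (by omega) (by omega)
            omega
      simp only [WP_seq, WP_set, WP_ite, WP_skip]
      simp [f1, f2, f4, f5, f6, f7, Env.len, hEc, hPy']
      repeat refine ⟨by omega, ?_⟩
      constructor
      · intro hlt'
        repeat refine ⟨by omega, ?_⟩
        refine hQ' _ _ _ ?_ ⟨((hFF.setv (by decide) _).setv (by decide) _).setv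
          (by decide) _, rfl, ?_, ?_, ?_, ?_⟩
        · simp; exact hlt
        · simpa using hnext
        · simp only [Store.setv_v, if_true]; omega
        · simp
          have hR : R (σ'.v .y) (σ₁.v .res) ∧ c ≤ σ₁.v .res := by
            rcases hres with h | h
            · omega
            · exact h
          exact ⟨by omega, fun _ => ⟨hR.1, hwy, hR.2, hlt'⟩⟩
        · simp
          intro y v hR hwy hyc hcv hv hPlt
          have := hpair y v hR hwy hyc hcv hv hPlt
          omega
      · intro hle
        repeat refine ⟨by omega, ?_⟩
        refine hQ' _ _ _ ?_ ⟨hFF.setv (by decide) _, rfl, ?_, ?_, ?_, ?_⟩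
        · simp; exact hlt
        · simpa using hnext
        · simp only [Store.setv_v, if_true]; omega
        · have f3 := hF₁.v .bz (by decide)
          simp at f3
          simp [f1, f3]; exact hbest
        · simp [f1]
          intro y v hR hwy hyc hcv hv hPlt
          rcases hpair y v hR hwy hyc hcv hv hPlt with h | h
          · exact hall y v hR hwy hyc hcv hv h
          · omega
    · refine ⟨((Frame.refl _ _ σ).setv (by decide) _).setv (by decide) _, ?_, ?_, ?_, ?_, ?_⟩
      · simp
      · simp
        exact .inr ⟨hwP, hT.lt_end _ (by omega) (by omega)⟩
      · simp; omega
      · simp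
      · simp
        intro y v hR hwy hyc hcv hv hlt
        have b1 := hB.R_back y v hR (by omega)
        have b2 := hT.le_par (y := y) (x := c) (by omega) hcN hyc (by omega)
        omega
    · rintro k σ' b ⟨hF, rfl, hy, hb, hbest, hall⟩ hn
      have e3 := hF.v .w (by decide)
      simp [e3, hw] at hn
      have hyw : σ'.v .y = P w := by
        rcases hy with h | h
        · exact h
        · omega
      rw [hyw] at hall hb
      refine hQ _ _ hF ?_ ⟨hbest, fun y v a1 a2 a3 a4 a5 => hall y v a1 a2 a3 a4 a5 (by omega)⟩
      have hd := hdep w (by omega) (by omega)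
      have hd' := hT.dep_mono hdep (y := w) (x := P c) (by omega) (by omega) hwP hPw
      have : (((4 * N.size + 12) * (dep (P c) + 1 - dep w) + 8 : ℕ) : ℤ) =
        (4 * N.size + 12 : ℕ) * ((dep (P c) : ℤ) - dep (P w)) + 8 := by
        push_cast [Nat.cast_sub (show dep w ≤ dep (P c) + 1 by omega)]
        rw [hd]; push_cast; ring
      rw [this]; omega


/-! ### Work at the vertices of a path -/

theorem OnPath.lt_end {E : ℕ → ℕ} {w z y : ℕ} (h : OnPath E w z y) : y < E y :=
  lt_of_le_of_lt h.2.1 h.2.2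

/-- Total length of the lists. -/
def total (N : ℕ) (L : ℕ → List ℕ) : ℕ := ∑ y ∈ Finset.range (N + 1), (L y).length

theorem total_push {N : ℕ} (L : ℕ → List ℕ) {y : ℕ} (hy : y ≤ N) (z : ℕ) :
    total N (Function.update L y (z :: L y)) = total N L + 1 := by
  have hmem : y ∈ Finset.range (N + 1) := by simp; omega
  unfold total
  rw [← Finset.add_sum_erase _ _ hmem, ← Finset.add_sum_erase _ _ hmem]
  have : ∀ x ∈ (Finset.range (N + 1)).erase y,
      (Function.update L y (z :: L y) x).length = (L x).length := fun x hx => by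
    rw [Function.update_of_ne (Finset.ne_of_mem_erase hx)]
  rw [Finset.sum_congr rfl this]
  simp
  omega

theorem total_pop {N : ℕ} (L : ℕ → List ℕ) {y : ℕ} (hy : y ≤ N) {z : ℕ} {l : List ℕ}
    (hL : L y = z :: l) : total N (Function.update L y l) + 1 = total N L := by
  have hmem : y ∈ Finset.range (N + 1) := by simp; omega
  unfold total
  rw [← Finset.add_sum_erase _ _ hmem, ← Finset.add_sum_erase _ _ hmem]
  have : ∀ x ∈ (Finset.range (N + 1)).erase y,
      (Function.update L y l x).length = (L x).length := fun x hx => by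
    rw [Function.update_of_ne (Finset.ne_of_mem_erase hx)]
  rw [Finset.sum_congr rfl this]
  simp [hL]
  omega

/-- `L'` arises from `L` by insertion of edges of `R`. -/
def Grow (R : ℕ → ℕ → Prop) (L L' : ℕ → List ℕ) : Prop :=
  (∀ y, L y ⊆ L' y) ∧ ∀ y z, z ∈ L' y → z ∈ L y ∨ R y z

theorem Grow.refl (R : ℕ → ℕ → Prop) (L : ℕ → List ℕ) : Grow R L L :=
  ⟨fun _ => List.Subset.refl _, fun _ _ h => .inl h⟩

theorem Grow.trans {R : ℕ → ℕ → Prop} {L L' L'' : ℕ → List ℕ} (h : Grow R L L')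
    (h' : Grow R L' L'') : Grow R L L'' :=
  ⟨fun y => List.Subset.trans (h.1 y) (h'.1 y), fun y z hz => (h'.2 y z hz).elim (h.2 y z) .inr⟩

theorem Grow.push {R : ℕ → ℕ → Prop} (L : ℕ → List ℕ) {y z : ℕ} (h : R y z) :
    Grow R L (Function.update L y (z :: L y)) := by
  constructor
  · intro y'
    by_cases hy : y' = y
    · subst hy; simp
    · rw [Function.update_of_ne hy]; exact List.Subset.refl _
  · intro y' z' hz
    by_cases hy : y' = y
    · subst hy
      rw [Function.update_self] at hz
      rcases List.mem_cons.1 hz with rfl | hz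
      · exact .inr h
      · exact .inl hz
    · rw [Function.update_of_ne hy] at hz; exact .inl hz

theorem Queried.grow {E : ℕ → ℕ} {R : ℕ → ℕ → Prop} {L L' : ℕ → List ℕ} {w c : ℕ}
    (h : Queried E R L w c) (hL : Grow R L L') : Queried E R L' w c := by
  intro y v h1 h2 h3 h4 h5
  obtain ⟨y', v', k1, k2, k3, k4, k5⟩ := h y v h1 h2 h3 h4 h5
  exact ⟨y', v', k1, k2, k3, hL.1 _ k4, k5⟩

/-- Finds an edge from the subtree of `c` to the path above, and lists it. -/
def queryCode : Stmt :=
  findCode ;; .ite .lt ‡.best ‡.c (pushCode ‡.best ‡.bz) .skip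

/-- The variables that are changed by `queryCode`. -/
abbrev queryVars : List Var := [.best, .j, .y, .bz, .si, .sl, .lo, .hi, .mid, .res, .k]

/-- Of the 17 additional units, 5 pay for the test and the insertion into the list, and 12 are
stored with the listed edge for its later exploration. -/
theorem queryCode_spec {env : Env} {N g : ℕ} (hfit : env.Fits N) {P E : ℕ → ℕ}
    {R U : ℕ → ℕ → Prop} (hB : DFSBase N P E R U) {dep : ℕ → ℕ}
    (hdep : ∀ j, 2 ≤ j → j ≤ N → dep j = dep (P j) + 1) {σ : Store} (h : HasTree N g P E R σ)
    {w c : ℕ} (hw : σ.v .w = w) (hc : σ.v .c = c) (hw2 : 2 ≤ w) (hcN : c ≤ N) (hwP : w ≤ P c)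
    (hPw : P c < E w) (hPc : P c < c) {L : ℕ → List ℕ}
    (hL : Lists (σ.a .head) (σ.a .next) (σ.a .dst) (N + 1) (σ.v .k) L) (hk : σ.v .k < env.M)
    {a : ℤ} {Q : Store → ℤ → Prop}
    (hQ : ∀ σ' b L', Frame queryVars [.head, .next, .dst] σ σ' →
      Lists (σ'.a .head) (σ'.a .next) (σ'.a .dst) (N + 1) (σ'.v .k) L' → σ'.v .k ≤ σ.v .k + 1 →
      Grow R L L' → Queried E R L' w c →
      a - findCost N E w c (dep w) (dep (P c)) - 17 - 12 * total N L ≤ b - 12 * total N L' →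
        Q σ' b) : WP env queryCode σ a Q := by
  obtain ⟨hM2, hM, hM0⟩ := hfit.bounds
  simp only [queryCode, WP_seq]
  refine findCode_spec hfit hB hdep h hw hc hw2 hcN hwP hPw hPc ?_
  intro σ₁ b₁ hF hb hfound
  have hF' : Frame queryVars [.head, .next, .dst] σ σ₁ :=
    (Frame.refl _ _ σ).trans hF (by decide) (by decide)
  have e1 := hF.v .c (by decide)
  have e2 := hF.v .k (by decide)
  have e3 := hF.a .head (by decide)
  have e4 := hF.a .next (by decide)
  have e5 := hF.a .dst (by decide)
  obtain ⟨⟨hbc, hbest⟩, hall⟩ := hfound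
  simp only [pushCode, WP_seq, WP_set, WP_ite, WP_put, WP_skip]
  simp [e1, e2, e3, e4, e5, hc, Env.len]
  constructor
  · intro hlt
    obtain ⟨hR, hwb, hcb, hbE⟩ := hbest hlt
    repeat refine ⟨by omega, ?_⟩
    refine hQ _ _ (Function.update L (σ₁.v .best) (σ₁.v .bz :: L (σ₁.v .best)))
      ((((hF'.seta (by decide) _ _).seta (by decide) _ _).seta (by decide) _ _).setv
        (by decide) _) ?_ ?_ (Grow.push _ hR) ?_ ?_
    · simp [e3, e4, e5, e2]
      exact hL.push _ _
    · simp
    · intro y v h1 h2 h3 h4 h5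
      exact ⟨_, _, hwb, hall y v h1 h2 h3 h4 h5, hcb.trans_lt (hB.R_back _ _ hR (by omega)),
        by simp, hcb, hbE⟩
    · rw [total_push L (by omega)]
      push_cast
      omega
  · intro hle
    refine hQ _ _ L hF' ?_ ?_ (Grow.refl _ _) ?_ ?_
    · rwa [e3, e4, e5, e2]
    · omega
    · intro y v h1 h2 h3 h4 h5
      have := hall y v h1 h2 h3 h4 h5
      omega
    · omega

/-- The vertex `v` lies in a subtree that hangs from the path from `z` up to `w` and for which an
edge to the path has been listed. -/
def Covered (N : ℕ) (P E : ℕ → ℕ) (R : ℕ → ℕ → Prop) (L : ℕ → List ℕ) (w z v : ℕ) : Prop :=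
  ∃ c, 2 ≤ c ∧ c ≤ N ∧ OnPath E w z (P c) ∧ c ≤ v ∧ v < E c ∧
    (∀ v', c ≤ v' → v' < E c → ¬ OnPath E w z v') ∧ Queried E R L w c

theorem Covered.grow {N : ℕ} {P E : ℕ → ℕ} {R : ℕ → ℕ → Prop} {L L' : ℕ → List ℕ} {w z v : ℕ}
    (h : Covered N P E R L w z v) (hL : Grow R L L') : Covered N P E R L' w z v := by
  obtain ⟨c, h1, h2, h3, h4, h5, h6, h7⟩ := h
  exact ⟨c, h1, h2, h3, h4, h5, h6, h7.grow hL⟩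

/-! ### The potential, and its use for hanging subtrees. -/

/-- The unit of time in which potentials are measured. -/
def unit (N : ℕ) : ℕ := 3 * (4 * N.size + 12)

/-- The credits that are reserved for an unvisited subtree with `s` vertices. -/
def reserve (N s : ℕ) : ℕ := unit N * (s * s.size)

/-- The credits for the children of `x` below `c`, except `prev`. -/
def childReserve (N : ℕ) (P E : ℕ → ℕ) (w x prev c : ℕ) : ℕ :=
  ∑ c' ∈ (Finset.Icc 2 N).erase w, if P c' = x ∧ c' ≠ prev ∧ c' < c then reserve N (E c' - c') else 0

/-- The credits kept for the heavy subtree, until more than half of the vertices are treated. -/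
def heavyReserve (N s h len : ℕ) : ℕ := if 2 * h ≤ s then unit N * len else 0

/-- The number of vertices of the subtree at `x` that are treated when the child `c` is reached. -/
def treated (E : ℕ → ℕ) (x prev c : ℕ) : ℕ := c - x - 1 + if c ≤ prev then E prev - prev else 0

/-- Queries for the children of `x` except `prev`. -/
def childCode : Stmt :=
  .set .c (‡.x + 1) ;;
  .loop .lt ‡.c (.buf .E ‡.x) (
    .ite .ne ‡.c ‡.prev queryCode .skip ;;
    .set .c (.buf .E ‡.c))

/-- No child of `x` lies strictly between `c` and `E c`: the numbers there are proper descendants of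
`c`, whose parents are at least `c`. -/
theorem childReserve_step {N : ℕ} {P E : ℕ → ℕ} (hT : NumTree N P E) {w x prev c : ℕ}
    (hc2 : 2 ≤ c) (hcN : c ≤ N) (hcw : c ≠ w) (hP : P c = x) (hcx : x < c) :
    childReserve N P E w x prev (E c) = childReserve N P E w x prev c +
      if c = prev then 0 else reserve N (E c - c) := by
  have hmem : c ∈ (Finset.Icc 2 N).erase w := by simp [hc2, hcN, hcw]
  unfold childReserve
  rw [← Finset.add_sum_erase _ _ hmem, ← Finset.add_sum_erase _ _ hmem]
  have hE := hT.lt_end c (by omega) hcN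
  have : ∀ c' ∈ ((Finset.Icc 2 N).erase w).erase c,
      (if P c' = x ∧ c' ≠ prev ∧ c' < E c then reserve N (E c' - c') else 0) =
      if P c' = x ∧ c' ≠ prev ∧ c' < c then reserve N (E c' - c') else 0 := by
    intro c' hc'
    simp only [Finset.mem_erase, Finset.mem_Icc] at hc'
    have : P c' = x → c' < E c → c' < c := by
      intro h1 h2
      by_contra h3
      have := hT.le_par (y := c) (x := c') (by omega) (by omega) (by omega) h2
      omega
    congr 1
    simp only [eq_iff_iff]
    constructor
    · rintro ⟨h1, h2, h3⟩; exact ⟨h1, h2, this h1 h3⟩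
    · rintro ⟨h1, h2, h3⟩; exact ⟨h1, h2, by omega⟩
  rw [Finset.sum_congr rfl this]
  by_cases hcp : c = prev
  · simp [hcp]
  · simp [hP, hcp, hE]; omega

theorem size_lt_size {s s' : ℕ} (hs : 0 < s) (h : 2 * s ≤ s') : s.size + 1 ≤ s'.size := by
  have h1 := size_half (m := s') (by omega)
  have h2 := Nat.size_le_size (show s ≤ s' / 2 by omega)
  omega

/-- A subtree of at most half the size has a shorter binary length, so its share of the old reserve
exceeds its own reserve by one unit per vertex. This surplus pays for scanning it. -/
theorem reserve_light (N : ℕ) {s s' : ℕ} (hs : 0 < s) (h : 2 * s ≤ s') :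
    reserve N s + unit N * s ≤ unit N * s'.size * s := by
  have := Nat.mul_le_mul_left (unit N * s) (size_lt_size hs h)
  unfold reserve
  calc unit N * (s * s.size) + unit N * s = unit N * s * (s.size + 1) := by ring
    _ ≤ _ := this
    _ = _ := by ring

/-- A heavy subtree still gets its own reserve from its share, but without a surplus; the scan is
paid by `heavyReserve`. -/
theorem reserve_heavy (N : ℕ) {s s' : ℕ} (h : s ≤ s') :
    reserve N s ≤ unit N * s'.size * s := by
  have := Nat.mul_le_mul_left (unit N * s) (Nat.size_le_size h)
  unfold reserve
  calc unit N * (s * s.size) = unit N * s * (s.size) := by ring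
    _ ≤ _ := this
    _ = _ := by ring

theorem unit_ge {N : ℕ} (hN : 3 ≤ N) : 60 ≤ unit N := by
  have : Nat.size 3 ≤ N.size := Nat.size_le_size hN
  have h3 : Nat.size 3 = 2 := by decide
  unfold unit
  omega

/-- The amortized cost of the treatment of one child. -/
theorem child_cost {N : ℕ} (hN : 3 ≤ N) (E : ℕ → ℕ) {w c h dw dc len : ℕ} (hs : c < E c)
    (hh : h + (E c - c) ≤ E w - w) (hd : dc + 1 - dw ≤ len) (hl : 1 ≤ len) :
    findCost N E w c dw dc + 20 + reserve N (E c - c) +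
      heavyReserve N (E w - w) (h + (E c - c)) len ≤
      heavyReserve N (E w - w) h len + unit N * (E w - w).size * (E c - c) := by
  have hu := unit_ge hN
  have h0 : 0 < E c - c := by omega
  generalize hsc : E c - c = s at *
  generalize hsw : E w - w = s' at *
  have hk : 20 ≤ 4 * N.size + 12 := by unfold unit at hu; omega
  unfold findCost heavyReserve
  rw [hsc, hsw]
  by_cases hlight : 2 * s ≤ s'
  · have h1 := reserve_light N h0 hlight
    rw [if_pos hlight]
    have h2 : (4 * N.size + 12) * s + 28 ≤ unit N * s := by
      have : 2 * (4 * N.size + 12) * 1 ≤ 2 * (4 * N.size + 12) * s := Nat.mul_le_mul_left _ h0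
      have h3 : unit N * s = (4 * N.size + 12) * s + 2 * (4 * N.size + 12) * s := by
        unfold unit; ring
      omega
    split_ifs <;> omega
  -- Here `2 * s > s'` and `h + s ≤ s'`, so at most half of the vertices were treated before and
  -- more than half are afterwards. The heavy reserve is present and is spent now; it cannot be
  -- needed a second time.
  · have h1 := reserve_heavy N (show s ≤ s' by omega)
    rw [if_neg hlight, if_neg (by omega), if_pos (by omega)]
    have h2 : (4 * N.size + 12) * (dc + 1 - dw) + 28 ≤ unit N * len := by
      have h4 : (4 * N.size + 12) * (dc + 1 - dw) ≤ (4 * N.size + 12) * len :=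
        Nat.mul_le_mul_left _ hd
      have : 2 * (4 * N.size + 12) * 1 ≤ 2 * (4 * N.size + 12) * len := Nat.mul_le_mul_left _ hl
      have h3 : unit N * len = (4 * N.size + 12) * len + 2 * (4 * N.size + 12) * len := by
        unfold unit; ring
      omega
    omega

/-- The children of `x` are found by the jumps from `c` to `E c`. Every child other than `prev`
roots a hanging subtree: its share of the reserve of `w` pays for the query and for the reserve that
the subtree needs as a new unvisited region. The subtree of `prev` is skipped, as its hanging
subtrees were covered when the path passed below. -/
theorem childCode_spec {env : Env} {N g : ℕ} (hfit : env.Fits N) {P E : ℕ → ℕ}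
    {R U : ℕ → ℕ → Prop} (hB : DFSBase N P E R U) {dep : ℕ → ℕ}
    (hdep : ∀ j, 2 ≤ j → j ≤ N → dep j = dep (P j) + 1) {σ : Store} (h : HasTree N g P E R σ)
    {w x z prev : ℕ} (hw : σ.v .w = w) (hx : σ.v .x = x) (hp : σ.v .prev = prev) (hw2 : 2 ≤ w)
    (hzN : z ≤ N) (hpath : OnPath E w z x) (hzw : z < E w)
    (hprev : (prev = 0 ∧ x = z) ∨ (P prev = x ∧ x < prev ∧ OnPath E w z prev)) {L : ℕ → List ℕ}
    (hL : Lists (σ.a .head) (σ.a .next) (σ.a .dst) (N + 1) (σ.v .k) L)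
    {kb : ℕ} (hk : σ.v .k ≤ kb) (hkb : kb + N + 1 ≤ env.M)
    (hcov : ∀ v, prev ≤ v → v < E prev → prev ≠ 0 → ¬ OnPath E w z v → Covered N P E R L w z v)
    {a X : ℤ} (ha : X + unit N * (E w - w).size * (E w - w : ℕ) -
      unit N * (E w - w).size * treated E x prev (x + 1) +
      heavyReserve N (E w - w) (treated E x prev (x + 1)) (dep z + 1 - dep w) + 12 * total N L + 6
        ≤ a) {Q : Store → ℤ → Prop}
    (hQ : ∀ σ' b L', Frame (.c :: queryVars) [.head, .next, .dst] σ σ' →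
      Lists (σ'.a .head) (σ'.a .next) (σ'.a .dst) (N + 1) (σ'.v .k) L' → σ'.v .k ≤ kb + N + 1 →
      Grow R L L' → (∀ v, x < v → v < E x → ¬ OnPath E w z v → Covered N P E R L' w z v) →
      X + childReserve N P E w x prev (E x) + unit N * (E w - w).size * (E w - w : ℕ) -
        unit N * (E w - w).size * (E x - x - 1 : ℕ) +
        heavyReserve N (E w - w) (E x - x - 1) (dep z + 1 - dep w) + 12 * total N L' ≤ b →
        Q σ' b) : WP env childCode σ a Q := by
  obtain ⟨hM2, hM, hM0⟩ := hfit.bounds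
  have hT := hB.tree
  have hg := h.g_eq
  have hg1 := h.g_le
  have hN := h.N_eq
  obtain ⟨hwx, hxz, hzx⟩ := hpath
  have hEx := h.E_eq x (by omega) (by omega)
  have h2 := hT.end_le x (by omega) (by omega)
  have h3 := hT.lt_end w (by omega) (by omega)
  have h4 := hT.end_le w (by omega) (by omega)
  have h5 := hT.end_le_end (i := w) (j := x) (by omega) (by omega) hwx (by omega)
  have hdxz := hT.dep_mono hdep (y := x) (x := z) (by omega) hzN hxz hzx
  have hdwx := hT.dep_mono hdep (y := w) (x := x) (by omega) (by omega) hwx (by omega)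
  have hprevx : prev < E x := by
    rcases hprev with h | ⟨-, -, h⟩
    · omega
    · have := h.2.1; omega
  simp only [childCode, WP_seq, WP_set, Ex.buf]
  simp [hx, Env.len]
  refine ⟨by omega, ?_⟩
  -- The last summand prepays the single round, of cost 4, in which `prev` is skipped; it falls due
  -- when `c` has passed `prev`. As `treated` already counts the subtree of `prev`, skipping it
  -- changes nothing else in the balance.
  refine WP_loop (fun m σ' b => ∃ L', Frame (.c :: queryVars) [.head, .next, .dst] σ σ' ∧
    Lists (σ'.a .head) (σ'.a .next) (σ'.a .dst) (N + 1) (σ'.v .k) L' ∧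
    m = E x - σ'.v .c ∧ x < σ'.v .c ∧ σ'.v .c ≤ E x ∧ σ'.v .k ≤ kb + (σ'.v .c - x) ∧
    Grow R L L' ∧ (∀ j, x < j → j < σ'.v .c → E j ≤ σ'.v .c) ∧
    (∀ v, x < v → v < σ'.v .c → ¬ OnPath E w z v → Covered N P E R L' w z v) ∧
    X + childReserve N P E w x prev (σ'.v .c) + unit N * (E w - w).size * (E w - w : ℕ) -
      unit N * (E w - w).size * treated E x prev (σ'.v .c) +
      heavyReserve N (E w - w) (treated E x prev (σ'.v .c)) (dep z + 1 - dep w) +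
      12 * total N L' + 1 + (if σ'.v .c ≤ prev then 4 else 0) ≤ b) ?_ (E x - (x + 1)) ?_ ?_
  · rintro m σ' b ⟨L', hF, hL', rfl, hxc, hcE, hk', hgrow, hnest, hcov', hb⟩ Q' hQ'
    have e1 := hF.v .N (by decide)
    have e2 := hF.v .g (by decide)
    have e3 := hF.v .w (by decide)
    have e4 := hF.v .x (by decide)
    have e5 := hF.v .prev (by decide)
    have e6 := hF.a .E (by decide)
    generalize hc : σ'.v .c = c at *
    simp only [WP_seq, WP_set, WP_ite, WP_skip]
    simp [e1, e2, e3, e4, e5, e6, hg, hN, hw, hx, hp, hc, Env.len, hEx]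
    refine ⟨by omega, ?_⟩
    intro hlt
    have hPc := hT.child (x := x) (c := c) (by omega) (by omega) hxc hlt hnest
    have hEc := h.E_eq c (by omega) (by omega)
    have hcE' := hT.lt_end c (by omega) (by omega)
    have hEcx := hT.end_le_end (i := x) (j := c) (by omega) (by omega) hxc.le hlt
    have hnest' := hT.next_child (x := x) (c := c) (by omega) (by omega) hxc hlt hnest
    have hstep := childReserve_step hT (w := w) (prev := prev) (x := x) (c := c) (by omega)
      (by omega) (by omega) hPc hxc
    constructor
    · intro hcp
      have htr : treated E x prev (E c) = treated E x prev c + (E c - c) := by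
        unfold treated
        have : c ≤ prev → E c ≤ prev := by
          intro hle
          by_contra hlt'
          rcases hprev with h | ⟨h, -, h'⟩
          · omega
          · have := hT.le_par (y := c) (x := prev) (by omega) (by have := h'.2.1; omega) (by omega)
              (by omega)
            omega
        split_ifs <;> omega
      have htr' : treated E x prev c + (E c - c) ≤ E w - w := by
        rw [← htr]
        unfold treated
        split_ifs with hle
        · have : E prev ≤ E x := by
            rcases hprev with h | ⟨h, h1, -⟩
            · omega
            · exact hT.end_le_end (by omega) (by omega) h1.le hprevx
          have hpp : prev < E prev := by
            rcases hprev with h | ⟨h, h1, h1'⟩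
            · omega
            · exact h1'.lt_end
          omega
        · omega
      -- A path vertex in the subtree of `c` would make `c` an ancestor of `z`, as `prev` is; but
      -- two different siblings have no common descendant.
      have hnopath : ∀ v', c ≤ v' → v' < E c → ¬ OnPath E w z v' := by
        intro v' k1 k2 k3
        have hEv := hT.end_le_end (i := c) (j := v') (by omega) (by omega) k1 k2
        obtain ⟨k4, k5, k6⟩ := k3
        rcases hprev with ⟨-, h⟩ | ⟨p1, p2, p3, p4, p5⟩
        · omega
        · rcases lt_or_gt_of_ne hcp with hlt' | hlt'
          · have := hT.le_par (y := c) (x := prev) (by omega) (by omega) hlt' (by omega)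
            omega
          · have := hT.le_par (y := prev) (x := c) (by omega) (by omega) hlt' (by omega)
            omega
      have hcost := child_cost hfit.three_le E (w := w) (c := c) (h := treated E x prev c)
        (dw := dep w) (dc := dep x) (len := dep z + 1 - dep w) hcE' htr' (by omega) (by omega)
      refine queryCode_spec hfit hB hdep (h.frame hF) (by rw [e3, hw]) hc hw2 (by omega)
        (by omega) (by omega) (by omega) hL' (by omega) ?_
      intro σ₁ b₁ L₁ hF₁ hL₁ hk₁ hgrow₁ hq hb₁
      have f2 := hF₁.v .g (by decide)
      have f4 := hF₁.v .c (by decide)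
      have f6 := hF₁.a .E (by decide)
      have hFF := hF.trans hF₁ (by decide) (by decide)
      simp [f2, f4, f6, e2, e6, hg, hc, hEc]
      repeat refine ⟨by omega, ?_⟩
      refine hQ' _ _ _ ?_ ⟨L₁, hFF.setv (by decide) _, by simpa using hL₁, rfl, ?_, ?_, ?_,
        hgrow.trans hgrow₁, ?_, ?_, ?_⟩
      · simp; omega
      · simp; omega
      · simp; omega
      · simp; omega
      · simpa using hnest'
      · simp
        intro v hv1 hv2 hv3
        by_cases hvc : v < c
        · exact (hcov' v hv1 hvc hv3).grow hgrow₁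
        · exact ⟨c, by omega, by omega, by rw [hPc]; exact ⟨hwx, hxz, hzx⟩, by omega, hv2, hnopath,
            hq⟩
      · simp only [Store.setv_v, if_true]
        rw [hstep, if_neg hcp, htr]
        rw [hPc] at hb₁
        push_cast
        have hm : (unit N : ℤ) * ((E w - w).size) * (treated E x prev c + ((E c - c : ℕ) : ℤ)) =
          unit N * ((E w - w).size) * treated E x prev c + unit N * (E w - w).size * (E c - c : ℕ) :=
            by ring
        rw [hm]
        zify at hcost
        have hif : (if E c ≤ prev then (4 : ℤ) else 0) ≤ if c ≤ prev then 4 else 0 := by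
          split_ifs <;> omega
        omega
    · rintro rfl
      have htr : treated E x c (E c) = treated E x c c := by
        unfold treated
        rw [if_neg (by omega), if_pos le_rfl]; omega
      simp [e2, e6, hg, hc, hEc]
      repeat refine ⟨by omega, ?_⟩
      refine hQ' _ _ _ ?_ ⟨L', hF.setv (by decide) _, by simpa using hL', rfl, ?_, ?_, ?_,
        hgrow, ?_, ?_, ?_⟩
      · simp; omega
      · simp; omega
      · simp; omega
      · simp; omega
      · simpa using hnest'
      · simp
        intro v hv1 hv2 hv3
        by_cases hvc : v < c
        · exact hcov' v hv1 hvc hv3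
        · exact (hcov v (by omega) hv2 (by omega) hv3).grow hgrow
      · simp only [Store.setv_v, if_true]
        rw [hstep, if_pos rfl, htr]
        rw [if_pos le_rfl] at hb
        rw [if_neg (by omega)]
        push_cast
        omega
  · refine ⟨L, (Frame.refl _ _ σ).setv (by decide) _, ?_, ?_, ?_, ?_, ?_, Grow.refl _ _, ?_, ?_, ?_⟩
    · simpa using hL
    · simp
    · simp
    · simp; omega
    · simp; omega
    · simp; intro j h1 h2; omega
    · simp; intro j h1 h2; omega
    · simp only [Store.setv_v, if_true]
      have : childReserve N P E w x prev (x + 1) = 0 := by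
        unfold childReserve
        refine Finset.sum_eq_zero fun c' hc' => ?_
        rw [if_neg]
        rintro ⟨k1, k2, k3⟩
        simp only [Finset.mem_erase, Finset.mem_Icc] at hc'
        have := hT.lt c' (by omega) (by omega)
        omega
      rw [this]
      have hif : (if x + 1 ≤ prev then (4 : ℤ) else 0) ≤ 4 := by split_ifs <;> omega
      push_cast
      omega
  · rintro m σ' b ⟨L', hF, hL', rfl, hxc, hcE, hk', hgrow, hnest, hcov', hb⟩ hn
    have e2 := hF.v .g (by decide)
    have e4 := hF.v .x (by decide)
    have e6 := hF.a .E (by decide)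
    simp [e2, e4, e6, hg, hx, hEx] at hn
    have hc : σ'.v .c = E x := by omega
    rw [hc] at hk' hcov' hb
    refine hQ _ _ L' hF hL' (by omega) hgrow hcov' ?_
    have htr : treated E x prev (E x) = E x - x - 1 := by
      unfold treated; rw [if_neg (by omega)]; omega
    rw [htr, if_neg (by omega)] at hb
    omega


/-! ### Visiting a path -/

/-- The credits for the maximal unvisited subtrees with roots in `s`. -/
def rootsReserve (N : ℕ) (P E : ℕ → ℕ) (s : Finset ℕ) (num : ℕ → ℕ) : ℕ :=
  ∑ c ∈ s, if num c = 0 ∧ num (P c) ≠ 0 then reserve N (E c - c) else 0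

/-- Visiting `x` turns exactly its unvisited children into roots of maximal unvisited subtrees. No
root disappears from the sum: a path vertex other than `w` still has an unvisited parent, and `w` is
left out because its reserve is being spent. -/
theorem rootsReserve_visit {N : ℕ} {P E : ℕ → ℕ} (hT : NumTree N P E) {num : ℕ → ℕ}
    {w x prev t : ℕ} (ht : t ≠ 0) (hx2 : 2 ≤ x) (hx : num x = 0) (hroot : x ≠ w → num (P x) = 0)
    (hprev : ∀ c, 2 ≤ c → c ≤ N → P c = x → (num c = 0 ↔ c ≠ prev)) :
    rootsReserve N P E ((Finset.Icc 2 N).erase w) (Function.update num x t) =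
      rootsReserve N P E ((Finset.Icc 2 N).erase w) num + childReserve N P E w x prev (E x) := by
  unfold rootsReserve childReserve
  rw [← Finset.sum_add_distrib]
  refine Finset.sum_congr rfl fun c hc => ?_
  simp only [Finset.mem_erase, Finset.mem_Icc] at hc
  have h1 := hT.lt c hc.2.1 hc.2.2
  have h2 := hT.lt_end_par hc.2.1 hc.2.2
  by_cases hcx : c = x
  · subst hcx
    have h3 := hroot hc.1
    simp [ht, h3]
    intro h
    omega
  · rw [Function.update_of_ne hcx]
    by_cases hPc : P c = x
    · have h4 := hprev c hc.2.1 hc.2.2 hPc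
      rw [hPc] at h2
      simp [hPc, ht, hx, h4, h2]
    · rw [Function.update_of_ne hPc]
      simp [hPc]

/-- Visits the path of the base tree from `z` up to its topmost unvisited vertex. -/
def enterCode : Stmt :=
  .set .w ‡.z ;;
  .loop .eq (.get .num (.buf .P ‡.w)) 0 (.set .w (.buf .P ‡.w)) ;;
  .set .x ‡.z ;; .set .prev 0 ;; .set .q ‡.cur ;;
  .loop .le ‡.w ‡.x (
    .put .num ‡.x ‡.t ;; .set .t (‡.t + 1) ;; .put .Q ‡.x ‡.q ;;
    childCode ;;
    .set .prev ‡.x ;; .set .q ‡.x ;; .set .x (.buf .P ‡.x)) ;;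
  .set .cur ‡.w

/-- The variables that are changed by `enterCode`. -/
abbrev enterVars : List Var := .w :: .x :: .prev :: .q :: .t :: .cur :: .c :: queryVars

/-- The arrays that are changed by `enterCode`. -/
abbrev enterArrs : List Arr := [.num, .Q, .head, .next, .dst]

/-- The child of `x` on the path is the one visited before `x`. -/
theorem onPath_child {N : ℕ} {P E : ℕ → ℕ} (hT : NumTree N P E) {w z x prev c : ℕ} (hw : 2 ≤ w)
    (hz : z ≤ N) (hprev : (prev = 0 ∧ x = z) ∨ (P prev = x ∧ x < prev ∧ OnPath E w z prev))
    (hP : P c = x) (hxc : x < c) (hc : OnPath E w z c) : c = prev := by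
  obtain ⟨h1, h2, h3⟩ := hc
  rcases hprev with ⟨-, h⟩ | ⟨p1, p2, p3, p4, p5⟩
  · omega
  · rcases lt_trichotomy c prev with hlt | heq | hlt
    · have := hT.le_par (y := c) (x := prev) (by omega) (by omega) hlt (by omega)
      omega
    · exact heq
    · have := hT.le_par (y := prev) (x := c) (by omega) (by omega) hlt (by omega)
      omega

-- The reserve of the subtree of `w` is distributed among the subtrees hanging from the path. In
-- addition each path vertex releases two units: one forms the heavy reserve, which may pay for a
-- scan of the whole path, and the other, worth at least 60, covers climbing to `w` and the constant
-- work per vertex. Numbers increase by one as depths decrease by one, so higher path vertices get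
-- the larger numbers required by `Round.enter`.
set_option maxHeartbeats 1000000 in
theorem enterCode_spec {env : Env} {N g : ℕ} (hfit : env.Fits N) {P E : ℕ → ℕ}
    {R U : ℕ → ℕ → Prop} (hB : DFSBase N P E R U) {dep : ℕ → ℕ}
    (hdep : ∀ j, 2 ≤ j → j ≤ N → dep j = dep (P j) + 1) {σ : Store} (h : HasTree N g P E R σ)
    {L : ℕ → List ℕ} (hR : Round N P (Edge N R U) U (σ.a .num) (σ.a .fin) (σ.a .Q) (σ.v .t)
      (σ.v .cur) L) (hcur : σ.v .cur ≠ 0) {l : List ℕ} (hLc : L (σ.v .cur) = σ.v .z :: l)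
    (hz0 : σ.a .num (σ.v .z) = 0)
    (hL : Lists (σ.a .head) (σ.a .next) (σ.a .dst) (N + 1) (σ.v .k)
      (Function.update L (σ.v .cur) l))
    {kb : ℕ} (hk : σ.v .k ≤ kb + σ.v .t * (N + 1)) (hkb : kb + (N + 2) * (N + 1) ≤ env.M)
    {a X : ℤ} (ha : X + rootsReserve N P E (Finset.Icc 2 N) (σ.a .num) +
      2 * unit N * (N + 1 - σ.v .t : ℤ) + 12 * total N (Function.update L (σ.v .cur) l) ≤ a)
    {Q : Store → ℤ → Prop}
    (hQ : ∀ σ' b L', Frame enterVars enterArrs σ σ' →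
      Round N P (Edge N R U) U (σ'.a .num) (σ'.a .fin) (σ'.a .Q) (σ'.v .t) (σ'.v .cur) L' →
      Lists (σ'.a .head) (σ'.a .next) (σ'.a .dst) (N + 1) (σ'.v .k) L' →
      σ'.v .k ≤ kb + σ'.v .t * (N + 1) →
      X + rootsReserve N P E (Finset.Icc 2 N) (σ'.a .num) +
        2 * unit N * (N + 1 - σ'.v .t : ℤ) + 12 * total N L' ≤ b → Q σ' b) :
    WP env enterCode σ a Q := by
  obtain ⟨hM2, hM, hM0⟩ := hfit.bounds
  have hT := hB.tree
  have hg := h.g_eq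
  have hg1 := h.g_le
  have hN := h.N_eq
  generalize hcu : σ.v .cur = cur at *
  generalize hz : σ.v .z = z at *
  generalize ht : σ.v .t = t at *
  have hzmem := hR.snd cur z (by rw [hLc]; simp)
  have hzr := hB.edge_rng (hB.edge_symm hzmem)
  have hz1 : z ≠ 1 := by rintro rfl; rw [hR.num_one] at hz0; omega
  have htN := hR.t_le
  simp only [enterCode, WP_seq, WP_set, WP_ite, WP_put, Ex.buf]
  simp [hz]
  refine WP_loop (fun m σ' b => Frame [.w] [] σ σ' ∧ m = σ'.v .w ∧ 2 ≤ σ'.v .w ∧ σ'.v .w ≤ z ∧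
    z < E (σ'.v .w) ∧ σ.a .num (σ'.v .w) = 0 ∧ a - 1 - 2 * (dep z - dep (σ'.v .w)) ≤ b) ?_ z ?_ ?_
  · rintro m σ' b ⟨hF, rfl, hw2, hwz, hzw, hw0, hb⟩ Q' hQ'
    have e2 := hF.v .g (by decide)
    have e3 := hF.a .P (by decide)
    have e4 := hF.a .num (by decide)
    generalize hw : σ'.v .w = w at *
    have hPw := h.P_eq w (by omega) (by omega)
    have hPlt := hT.lt w (by omega) (by omega)
    have hPle := hT.one_le w (by omega) (by omega)
    simp only [WP_set]
    simp [e2, e3, e4, hg, hw, Env.len, hPw]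
    repeat refine ⟨by omega, ?_⟩
    intro h0
    repeat refine ⟨by omega, ?_⟩
    refine hQ' _ _ _ ?_ ⟨hF.setv (by decide) _, rfl, ?_, ?_, ?_, ?_, ?_⟩
    · simp; omega
    · simp
      by_contra hlt
      have : P w = 1 := by omega
      rw [this, hR.num_one] at h0; omega
    · simp; omega
    · simp
      have b3 := hT.lt_end_par (x := w) hw2 (by omega)
      have b4 := hT.end_le_end (i := P w) (j := w) (by omega) (by omega) hPlt.le b3
      omega
    · simp; exact h0
    · simp
      have := hdep w hw2 (by omega)
      omega
  · refine ⟨(Frame.refl _ _ σ).setv (by decide) _, ?_, ?_, ?_, ?_, ?_, ?_⟩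
    · simp
    · simp; omega
    · simp
    · simp; exact hT.lt_end z (by omega) (by omega)
    · simpa using hz0
    · simp
  rintro m σ₁ b₁ ⟨hF₁, rfl, hw2, hwz, hzw, hw0, hb₁⟩ hPw0
  have e2 := hF₁.v .g (by decide)
  have e3 := hF₁.a .P (by decide)
  have e4 := hF₁.a .num (by decide)
  have e5 := hF₁.v .z (by decide)
  have e6 := hF₁.v .cur (by decide)
  generalize hw : σ₁.v .w = w at *
  have hPw := h.P_eq w (by omega) (by omega)
  have hPwlt := hT.lt w (by omega) (by omega)
  have hPwle := hT.one_le w (by omega) (by omega)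
  simp [e2, e3, e4, hg, hw, hPw] at hPw0
  have hEw := hT.end_le w (by omega) (by omega)
  have hun : ∀ v, w ≤ v → v < E w → σ.a .num v = 0 :=
    fun v h1 h2 => hR.unvisited hT hw2 (by omega) hw0 h1 h2
  have hdwz := hT.dep_mono hdep (y := w) (x := z) (by omega) (by omega) hwz hzw
  have hF₁' : Frame enterVars enterArrs σ σ₁ :=
    (Frame.refl _ _ σ).trans hF₁ (by decide) (by decide)
  have hwmem : w ∈ Finset.Icc 2 N := by simp; omega
  have hunit := unit_ge hfit.three_le
  set s := (Finset.Icc 2 N).erase w with hs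
  have hroots : rootsReserve N P E (Finset.Icc 2 N) (σ.a .num) =
      reserve N (E w - w) + rootsReserve N P E s (σ.a .num) := by
    unfold rootsReserve
    rw [← Finset.add_sum_erase _ _ hwmem, if_pos ⟨hw0, hPw0⟩]
  have hlen1 : ((dep z + 1 - dep w : ℕ) : ℤ) = dep z + 1 - dep w := by
    rw [Nat.cast_sub (by omega)]; push_cast; ring
  -- The other credits, after the two units for each of the `dep z + 1 - dep w` path vertices have
  -- been withdrawn.
  set Z : ℤ := X + 2 * unit N * (N + 1 - t : ℤ) - 2 * unit N * (dep z + 1 - dep w : ℕ) with hZ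
  simp [e5, e6, hz, hcu]
  -- Here `x` is the next path vertex, and `prev` the one just visited, or `0` at the start. The
  -- parent `q` of `x` in the new tree is `prev`, or the old current vertex for `x = z`. The number
  -- `hh` of treated vertices is the size of the subtree of `prev`, so it accumulates along the
  -- whole path.
  refine WP_loop (fun m σ' b => ∃ L', Frame enterVars enterArrs σ σ' ∧
    Lists (σ'.a .head) (σ'.a .next) (σ'.a .dst) (N + 1) (σ'.v .k) L' ∧
    σ'.v .k ≤ kb + σ'.v .t * (N + 1) ∧ m = σ'.v .x ∧ σ'.v .w = w ∧
    ((σ'.v .x = P w ∧ σ'.v .prev = w) ∨ OnPath E w z (σ'.v .x)) ∧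
    ((σ'.v .prev = 0 ∧ σ'.v .x = z ∧ σ'.v .q = cur) ∨ (P (σ'.v .prev) = σ'.v .x ∧
      σ'.v .x < σ'.v .prev ∧ OnPath E w z (σ'.v .prev) ∧ σ'.v .q = σ'.v .prev)) ∧
    Search N (Edge N R U) U (σ'.a .num) (σ.a .fin) (σ'.a .Q) (σ'.v .t) (σ'.v .q) L' ∧
    (∀ y, σ'.a .num y ≠ 0 ↔ σ.a .num y ≠ 0 ∨ (OnPath E w z y ∧ σ'.v .x < y)) ∧
    (∀ y, σ.a .num y ≠ 0 → σ'.a .num y = σ.a .num y) ∧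
    σ'.v .t + dep (σ'.v .x) = t + dep z ∧
    (∀ y, OnPath E w z y → σ'.v .x < y → σ'.a .num y + dep y = t + dep z) ∧
    (∀ v, σ'.v .prev ≤ v → v < E (σ'.v .prev) → σ'.v .prev ≠ 0 → ¬ OnPath E w z v →
      Covered N P E R L' w z v) ∧
    Grow R (Function.update L cur l) L' ∧
    (∃ hh : ℕ, hh = (if σ'.v .prev = 0 then 0 else E (σ'.v .prev) - σ'.v .prev) ∧
      Z + rootsReserve N P E s (σ'.a .num) + unit N * (E w - w).size * (E w - w : ℕ) -
      unit N * (E w - w).size * hh + heavyReserve N (E w - w) hh (dep z + 1 - dep w) +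
      12 * total N L' + 20 * (dep (σ'.v .x) + 1 - dep w : ℤ) + 3 ≤ b)) ?_ z ?_ ?_
  · rintro m σ' b ⟨L', hF, hL', hk', rfl, hw', hpos, hprev, hS, hvis, hold, ht', hnum, hcov, hgrow,
      hh, hheq, hb⟩ Q' hQ'
    have f1 := hF.v .N (by decide)
    have f2 := hF.v .g (by decide)
    have hH' := h.frame hF
    generalize hx : σ'.v .x = x at *
    generalize hp : σ'.v .prev = prev at *
    generalize hq : σ'.v .q = q at *
    generalize ht1 : σ'.v .t = t1 at *
    have ht1N := hS.t_le
    have ht1N' : t1 * (N + 1) ≤ (N + 1) * (N + 1) := Nat.mul_le_mul_right _ ht1N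
    have ht1pos : t1 ≠ 0 := by have := hS.card; omega
    have hkb2 : (N + 2) * (N + 1) = (N + 1) * (N + 1) + (N + 1) := by ring
    simp only [WP_seq, WP_set, WP_ite, WP_put]
    simp [f2, hg, hw', hx, hp, hq, ht1, Env.len]
    intro hwx
    have hxp : OnPath E w z x := by
      rcases hpos with h | h
      · omega
      · exact h
    obtain ⟨-, hxz, hzx⟩ := hxp
    have hx0 : σ'.a .num x = 0 := by
      by_contra hne
      rcases (hvis x).1 hne with h | h
      · exact h (hun x hwx (by omega))
      · omega
    have hq0 : q ≠ 0 := by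
      rcases hprev with h | h
      · omega
      · omega
    have hHq : Edge N R U q x := by
      rcases hprev with ⟨-, h1, h2⟩ | ⟨h1, h2, h3, h4⟩
      · rw [h1, h2]; exact hzmem
      · rw [h4, ← h1]
        exact hB.edge_symm (hB.edge_par (by omega) (by have := h3.2.1; omega))
    have hprev' : (prev = 0 ∧ x = z) ∨ (P prev = x ∧ x < prev ∧ OnPath E w z prev) :=
      hprev.imp (fun h => ⟨h.1, h.2.1⟩) fun h => ⟨h.1, h.2.1, h.2.2.1⟩
    have hchild : ∀ c, 2 ≤ c → c ≤ N → P c = x → (σ'.a .num c = 0 ↔ c ≠ prev) := by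
      intro c hc2 hcN hPc
      have c1 := hT.lt c hc2 hcN
      have c2 := hT.lt_end_par hc2 hcN
      have c3 := hT.end_le_end (i := w) (j := x) (by omega) (by omega) hwx (by omega)
      rw [hPc] at c1 c2
      constructor
      · rintro hc0 rfl
        rcases hprev' with h | h
        · omega
        · exact (hvis c).2 (.inr ⟨h.2.2, h.2.1⟩) hc0
      · intro hne
        by_contra hc0
        rcases (hvis c).1 hc0 with h | h
        · exact h (hun c (by omega) (by omega))
        · exact hne (onPath_child hT hw2 (by omega) hprev' hPc c1 h.1)
    have hrv := rootsReserve_visit hT (w := w) (x := x) (prev := prev) ht1pos (by omega) hx0 (by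
      intro hxw
      by_contra hne
      have c1 := hT.lt x (by omega) (by omega)
      have c2 := hT.le_par (y := w) (x := x) (by omega) (by omega) (by omega) (by omega)
      rcases (hvis (P x)).1 hne with h | h
      · exact h (hun _ c2 (by omega))
      · omega) hchild
    rw [← hs] at hrv
    have hSv := hS.visit (fun _ _ => hB.edge_symm) (x := x) (by omega) (by omega) hq0 hx0 hHq
    have htreat : treated E x prev (x + 1) = hh := by
      rw [hheq]
      unfold treated
      rcases hprev' with ⟨h, -⟩ | ⟨-, h, -⟩
      · rw [if_neg (by omega), if_pos h]; omega
      · rw [if_pos (by omega), if_neg (by omega)]; omega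
    repeat refine ⟨by omega, ?_⟩
    refine childCode_spec hfit hB hdep (w := w) (x := x) (z := z) (prev := prev) (L := L')
      (σ := ((σ'.seta .num x t1).setv .t (t1 + 1)).seta .Q x q)
      (g := g) (kb := kb + t1 * (N + 1))
      (X := Z + rootsReserve N P E s (σ'.a .num) + 20 * (dep x - dep w : ℤ) + 10)
      (hH'.congr rfl rfl rfl rfl rfl rfl) ?_ ?_ ?_ hw2 (by omega) ⟨hwx, hxz, hzx⟩ hzw hprev'
      ?_ ?_ ?_ hcov ?_ ?_
    · simp [hw']
    · simp [hx]
    · simp [hp]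
    · simpa using hL'
    · simp; omega
    · omega
    · rw [htreat]; omega
    intro σ₂ b₂ L₂ hF₂ hL₂ hk₂ hgrow₂ hcov₂ hb₂
    have k1 := hF₂.v .x (by decide)
    have k2 := hF₂.v .g (by decide)
    have k3 := hF₂.a .P (by decide)
    have k4 := hF₂.a .num (by decide)
    have k5 := hF₂.a .Q (by decide)
    have k6 := hF₂.v .t (by decide)
    have k7 := hF₂.v .w (by decide)
    simp [f2, hg, hx, hF.a .P (by decide)] at k1 k2 k3 k4 k5 k6 k7
    have hPx := h.P_eq x (by omega) (by omega)
    have hPxlt := hT.lt x (by omega) (by omega)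
    have hdx := hdep x (by omega) (by omega)
    have hxE := hT.lt_end_par (x := x) (by omega) (by omega)
    have hEE := hT.end_le_end (i := P x) (j := x) (hT.one_le x (by omega) (by omega)) (by omega)
      hPxlt.le hxE
    have hpathx : ∀ y, OnPath E w z y ∧ P x < y ↔ (OnPath E w z y ∧ x < y) ∨ y = x := by
      intro y
      constructor
      · rintro ⟨hy, hlt⟩
        by_cases hyx : x < y
        · exact .inl ⟨hy, hyx⟩
        · by_cases hye : y = x
          · exact .inr hye
          · have := hT.le_par (y := y) (x := x) (by have := hy.1; omega) (by omega) (by omega)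
              (by have := hy.2.2; omega)
            omega
      · rintro (⟨h1, h2⟩ | rfl)
        · exact ⟨h1, by omega⟩
        · exact ⟨⟨hwx, hxz, hzx⟩, hPxlt⟩
    have hFF : Frame enterVars enterArrs σ σ₂ :=
      Frame.trans (((hF.seta (by decide) _ _).setv (by decide) _).seta (by decide) _ _) hF₂
        (by decide) (by decide)
    have hxz' : x ≠ 0 := by omega
    simp [k1, k2, k3, hPx]
    repeat refine ⟨by omega, ?_⟩
    refine hQ' _ _ _ ?_ ⟨L₂, ((hFF.setv (by decide) _).setv (by decide) _).setv (by decide) _,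
      by simpa using hL₂, ?_, rfl, by simp [k7, hw'], ?_, ?_, ?_, ?_, ?_, ?_, ?_, ?_,
      hgrow.trans hgrow₂, E x - x, ?_, ?_⟩
    · simp; exact hPxlt
    · simp [k6, ht1]
      have : (t1 + 1) * (N + 1) = t1 * (N + 1) + (N + 1) := by ring
      omega
    · simp
      rcases hwx.eq_or_lt with h1 | h1
      · exact .inl ⟨by rw [h1], by omega⟩
      · have := hT.le_par (y := w) (x := x) (by omega) (by omega) h1 (by omega)
        exact .inr ⟨this, by omega, by omega⟩
    · simp
      exact .inr ⟨hPxlt, hwx, hxz, hzx⟩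
    · simp [k4, k5, k6, hq, ht1]
      refine hSv.setL (fun y z' hz' => ?_) (fun y z' hu hy => hgrow₂.1 _ (hSv.cmp y z' hu hy))
      rcases hgrow₂.2 y z' hz' with h | h
      · exact hSv.snd y z' h
      · exact .inl h
    · intro y
      simp [k4, ht1]
      rw [hpathx y]
      by_cases hyx : y = x
      · subst hyx; simp [ht1pos]
      · rw [Function.update_of_ne hyx]
        have hv := hvis y
        simp only [ne_eq] at hv
        rw [hv]
        simp [hyx]
    · intro y hy
      simp [k4, ht1]
      rw [Function.update_of_ne]
      · exact hold y hy
      · rintro rfl; exact hy (hun _ hwx (by omega))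
    · simp [k6, ht1]
      omega
    · intro y hy hyx
      simp [k4, ht1] at hyx ⊢
      rcases (hpathx y).1 ⟨hy, hyx⟩ with h | rfl
      · rw [Function.update_of_ne (by omega)]
        exact hnum y h.1 h.2
      · simp; omega
    · simp
      intro v hv1 hv2 _ hv3
      rcases hv1.eq_or_lt with rfl | hlt
      · exact absurd ⟨hwx, hxz, hzx⟩ hv3
      · exact hcov₂ v hlt hv2 hv3
    · simp [hxz']
    · simp [k4, ht1]
      rw [hrv]
      have hEx := hT.lt_end x (by omega) (by omega)
      -- Now `x` itself counts as treated as well. This lowers the required credits, and the surplus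
      -- is given up.
      have hm : (unit N : ℤ) * (E w - w).size * ((E x - x : ℕ) : ℤ) =
          unit N * (E w - w).size * ((E x - x - 1 : ℕ) : ℤ) + unit N * (E w - w).size := by
        rw [show E x - x = E x - x - 1 + 1 by omega]; push_cast; ring
      have hhv : heavyReserve N (E w - w) (E x - x) (dep z + 1 - dep w) ≤
          heavyReserve N (E w - w) (E x - x - 1) (dep z + 1 - dep w) := by
        unfold heavyReserve
        split_ifs <;> omega
      have hpos : (0 : ℤ) ≤ unit N * (E w - w).size := by positivity
      push_cast
      omega
  · refine ⟨Function.update L cur l, (((hF₁'.setv (by decide) _).setv (by decide) _).setv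
      (by decide) _), ?_, ?_, ?_, ?_, ?_, ?_, ?_, ?_, ?_, ?_, ?_, ?_, Grow.refl _ _, 0, ?_, ?_⟩
    · simpa [hF₁.a .head (by decide), hF₁.a .next (by decide), hF₁.a .dst (by decide),
        hF₁.v .k (by decide)] using hL
    · simpa [hF₁.v .k (by decide), hF₁.v .t (by decide), ht] using hk
    · simp
    · simpa using hw
    · simp
      exact .inr ⟨hwz, le_rfl, hT.lt_end z (by omega) (by omega)⟩
    · simp
    · simp [e4, hF₁.a .Q (by decide), hF₁.v .t (by decide), ht]
      refine hR.toSearch.setL (fun y z' hz' => ?_) (fun y z' hu hy => ?_)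
      · by_cases hy : y = cur
        · subst hy
          rw [Function.update_self] at hz'
          exact hR.snd y z' (by rw [hLc]; exact List.mem_cons_of_mem _ hz')
        · rw [Function.update_of_ne hy] at hz'; exact hR.snd y z' hz'
      · rw [Function.update_of_ne]
        · exact hR.cmp y z' hu hy
        · rintro rfl; exact (hR.cur_stk hcur).1 hy
    · intro y
      simp [e4]
      intro h1 h2
      have := h1.2.1; omega
    · intro y _
      simp [e4]
    · simp [hF₁.v .t (by decide), ht]
    · simp
      intro y h1 h2
      have := h1.2.1; omega
    · simp
    · simp
    · simp [e4]
      have hres : (reserve N (E w - w) : ℤ) = unit N * (E w - w).size * (E w - w : ℕ) := by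
        unfold reserve; push_cast; ring
      have hhv : (heavyReserve N (E w - w) 0 (dep z + 1 - dep w) : ℤ) ≤
          unit N * (dep z + 1 - dep w : ℕ) := by
        unfold heavyReserve
        split_ifs
        · push_cast; exact le_rfl
        · positivity
      have hul : (60 : ℤ) * (dep z + 1 - dep w : ℕ) ≤ unit N * (dep z + 1 - dep w : ℕ) := by
        have : (60 : ℤ) ≤ unit N := by exact_mod_cast hunit
        exact mul_le_mul_of_nonneg_right this (by positivity)
      have h2u : (2 : ℤ) * unit N * (dep z + 1 - dep w : ℕ) =
        unit N * (dep z + 1 - dep w : ℕ) + unit N * (dep z + 1 - dep w : ℕ) := by ring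
      rw [hroots] at ha
      push_cast at ha
      rw [hres] at ha
      rw [hZ, h2u]
      generalize (unit N : ℤ) * (dep z + 1 - dep w : ℕ) = A at *
      omega
  · rintro m σ' b ⟨L', hF, hL', hk', rfl, hw', hpos, hprev, hS, hvis, hold, ht', hnum, hcov, hgrow,
      hh, hheq, hb⟩ hn
    simp [hw'] at hn
    have hxP : σ'.v .x = P w ∧ σ'.v .prev = w := by
      rcases hpos with h | h
      · exact h
      · have := h.1; omega
    have hq : σ'.v .q = w := by
      rcases hprev with h | h
      · omega
      · rw [h.2.2.2, hxP.2]
    rw [hxP.1] at ht' hvis hnum hb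
    rw [hxP.2] at hcov hheq
    rw [if_neg (by omega)] at hheq
    rw [hq] at hS
    rw [hheq] at hb
    have hdw := hdep w hw2 (by omega)
    have hPle : ∀ y, OnPath E w z y → P w < y := fun y hy => by have := hy.1; omega
    have hdle : ∀ y y', OnPath E w z y → OnPath E w z y' → y' ≤ y → dep y' ≤ dep y := by
      intro y y' hy hy' hle
      exact hT.dep_mono hdep (by have := hy'.1; omega) (by have := hy.2.1; omega) hle
        (by have := hy.2.1; have := hy'.2.2; omega)
    have hnum' : ∀ y, OnPath E w z y → σ'.a .num y + dep y = t + dep z :=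
      fun y hy => hnum y hy (hPle y hy)
    have hzp : OnPath E w z z := ⟨hwz, le_rfl, hT.lt_end z (by omega) (by omega)⟩
    have hround := Round.enter hB hR hcur (z := z) (w := w) (l := l) hLc hw2 (by omega) hw0 hPw0 hwz
      hzw hS (fun y => by rw [hvis y]; exact or_congr_right ⟨fun h => h.1, fun h => ⟨h, hPle y h⟩⟩) hold
      (fun y hy => by have := hnum' y hy; have := hdle z y hzp hy hy.2.1; omega)
      (fun y y' hy hy' hle => by
        have := hnum' y hy; have := hnum' y' hy'; have := hdle y y' hy hy' hle; omega)
      (fun y hy => by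
        have := hgrow.1 y
        rwa [Function.update_of_ne hy] at this)
      (by have := hgrow.1 cur; rwa [Function.update_self] at this)
      (fun v h1 h2 h3 => hcov v h1 h2 (by omega) h3)
    have hroots' : rootsReserve N P E (Finset.Icc 2 N) (σ'.a .num) =
        rootsReserve N P E s (σ'.a .num) := by
      unfold rootsReserve
      rw [← Finset.add_sum_erase _ _ hwmem, if_neg, zero_add]
      rintro ⟨h1, -⟩
      exact (hvis w).2 (.inr ⟨⟨le_rfl, hwz, hzw⟩, hPwlt⟩) h1
    simp [hw']
    refine hQ _ _ L' (hF.setv (by decide) _) ?_ ?_ ?_ ?_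
    · simpa [hF.a .fin (by decide)] using hround
    · simpa using hL'
    · simpa using hk'
    · simp
      rw [hroots']
      have hA : (2 : ℤ) * unit N * (N + 1 - (σ'.v .t : ℤ)) = 2 * unit N * (N + 1 - t : ℤ) -
          2 * unit N * (dep z + 1 - dep w : ℕ) := by
        have : (σ'.v .t : ℤ) = t + (dep z + 1 - dep w : ℕ) := by omega
        rw [this]; ring
      rw [hA]
      rw [hZ] at hb
      omega


/-! ### The search -/

/-- A loop rule for invariants that bound the credits from below. -/
theorem WP_while {env : Env} {o : Cmp} {x y : Ex} {c : Stmt} (I : Store → ℤ → Prop) (X : ℤ)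
    (hX : ∀ σ a, I σ a → X ≤ a)
    (hI : ∀ σ a, I σ a → ∀ Q' : Store → ℤ → Prop, (∀ σ' b, I σ' b → Q' σ' b) →
      x.Ok env σ ∧ y.Ok env σ ∧ (o.Holds (x.eval σ) (y.eval σ) → WP env c σ (a - 1) Q'))
    {σ : Store} {a : ℤ} {Q : Store → ℤ → Prop} (h : I σ a)
    (hQ : ∀ σ' b, I σ' b → ¬ o.Holds (x.eval σ') (y.eval σ') → Q σ' (b - 1)) :
    WP env (.loop o x y c) σ a Q := by
  -- The credits serve as the termination measure: every test costs one, and they never fall below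
  -- `X`.
  refine WP_loop (fun k σ a => I σ a ∧ k = (a - X).toNat) ?_ (a - X).toNat ⟨h, rfl⟩
    fun k σ' b h => hQ σ' b h.1
  rintro k σ a ⟨h, rfl⟩ Q' hQ'
  obtain ⟨h1, h2, h3⟩ := hI σ a h I fun _ _ h => h
  refine ⟨h1, h2, fun hh => ?_⟩
  have := h3 hh
  unfold WP at this ⊢
  obtain ⟨t, σ', hr, hi⟩ := this
  refine ⟨t, σ', hr, hQ' _ _ _ ?_ ⟨hi, rfl⟩⟩
  have := hX _ _ hi
  omega

/-- The depth is the number of intervals that contain a vertex; those of `j` are those of its parent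
and its own. Depths occur only in the analysis and are not computed. -/
theorem NumTree.exists_depth {N : ℕ} {P E : ℕ → ℕ} (hT : NumTree N P E) :
    ∃ dep : ℕ → ℕ, ∀ j, 2 ≤ j → j ≤ N → dep j = dep (P j) + 1 := by
  refine ⟨fun j => ((Finset.Icc 1 N).filter fun i => i ≤ j ∧ j < E i).card, fun j hj hjN => ?_⟩
  have h1 := hT.lt j hj hjN
  have : (Finset.Icc 1 N).filter (fun i => i ≤ j ∧ j < E i) =
      insert j ((Finset.Icc 1 N).filter fun i => i ≤ P j ∧ P j < E i) := by
    ext i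
    simp only [Finset.mem_filter, Finset.mem_insert, Finset.mem_Icc]
    constructor
    · rintro ⟨hi, hij, hjE⟩
      rcases hij.eq_or_lt with rfl | hlt
      · exact .inl rfl
      · exact .inr ⟨hi, (hT.mem i j hi.1 hi.2 hj hjN).1 ⟨hlt, hjE⟩⟩
    · rintro (rfl | ⟨hi, hij⟩)
      · exact ⟨by omega, le_rfl, hT.lt_end i (by omega) hjN⟩
      · have := (hT.mem i j hi.1 hi.2 hj hjN).2 hij
        exact ⟨hi, by omega, this.2⟩
  simp only [this]
  rw [Finset.card_insert_of_notMem]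
  simp only [Finset.mem_filter]
  omega

/-- One step of the search: the next listed edge is explored, or the current vertex is left. -/
def stepCode : Stmt :=
  .set .p (.get .head ‡.cur) ;;
  .ite .ne ‡.p 0
    (.put .head ‡.cur (.get .next ‡.p) ;; .set .z (.get .dst ‡.p) ;;
      .ite .eq (.get .num ‡.z) 0 enterCode .skip)
    (.put .fin ‡.cur ‡.t ;; .set .cur (.get .Q ‡.cur))

/-- The search, after its initialization. -/
def searchCode : Stmt := .loop .ne ‡.cur 0 stepCode

/-- The variables that are changed by `searchCode`. -/
abbrev searchVars : List Var := .p :: .z :: enterVars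

/-- The arrays that are changed by `searchCode`. -/
abbrev searchArrs : List Arr := .fin :: enterArrs

/-- The number of vertices that have not been left. -/
def unfinished (N : ℕ) (fin : ℕ → ℕ) : ℕ := ((Finset.Icc 1 N).filter fun x => fin x = 0).card

theorem unfinished_leave {N : ℕ} {fin : ℕ → ℕ} {x t : ℕ} (h1 : 1 ≤ x) (hN : x ≤ N) (h0 : fin x = 0)
    (ht : t ≠ 0) : unfinished N (Function.update fin x t) + 1 = unfinished N fin := by
  unfold unfinished
  have hmem : x ∈ (Finset.Icc 1 N).filter fun x => fin x = 0 := by simp [h1, hN, h0]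
  rw [← Finset.card_erase_add_one hmem]
  congr 2
  ext y
  simp only [Finset.mem_filter, Finset.mem_erase]
  by_cases hy : y = x
  · subst hy; simp [ht]
  · simp [hy]

/-- The results of a complete search: the numbers of the vertices in preorder, the ends of the
intervals of descendants, and the parents. -/
structure Finished (N : ℕ) (H : ℕ → ℕ → Prop) (num fin Q : ℕ → ℕ) : Prop where
  rng : ∀ x, 1 ≤ x → x ≤ N → 1 ≤ num x ∧ num x ≤ N
  inj : ∀ x y, 1 ≤ x → x ≤ N → 1 ≤ y → y ≤ N → num x = num y → x = y
  num_one : num 1 = 1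
  Q_one : Q 1 = 0
  fin_rng : ∀ x, 1 ≤ x → x ≤ N → num x < fin x ∧ fin x ≤ N + 1
  par : ∀ x, 2 ≤ x → x ≤ N → 1 ≤ Q x ∧ Q x ≤ N ∧ num (Q x) < num x ∧ H (Q x) x
  mem : ∀ x j, 1 ≤ x → x ≤ N → 2 ≤ j → j ≤ N →
    ((num x < num j ∧ num j < fin x) ↔ (num x ≤ num (Q j) ∧ num (Q j) < fin x))
  back : ∀ a b, 1 ≤ a → a ≤ N → H a b → num a < num b → num b < fin a
  clean : ∀ x, x = 0 ∨ N < x → num x = 0 ∧ fin x = 0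

/-- An empty stack means that all visited vertices have been left, the root among them. As the root
is adjacent to every vertex, `front` shows that no vertex is unvisited. -/
theorem Search.finished {N : ℕ} {R U : ℕ → ℕ → Prop} {num fin Q : ℕ → ℕ} {t : ℕ}
    {L : ℕ → List ℕ} (h : Search N (Edge N R U) U num fin Q t 0 L) :
    Finished N (Edge N R U) num fin Q := by
  have hfin : ∀ x, num x ≠ 0 → fin x ≠ 0 := fun x hx hf => (h.stk_le x hx hf).1 rfl
  have h1 : num 1 ≠ 0 := by rw [h.num_one]; omega
  have hvis : ∀ x, 1 ≤ x → x ≤ N → num x ≠ 0 := by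
    intro x hx1 hxN hx
    have hx2 : x ≠ 1 := by rintro rfl; exact h1 hx
    exact hfin 1 h1 (h.front x 1 hx h1 (.inr (.inr (.inr ⟨rfl, by omega, hxN⟩))))
  have ht := h.t_le
  have hend : ∀ x, 1 ≤ x → x ≤ N → curEnd fin t x = fin x := by
    intro x hx1 hxN
    simp [curEnd, hfin x (hvis x hx1 hxN)]
  constructor
  · intro x hx1 hxN
    have := hvis x hx1 hxN
    have := h.lt x
    omega
  · intro x y hx1 hxN _ _ hxy
    exact h.inj x y (hvis x hx1 hxN) hxy
  · exact h.num_one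
  · exact h.Q_one
  · intro x hx1 hxN
    have := h.fin_rng x (hfin x (hvis x hx1 hxN))
    omega
  · intro x hx1 hxN
    have h2 := h.par x (hvis x (by omega) hxN) (by omega)
    have h3 := h.rng _ h2.1
    exact ⟨h3.1, h3.2, h2.2⟩
  · intro x j hx1 hxN hj hjN
    have := h.mem x j (hvis x hx1 hxN) (hvis j (by omega) hjN) (by omega)
    rwa [hend x hx1 hxN] at this
  · intro a b ha haN hab hlt
    have := h.back a b hab (hvis a ha haN) hlt
    rwa [hend a ha haN] at this
  · intro x hx
    have h2 : num x = 0 := by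
      by_contra hne
      have := h.rng x hne
      omega
    refine ⟨h2, ?_⟩
    by_contra hne
    exact (h.fin_rng x hne).1 h2

/-- The potential consists of the reserves of the maximal unvisited subtrees, two units per
unvisited vertex, 12 per listed edge and 12 per vertex not yet left. The bound on `k` says that each
newly visited vertex causes at most `N + 1` new list cells, which keeps them inside the array. -/
theorem searchCode_spec {env : Env} {N g : ℕ} (hfit : env.Fits N) {P E : ℕ → ℕ}
    {R U : ℕ → ℕ → Prop} (hB : DFSBase N P E R U) {σ : Store} (h : HasTree N g P E R σ)
    {L : ℕ → List ℕ} (hR : Round N P (Edge N R U) U (σ.a .num) (σ.a .fin) (σ.a .Q) (σ.v .t)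
      (σ.v .cur) L)
    (hL : Lists (σ.a .head) (σ.a .next) (σ.a .dst) (N + 1) (σ.v .k) L)
    {kb : ℕ} (hk : σ.v .k ≤ kb + σ.v .t * (N + 1)) (hkb : kb + (N + 2) * (N + 1) ≤ env.M)
    {a X : ℤ} (ha : X + rootsReserve N P E (Finset.Icc 2 N) (σ.a .num) +
      2 * unit N * (N + 1 - σ.v .t : ℤ) + 12 * total N L + 12 * unfinished N (σ.a .fin) + 1 ≤ a)
    {Q : Store → ℤ → Prop}
    (hQ : ∀ σ' b, Frame searchVars searchArrs σ σ' →
      Finished N (Edge N R U) (σ'.a .num) (σ'.a .fin) (σ'.a .Q) → X ≤ b → Q σ' b) :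
    WP env searchCode σ a Q := by
  obtain ⟨hM2, hM, hM0⟩ := hfit.bounds
  obtain ⟨dep, hdep⟩ := hB.tree.exists_depth
  refine WP_while (fun σ' b => Frame searchVars searchArrs σ σ' ∧ ∃ L,
    Round N P (Edge N R U) U (σ'.a .num) (σ'.a .fin) (σ'.a .Q) (σ'.v .t) (σ'.v .cur) L ∧
    Lists (σ'.a .head) (σ'.a .next) (σ'.a .dst) (N + 1) (σ'.v .k) L ∧
    σ'.v .k ≤ kb + σ'.v .t * (N + 1) ∧
    X + rootsReserve N P E (Finset.Icc 2 N) (σ'.a .num) + 2 * unit N * (N + 1 - σ'.v .t : ℤ) +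
      12 * total N L + 12 * unfinished N (σ'.a .fin) + 1 ≤ b) X ?_ ?_
    ⟨Frame.refl _ _ σ, L, hR, hL, hk, ha⟩ ?_
  · rintro σ' b ⟨-, L, hR, -, -, hb⟩
    have h1 : (σ'.v .t : ℤ) ≤ N + 1 := by exact_mod_cast hR.t_le
    have h2 : (0 : ℤ) ≤ 2 * unit N * (N + 1 - σ'.v .t : ℤ) := by
      apply mul_nonneg
      · positivity
      · omega
    omega
  · rintro σ' b ⟨hF, L, hR, hL, hk, hb⟩ Q' hQ'
    have hH' := h.frame hF
    have ht1N := hR.t_le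
    have ht1N' : σ'.v .t * (N + 1) ≤ (N + 1) * (N + 1) := Nat.mul_le_mul_right _ ht1N
    have hkb2 : (N + 2) * (N + 1) = (N + 1) * (N + 1) + (N + 1) := by ring
    have ht0 : σ'.v .t ≠ 0 := by have := hR.card; omega
    generalize hcu : σ'.v .cur = cur at hR ⊢
    simp only [stepCode, WP_seq, WP_set, WP_ite, WP_put, WP_skip]
    simp [hcu, Env.len]
    intro hc0
    have hcs := hR.cur_stk hc0
    have hcr := hR.rng cur hcs.1
    refine ⟨by omega, ?_, ?_⟩
    · intro hp0
      obtain ⟨l, hLc, hpk, hpop⟩ := hL.pop (y := cur) (by omega) hp0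
      have htot := total_pop (N := N) L (y := cur) (by omega) hLc
      generalize hz : σ'.a .dst (σ'.a .head cur) = z at *
      have hzr := hB.edge_rng (hB.edge_symm (hR.snd cur z (by rw [hLc]; simp)))
      repeat refine ⟨by omega, ?_⟩
      constructor
      · intro hz0
        refine enterCode_spec hfit hB hdep (g := g) (L := L) (l := l) (kb := kb)
          (X := X + 12 * unfinished N (σ'.a .fin) + 1)
          (σ := ((σ'.setv .p (σ'.a .head cur)).seta .head cur (σ'.a .next (σ'.a .head cur))).setv .z z)
          (hH'.congr rfl rfl rfl rfl rfl rfl) ?_ ?_ ?_ ?_ ?_ ?_ hkb ?_ ?_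
        · simpa [hcu] using hR
        · simpa [hcu] using hc0
        · simpa [hcu] using hLc
        · simpa using hz0
        · simpa [hcu] using hpop
        · simpa using hk
        · simp [hcu]; omega
        · intro σ₂ b₂ L₂ hF₂ hR₂ hL₂ hk₂ hb₂
          have f1 := hF₂.a .fin (by decide)
          simp at f1
          refine hQ' _ _ ⟨((((hF.setv (by decide) _).seta (by decide) _ _).setv (by decide) _).trans
            hF₂ (by decide) (by decide)), L₂, hR₂, hL₂, hk₂, ?_⟩
          rw [f1]; omega
      · intro hz0
        refine hQ' _ _ ⟨((hF.setv (by decide) _).seta (by decide) _ _).setv (by decide) _,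
          Function.update L cur l, ?_, ?_, ?_, ?_⟩
        · simpa [hcu] using hR.drop hc0 hLc hz0
        · simpa using hpop
        · simpa using hk
        · simp; omega
    · intro hp0
      have hnil := hL.eq_nil (y := cur) (by omega) hp0
      have hunf := unfinished_leave hcr.1 hcr.2 hcs.2 ht0
      repeat refine ⟨by omega, ?_⟩
      refine hQ' _ _ ⟨((hF.setv (by decide) _).seta (by decide) _ _).setv (by decide) _, L, ?_, ?_,
        ?_, ?_⟩
      · simpa using hR.leave hc0 hnil
      · simpa using hL
      · simpa using hk
      · simp; omega
  · rintro σ' b ⟨hF, L, hR, hL, hk, hb⟩ hn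
    simp at hn
    rw [hn] at hR
    have h1 : (σ'.v .t : ℤ) ≤ N + 1 := by exact_mod_cast hR.t_le
    have h2 : (0 : ℤ) ≤ 2 * unit N * (N + 1 - σ'.v .t : ℤ) := by
      apply mul_nonneg
      · positivity
      · omega
    exact hQ _ _ hF hR.toSearch.finished (by omega)


/-! ### The log of the edges, and the initialization of the search -/

/-- The edges number `a, …, b - 1` of the log. -/
def logAdj (lg : ℕ → ℕ) (a b u v : ℕ) : Prop :=
  ∃ k, a ≤ k ∧ k < b ∧ ((lg (2 * k) = u ∧ lg (2 * k + 1) = v) ∨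
    (lg (2 * k) = v ∧ lg (2 * k + 1) = u))

theorem logAdj.symm {lg : ℕ → ℕ} {a b u v : ℕ} (h : logAdj lg a b u v) : logAdj lg a b v u := by
  obtain ⟨k, h1, h2, h3⟩ := h
  exact ⟨k, h1, h2, h3.symm⟩

theorem logAdj_self {lg : ℕ → ℕ} {a u v : ℕ} : ¬ logAdj lg a a u v := by
  rintro ⟨k, h1, h2, -⟩
  omega

theorem logAdj_succ {lg : ℕ → ℕ} {a b u v : ℕ} (h : a ≤ b) :
    logAdj lg a (b + 1) u v ↔ logAdj lg a b u v ∨ (lg (2 * b) = u ∧ lg (2 * b + 1) = v) ∨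
      (lg (2 * b) = v ∧ lg (2 * b + 1) = u) := by
  constructor
  · rintro ⟨k, h1, h2, h3⟩
    rcases (show k ≤ b by omega).eq_or_lt with rfl | hlt
    · exact .inr h3
    · exact .inl ⟨k, h1, hlt, h3⟩
  · rintro (⟨k, h1, h2, h3⟩ | h3)
    · exact ⟨k, h1, by omega, h3⟩
    · exact ⟨b, h, by omega, h3⟩

theorem logAdj_split {lg : ℕ → ℕ} {a b c u v : ℕ} (hab : a ≤ b) (hbc : b ≤ c) :
    logAdj lg a c u v ↔ logAdj lg a b u v ∨ logAdj lg b c u v := by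
  constructor
  · rintro ⟨k, h1, h2, h3⟩
    by_cases hk : k < b
    · exact .inl ⟨k, h1, hk, h3⟩
    · exact .inr ⟨k, by omega, h2, h3⟩
  · rintro (⟨k, h1, h2, h3⟩ | ⟨k, h1, h2, h3⟩)
    · exact ⟨k, h1, by omega, h3⟩
    · exact ⟨k, by omega, h2, h3⟩

theorem logAdj_congr {lg lg' : ℕ → ℕ} {a b u v : ℕ} (h : ∀ k < 2 * b, lg' k = lg k) :
    logAdj lg' a b u v ↔ logAdj lg a b u v := by
  unfold logAdj
  refine exists_congr fun k => and_congr_right fun _ => and_congr_right fun hk => ?_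
  rw [h (2 * k) (by omega), h (2 * k + 1) (by omega)]

/-- Prepares the search. -/
def initCode : Stmt :=
  .set .i 0 ;;
  .loop .le ‡.i ‡.N
    (.put .num ‡.i 0 ;; .put .fin ‡.i 0 ;; .put .head ‡.i 0 ;; .set .i (‡.i + 1)) ;;
  .set .k 1 ;; .set .i 2 ;;
  .loop .le ‡.i ‡.N (pushCode 1 ‡.i ;; .set .i (‡.i + 1)) ;;
  .set .i ‡.s0 ;;
  .loop .lt ‡.i ‡.e
    (.set .u (.buf .ord (.get .raw (2 * ‡.i))) ;; .set .v (.buf .ord (.get .raw (2 * ‡.i + 1))) ;;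
    pushCode ‡.u ‡.v ;; pushCode ‡.v ‡.u ;; .set .i (‡.i + 1)) ;;
  .put .num 1 1 ;; .put .Q 1 0 ;; .set .t 2 ;; .set .cur 1

/-- The variables that are changed by `initCode`. -/
abbrev initVars : List Var := [.i, .k, .u, .v, .t, .cur]

/-- The arrays that are changed by `initCode`. -/
abbrev initArrs : List Arr := [.num, .fin, .head, .next, .dst, .Q]

theorem total_nil (N : ℕ) : total N (fun _ => []) = 0 := by simp [total]

theorem mem_push {L : ℕ → List ℕ} {y z y' z' : ℕ} :
    z' ∈ Function.update L y (z :: L y) y' ↔ z' ∈ L y' ∨ (y' = y ∧ z' = z) := by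
  by_cases h : y' = y
  · subst h; simp; tauto
  · simp [h]

/-- The expression `y` is evaluated again after entries of arrays have changed, so its value is
required to depend on the variables only. -/
theorem pushCode_spec {env : Env} {σ : Store} {y z : Ex} {y₀ z₀ N : ℕ}
    (hy : ∀ σ' : Store, σ'.v = σ.v → y.Ok env σ' ∧ y.eval σ' = y₀) (hz : z.Ok env σ)
    (hz₀ : z.eval σ = z₀) (hM : y₀ < env.M) (hk : σ.v .k < env.M) (h1 : 1 ≤ env.M)
    {L : ℕ → List ℕ} (hL : Lists (σ.a .head) (σ.a .next) (σ.a .dst) N (σ.v .k) L)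
    {a : ℤ} {Q : Store → ℤ → Prop}
    (hQ : ∀ σ', Frame [.k] [.head, .next, .dst] σ σ' →
      Lists (σ'.a .head) (σ'.a .next) (σ'.a .dst) N (σ'.v .k) (Function.update L y₀ (z₀ :: L y₀)) →
      σ'.v .k = σ.v .k + 1 → Q σ' (a - 4)) : WP env (pushCode y z) σ a Q := by
  have hlen : ∀ f, f ≠ Arr.raw → env.len f = env.M := fun f hf => len_of_ne_raw env hf
  have e1 := hy (σ.seta .dst (σ.v .k) z₀) rfl
  have e2 := hy ((σ.seta .dst (σ.v .k) z₀).seta .next (σ.v .k) (σ.a .head y₀)) rfl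
  simp only [pushCode, WP_seq, WP_set, WP_put]
  simp only [ok_var, eval_var, ok_get, ok_add, ok_lit, hz, hz₀, true_and, Store.seta_v, eval_get,
    eval_add, eval_lit, e1, e2, Store.seta_a, hlen _ (by decide : Arr.head ≠ .raw),
    hlen _ (by decide : Arr.next ≠ .raw), hlen _ (by decide : Arr.dst ≠ .raw), reduceCtorEq, ↓reduceIte]
  refine ⟨hk, hM, hk, hM, ⟨h1, by omega⟩, ?_⟩
  rw [show a - 1 - 1 - 1 - 1 = a - 4 by ring]
  refine hQ _ (((((Frame.refl _ _ σ).seta (by decide) _ _).seta (by decide) _ _).seta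
    (by decide) _ _).setv (by decide) _) ?_ (by simp)
  simpa using hL.push y₀ z₀

/-- All vertices are listed at the root, and every edge of the log from number `s0` on is listed at
both ends, in terms of the numbers of the base tree. Old edges are not listed here; the queries
supply them. -/
theorem initCode_spec {env : Env} {N g : ℕ} (hfit : env.Fits N) {σ : Store} (hN : σ.v .N = N)
    (hg : σ.v .g = g) (hg1 : g ≤ 1) (hse : σ.v .s0 ≤ σ.v .e) (he : 2 * σ.v .e ≤ env.B)
    (hclean : ∀ x, N < x → σ.a .num x = 0 ∧ σ.a .fin x = 0)
    (hlog : ∀ k < 2 * σ.v .e, σ.a .raw k < N)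
    (hord : ∀ v < N, σ.a .ord (2 * v + g) ≤ N)
    {a : ℤ} {Q : Store → ℤ → Prop}
    (hQ : ∀ σ' b L, Frame initVars initArrs σ σ' →
      (∀ x, σ'.a .num x = if x = 1 then 1 else 0) → (∀ x, σ'.a .fin x = 0) → σ'.a .Q 1 = 0 →
      σ'.v .t = 2 → σ'.v .cur = 1 →
      Lists (σ'.a .head) (σ'.a .next) (σ'.a .dst) (N + 1) (σ'.v .k) L →
      σ'.v .k = N + 2 * (σ.v .e - σ.v .s0) →
      (∀ y z, z ∈ L y ↔ (y = 1 ∧ 2 ≤ z ∧ z ≤ N) ∨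
        logAdj (fun k => σ.a .ord (2 * σ.a .raw k + g)) (σ.v .s0) (σ.v .e) y z) →
      total N L + 1 = N + 2 * (σ.v .e - σ.v .s0) →
      a - 11 * N - 12 * (σ.v .e - σ.v .s0 : ℕ) - 20 ≤ b → Q σ' b) : WP env initCode σ a Q := by
  obtain ⟨hM2, hM, hM0⟩ := hfit.bounds
  have h3 := hfit.three_le
  have hBN := hfit.B_eq
  have hNN : (N + 1) * (N + 1) = N * N + 2 * N + 1 := by ring
  generalize hs : σ.v .s0 = s0 at *
  generalize hee : σ.v .e = e at *
  simp only [initCode, WP_seq, WP_set, WP_put]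
  simp
  refine WP_while (fun σ' b => Frame initVars initArrs σ σ' ∧ σ'.v .i ≤ N + 1 ∧
    (∀ x, x < σ'.v .i ∨ N < x → σ'.a .num x = 0 ∧ σ'.a .fin x = 0) ∧
    (∀ x < σ'.v .i, σ'.a .head x = 0) ∧ a - 1 - 5 * σ'.v .i ≤ b) (a - 1 - 5 * (N + 1)) ?_ ?_ ?_ ?_
  · rintro σ' b ⟨-, h1, -, -, h2⟩
    omega
  · rintro σ' b ⟨hF, h1, h2, h4, h5⟩ Q' hQ'
    have e1 := hF.v .N (by decide)
    simp only [WP_seq, WP_set, WP_put]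
    simp [e1, hN, Env.len]
    intro hlt
    repeat refine ⟨by omega, ?_⟩
    refine hQ' _ _ ⟨(((hF.seta (by decide) _ _).seta (by decide) _ _).seta (by decide) _ _).setv
      (by decide) _, ?_, ?_, ?_, ?_⟩
    · simp; omega
    · simp
      intro x hx
      by_cases hxi : x = σ'.v .i
      · simp [hxi]
      · simp [hxi]; exact h2 x (by omega)
    · simp
      intro x hx
      by_cases hxi : x = σ'.v .i
      · simp [hxi]
      · simp [hxi]; exact h4 x (by omega)
    · simp; omega
  · refine ⟨(Frame.refl _ _ σ).setv (by decide) _, ?_, ?_, ?_, ?_⟩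
    · simp
    · simpa using hclean
    · simp
    · simp
  rintro σ₁ b₁ ⟨hF₁, h1, h2, h4, h5⟩ hn
  have e1 := hF₁.v .N (by decide)
  simp [e1, hN] at hn
  repeat refine ⟨by omega, ?_⟩
  refine WP_while (fun σ' b => Frame initVars initArrs σ σ' ∧ 2 ≤ σ'.v .i ∧ σ'.v .i ≤ N + 1 ∧
    (∀ x, σ'.a .num x = 0 ∧ σ'.a .fin x = 0) ∧ σ'.v .k + 1 = σ'.v .i ∧
    (∃ L, Lists (σ'.a .head) (σ'.a .next) (σ'.a .dst) (N + 1) (σ'.v .k) L ∧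
      (∀ y z, z ∈ L y ↔ (y = 1 ∧ 2 ≤ z ∧ z < σ'.v .i)) ∧ total N L + 2 = σ'.v .i) ∧
    b₁ - 3 - 6 * (σ'.v .i - 2 : ℤ) ≤ b) (b₁ - 3 - 6 * (N + 1)) ?_ ?_ ?_ ?_
  · rintro σ' b ⟨-, -, h1, -, -, -, h2⟩
    omega
  · rintro σ' b ⟨hF, hi2, h1, h2, hk, ⟨L, hL, hL1, hL2⟩, h5⟩ Q' hQ'
    have e1 := hF.v .N (by decide)
    simp only [WP_seq, WP_set, WP_put]
    simp [e1, hN]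
    intro hlt
    refine pushCode_spec (N := N + 1) (y₀ := 1) (z₀ := σ'.v .i)
      (fun _ _ => ⟨by simp; omega, by simp⟩) (by simp) (by simp) (by omega) (by omega) (by omega) hL ?_
    intro σ'' hF' hL' hk'
    have f1 := hF'.v .i (by decide)
    have hFF := hF.trans hF' (by decide) (by decide)
    simp [f1]
    repeat refine ⟨by omega, ?_⟩
    refine hQ' _ _ ⟨hFF.setv (by decide) _, ?_, ?_, ?_, ?_, ⟨_, hL', ?_, ?_⟩, ?_⟩
    · simp; omega
    · simp; omega
    · simpa [hF'.a .num (by decide), hF'.a .fin (by decide)] using h2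
    · simp; omega
    · intro y z
      rw [mem_push, hL1]
      simp; omega
    · rw [total_push L (by omega)]; simp; omega
    · simp; omega
  · refine ⟨(hF₁.setv (by decide) _).setv (by decide) _, ?_, ?_, ?_, ?_,
      ⟨fun _ => [], ⟨?_, ?_⟩, ?_, ?_⟩, ?_⟩
    · simp
    · simp; omega
    · intro x
      simpa using h2 x (by omega)
    · simp
    · simp
    · intro y hy
      simp [h4 y (by omega)]
      exact .nil
    · simp; omega
    · simp [total_nil]
    · simp; omega
  rintro σ₂ b₂ ⟨hF₂, -, h12, h22, hk2, ⟨L, hL, hL1, hL2⟩, h52⟩ hn2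
  have e2 := hF₂.v .N (by decide)
  simp [e2, hN] at hn2
  have hi2 : σ₂.v .i = N + 1 := by omega
  rw [hi2] at hk2 hL1 hL2 h52
  refine WP_while (fun σ' b => Frame initVars initArrs σ σ' ∧ s0 ≤ σ'.v .i ∧ σ'.v .i ≤ e ∧
    (∀ x, σ'.a .num x = 0 ∧ σ'.a .fin x = 0) ∧ σ'.v .k + 2 * s0 = N + 2 * σ'.v .i ∧
    (∃ L, Lists (σ'.a .head) (σ'.a .next) (σ'.a .dst) (N + 1) (σ'.v .k) L ∧
      (∀ y z, z ∈ L y ↔ (y = 1 ∧ 2 ≤ z ∧ z ≤ N) ∨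
        logAdj (fun k => σ.a .ord (2 * σ.a .raw k + g)) s0 (σ'.v .i) y z) ∧
      total N L + 1 + 2 * s0 = N + 2 * σ'.v .i) ∧
    b₂ - 2 - 12 * (σ'.v .i - s0 : ℤ) ≤ b) (b₂ - 2 - 12 * (e - s0 : ℤ)) ?_ ?_ ?_ ?_
  · rintro σ' b ⟨-, -, h1, -, -, -, h2⟩
    omega
  · rintro σ' b ⟨hF, hi2, h1, h2, hk, ⟨L, hL, hL1, hL2⟩, h5⟩ Q' hQ'
    have e1 := hF.v .N (by decide)
    have e3 := hF.v .e (by decide)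
    have e4 := hF.v .g (by decide)
    have e5 := hF.a .raw (by decide)
    have e6 := hF.a .ord (by decide)
    generalize hi : σ'.v .i = i at *
    simp only [WP_seq, WP_set, WP_put, Ex.buf]
    simp [e1, e3, e4, e5, e6, hN, hee, hg, hi, Env.len]
    intro hlt
    have hr1 := hlog (2 * i) (by omega)
    have hr2 := hlog (2 * i + 1) (by omega)
    have ho1 := hord _ hr1
    have ho2 := hord _ hr2
    repeat refine ⟨by omega, ?_⟩
    generalize hu : σ.a .ord (2 * σ.a .raw (2 * i) + g) = u at *
    generalize hv : σ.a .ord (2 * σ.a .raw (2 * i + 1) + g) = v at *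
    refine pushCode_spec (N := N + 1) (y₀ := u) (z₀ := v) (L := L)
      (fun τ hτ => ⟨by simp, by simp [hτ]⟩) (by simp) (by simp) (by omega) (by simp; omega)
      (by omega) (by simpa using hL) ?_
    intro σ₃ hF₃ hL₃ hk₃
    have f1 := hF₃.v .u (by decide)
    have f2 := hF₃.v .v (by decide)
    simp at f1 f2 hk₃
    refine pushCode_spec (N := N + 1) (y₀ := v) (z₀ := u)
      (fun τ hτ => ⟨by simp, by simp [hτ, f2]⟩) (by simp) (by simp [f1]) (by omega) (by omega)
      (by omega) hL₃ ?_
    intro σ₄ hF₄ hL₄ hk₄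
    have g1 := hF₄.v .i (by decide)
    have g2 := hF₃.v .i (by decide)
    simp [hi] at g2
    rw [g2] at g1
    have hFF := (((hF.setv (x := .u) (by decide) u).setv (x := .v) (by decide) v).trans hF₃
      (by decide) (by decide)).trans hF₄ (by decide) (by decide)
    simp [g1]
    repeat refine ⟨by omega, ?_⟩
    refine hQ' _ _ ⟨hFF.setv (by decide) _, ?_, ?_, ?_, ?_, ⟨_, hL₄, ?_, ?_⟩, ?_⟩
    · simp; omega
    · simp; omega
    · simpa [hF₄.a .num (by decide), hF₄.a .fin (by decide), hF₃.a .num (by decide),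
        hF₃.a .fin (by decide)] using h2
    · simp; omega
    · intro y z
      rw [mem_push, mem_push, hL1]
      simp only [Store.setv_v, if_true]
      rw [logAdj_succ hi2]
      simp only [hu, hv, eq_comm, and_comm, or_assoc]
    · rw [total_push _ (by omega), total_push L (by omega)]; simp; omega
    · simp; omega
  · refine ⟨hF₂.setv (by decide) _, ?_, ?_, ?_, ?_, ⟨L, ?_, ?_, ?_⟩, ?_⟩
    · simp [hF₂.v .s0 (by decide), hs]
    · simp [hF₂.v .s0 (by decide), hs]; omega
    · simpa using h22
    · simp [hF₂.v .s0 (by decide), hs]; omega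
    · simpa using hL
    · intro y z
      rw [hL1]
      simp [hF₂.v .s0 (by decide), hs, logAdj_self]
    · simp [hF₂.v .s0 (by decide), hs]; omega
    · simp [hF₂.v .s0 (by decide), hs]
  rintro σ₃ b₃ ⟨hF₃, h13, h14, h23, hk3, ⟨L, hL, hL1, hL2⟩, h53⟩ hn3
  have e3 := hF₃.v .e (by decide)
  simp [e3, hee] at hn3
  have hi3 : σ₃.v .i = e := by omega
  rw [hi3] at hk3 hL1 hL2 h53
  simp only [Env.len]
  repeat refine ⟨by omega, ?_⟩
  refine hQ _ _ L ((((hF₃.seta (by decide) _ _).seta (by decide) _ _).setv (by decide) _).setv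
    (by decide) _) ?_ ?_ ?_ ?_ ?_ ?_ ?_ hL1 ?_ ?_
  · intro x
    simp
    by_cases hx : x = 1
    · simp [hx]
    · simp [hx, h23]
  · intro x; simp [h23]
  · simp
  · simp
  · simp
  · simpa using hL
  · simp; omega
  · omega
  · omega


/-! ### Trees in the memory -/

/-- The part `b` of an array with two buffers. -/
def col (b : ℕ) (f : ℕ → ℕ) (i : ℕ) : ℕ := f (2 * i + b)

/-- The rows in the part `b` of a two-dimensional array with two buffers. -/
def rows (N b : ℕ) (f : ℕ → ℕ) (i k : ℕ) : ℕ := f (2 * (i * (N + 1) + k) + b)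

/-- The relation `A` of vertices as a relation of their numbers, where `vx` maps numbers to
vertices, without the root. -/
def Rel (N : ℕ) (vx : ℕ → ℕ) (A : ℕ → ℕ → Prop) (i j : ℕ) : Prop :=
  (2 ≤ i ∧ i ≤ N) ∧ (2 ≤ j ∧ j ≤ N) ∧ A (vx i) (vx j)

/-- A DFS tree of the graph `A` on `0, …, n - 1`, with the additional root `n`; `ord` numbers the
vertices in preorder, and `inv` is its inverse. -/
structure TreeIn (n : ℕ) (A : ℕ → ℕ → Prop) (ord inv P E : ℕ → ℕ) : Prop where
  ord_rng : ∀ v ≤ n, 1 ≤ ord v ∧ ord v ≤ n + 1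
  inv_ord : ∀ v ≤ n, inv (ord v) = v
  inv_le : ∀ i, 1 ≤ i → i ≤ n + 1 → inv i ≤ n
  ord_inv : ∀ i, 1 ≤ i → i ≤ n + 1 → ord (inv i) = i
  root : ord n = 1
  tree : NumTree (n + 1) P E
  par : ∀ j, 2 ≤ j → j ≤ n + 1 → P j = 1 ∨ Rel (n + 1) inv A (P j) j
  back : ∀ i j, Rel (n + 1) inv A i j → i < j → j < E i

/-- The lists of the neighbours with numbers below `T`. -/
structure Rows (n : ℕ) (A : ℕ → ℕ → Prop) (T : ℕ) (inv cnt : ℕ → ℕ) (D : ℕ → ℕ → ℕ) : Prop where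
  cnt_le : ∀ i, 2 ≤ i → i ≤ n + 1 → cnt i + 2 ≤ T
  mono : ∀ i, 2 ≤ i → i ≤ n + 1 → ∀ k l, k < l → l < cnt i → D i k < D i l
  mem : ∀ i, 2 ≤ i → i ≤ n + 1 → ∀ r, (Rel (n + 1) inv A i r ∧ r < T) ↔ ∃ k < cnt i, D i k = r

/-- The part `b` of the memory contains a DFS tree of `A`, and the lists of the neighbours with
numbers below `T`. -/
structure Tree (n b : ℕ) (A : ℕ → ℕ → Prop) (T : ℕ) (σ : Store) : Prop where
  tree : TreeIn n A (col b (σ.a .ord)) (col b (σ.a .inv)) (col b (σ.a .P)) (col b (σ.a .E))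
  rows : Rows n A T (col b (σ.a .inv)) (col b (σ.a .cnt)) (rows (n + 1) b (σ.a .D))

theorem Tree.congr {n b T : ℕ} {A A' : ℕ → ℕ → Prop} {σ σ' : Store} (h : Tree n b A T σ)
    (hA : ∀ u v, A' u v ↔ A u v)
    (h1 : col b (σ'.a .ord) = col b (σ.a .ord)) (h2 : col b (σ'.a .inv) = col b (σ.a .inv))
    (h3 : col b (σ'.a .P) = col b (σ.a .P)) (h4 : col b (σ'.a .E) = col b (σ.a .E))
    (h5 : col b (σ'.a .cnt) = col b (σ.a .cnt))
    (h6 : IncDFS.rows (n + 1) b (σ'.a .D) = IncDFS.rows (n + 1) b (σ.a .D)) :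
    Tree n b A' T σ' := by
  obtain rfl : A' = A := by funext u v; exact propext (hA u v)
  refine ⟨?_, ?_⟩
  · rw [h1, h2, h3, h4]; exact h.tree
  · rw [h2, h5, h6]; exact h.rows

theorem Tree.frame {n b T : ℕ} {A : ℕ → ℕ → Prop} {σ σ' : Store} (h : Tree n b A T σ)
    {vs : List Var} {fs : List Arr} (hF : Frame vs fs σ σ')
    (hf : Arr.ord ∉ fs ∧ Arr.inv ∉ fs ∧ Arr.P ∉ fs ∧ Arr.E ∉ fs ∧ Arr.cnt ∉ fs ∧ Arr.D ∉ fs :=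
      by decide) : Tree n b A T σ' :=
  h.congr (fun _ _ => Iff.rfl) (by rw [hF.a _ hf.1]) (by rw [hF.a _ hf.2.1])
    (by rw [hF.a _ hf.2.2.1]) (by rw [hF.a _ hf.2.2.2.1]) (by rw [hF.a _ hf.2.2.2.2.1])
    (by rw [hF.a _ hf.2.2.2.2.2])

theorem TreeIn.ord_ge {n : ℕ} {A : ℕ → ℕ → Prop} {ord inv P E : ℕ → ℕ}
    (h : TreeIn n A ord inv P E) {v : ℕ} (hv : v < n) : 2 ≤ ord v ∧ ord v ≤ n + 1 := by
  have h1 := h.ord_rng v hv.le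
  refine ⟨?_, h1.2⟩
  by_contra hlt
  have h2 := h.inv_ord v hv.le
  rw [show ord v = 1 by omega, ← h.root, h.inv_ord n le_rfl] at h2
  omega

theorem TreeIn.inv_lt {n : ℕ} {A : ℕ → ℕ → Prop} {ord inv P E : ℕ → ℕ}
    (h : TreeIn n A ord inv P E) {i : ℕ} (hi : 2 ≤ i) (hin : i ≤ n + 1) : inv i < n := by
  have h1 := h.inv_le i (by omega) hin
  by_contra hlt
  have h2 := h.ord_inv i (by omega) hin
  rw [show inv i = n by omega, h.root] at h2
  omega

theorem TreeIn.inv_one {n : ℕ} {A : ℕ → ℕ → Prop} {ord inv P E : ℕ → ℕ}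
    (h : TreeIn n A ord inv P E) : inv 1 = n := by
  rw [← h.root, h.inv_ord n le_rfl]

/-- Edges of the log in terms of the numbers. -/
theorem TreeIn.logAdj_iff {n : ℕ} {A : ℕ → ℕ → Prop} {ord inv P E : ℕ → ℕ}
    (h : TreeIn n A ord inv P E) {lg : ℕ → ℕ} {a b : ℕ} (hlog : ∀ k < 2 * b, lg k < n) (i j : ℕ) :
    logAdj (fun k => ord (lg k)) a b i j ↔ Rel (n + 1) inv (logAdj lg a b) i j := by
  constructor
  · rintro ⟨k, h1, h2, h3⟩
    have l1 := hlog (2 * k) (by omega)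
    have l2 := hlog (2 * k + 1) (by omega)
    have o1 := h.ord_ge l1
    have o2 := h.ord_ge l2
    have i1 := h.inv_ord _ l1.le
    have i2 := h.inv_ord _ l2.le
    rcases h3 with ⟨rfl, rfl⟩ | ⟨rfl, rfl⟩
    · exact ⟨o1, o2, k, h1, h2, .inl ⟨i1.symm, i2.symm⟩⟩
    · exact ⟨o2, o1, k, h1, h2, .inr ⟨i1.symm, i2.symm⟩⟩
  · rintro ⟨⟨hi, hin⟩, ⟨hj, hjn⟩, k, h1, h2, h3⟩
    have o1 := h.ord_inv i (by omega) hin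
    have o2 := h.ord_inv j (by omega) hjn
    refine ⟨k, h1, h2, ?_⟩
    rcases h3 with ⟨e1, e2⟩ | ⟨e1, e2⟩ <;> simp [e1, e2, o1, o2]

theorem Tree.hasTree {n b : ℕ} {A : ℕ → ℕ → Prop} {σ : Store} (h : Tree n b A (n + 2) σ)
    (hN : σ.v .N = n + 1) (hg : σ.v .g = b) (hb : b ≤ 1) :
    HasTree (n + 1) b (col b (σ.a .P)) (col b (σ.a .E)) (Rel (n + 1) (col b (σ.a .inv)) A) σ := by
  refine ⟨hN, hg, hb, fun _ _ _ => rfl, fun _ _ _ => rfl, fun i h1 h2 => ?_, h.rows.mono,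
    fun i h1 h2 r => ?_⟩
  · have := h.rows.cnt_le i h1 h2
    unfold col at this
    omega
  · have := h.rows.mem i h1 h2 r
    unfold col IncDFS.rows at *
    rw [← this]
    constructor
    · exact fun h => ⟨h, by have := h.2.1.2; omega⟩
    · exact fun h => h.1

theorem TreeIn.base {n : ℕ} {A A' : ℕ → ℕ → Prop} {ord inv P E : ℕ → ℕ}
    (h : TreeIn n A ord inv P E) (hA : ∀ u v, A u v → A v u) (hA' : ∀ u v, A' u v → A' v u) :
    DFSBase (n + 1) P E (Rel (n + 1) inv A) (Rel (n + 1) inv A') where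
  tree := h.tree
  one_le := by omega
  R_symm := fun _ _ h => ⟨h.2.1, h.1, hA _ _ h.2.2⟩
  R_rng := fun _ _ h => h.1
  R_back := h.back
  par := h.par
  U_symm := fun _ _ h => ⟨h.2.1, h.1, hA' _ _ h.2.2⟩
  U_rng := fun _ _ h => h.1

/-- Computes a DFS tree from the tree in the memory and the last edges of the log. -/
def coreCode : Stmt := initCode ;; searchCode

/-- The variables that are changed by `coreCode`. -/
abbrev coreVars : List Var := initVars ++ searchVars

/-- The arrays that are changed by `coreCode`. -/
abbrev coreArrs : List Arr := initArrs ++ searchArrs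

/-- The credits reserved for the base tree. -/
def treeReserve (N : ℕ) (P E : ℕ → ℕ) : ℕ :=
  ∑ c ∈ Finset.Icc 2 N, if P c = 1 then reserve N (E c - c) else 0

/-- With only the root visited, the maximal unvisited subtrees are those of the children of the
root, whence `treeReserve`. A recent edge costs 12 for its two insertions, and 12 more for exploring
each of its two entries, which gives 36. -/
theorem coreCode_spec {env : Env} {n g : ℕ} (hfit : env.Fits (n + 1)) {σ : Store}
    {s0 e : ℕ} (hT : Tree n g (logAdj (σ.a .raw) 0 s0) (n + 2) σ)
    (hN : σ.v .N = n + 1) (hg : σ.v .g = g) (hg1 : g ≤ 1) (hs : σ.v .s0 = s0) (he : σ.v .e = e)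
    (hse : s0 ≤ e) (hen : 2 * e ≤ n * n)
    (hclean : ∀ x, n + 1 < x → σ.a .num x = 0 ∧ σ.a .fin x = 0)
    (hlog : ∀ k < 2 * e, σ.a .raw k < n) {a : ℤ} {Q : Store → ℤ → Prop}
    (hQ : ∀ σ' b, Frame coreVars coreArrs σ σ' →
      Finished (n + 1) (Edge (n + 1) (Rel (n + 1) (col g (σ.a .inv)) (logAdj (σ.a .raw) 0 s0))
        (Rel (n + 1) (col g (σ.a .inv)) (logAdj (σ.a .raw) s0 e))) (σ'.a .num) (σ'.a .fin)
        (σ'.a .Q) →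
      a - treeReserve (n + 1) (col g (σ.a .P)) (col g (σ.a .E)) - 3 * unit (n + 1) * (n + 1) -
        36 * (e - s0 : ℕ) ≤ b → Q σ' b) : WP env coreCode σ a Q := by
  obtain ⟨hM2, hM, hM0⟩ := hfit.bounds
  have h3 := hfit.three_le
  have hBN := hfit.B_eq
  have hNN : (n + 1) * (n + 1) = n * n + 2 * n + 1 := by ring
  have hNN' : (n + 1 + 1) * (n + 1 + 1) = n * n + 4 * n + 4 := by ring
  simp only [coreCode, WP_seq]
  refine initCode_spec hfit hN hg hg1 (by omega) (by omega) hclean ?_ ?_ ?_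
  · intro k hk
    have := hlog k (by omega)
    omega
  · intro v hv
    exact (hT.tree.ord_rng v (by omega)).2
  rintro σ₁ b₁ L hF h1 h2 hq ht hc hL hk hmem htot hb
  rw [hs, he] at hk hmem htot hb
  have hmem' : ∀ y z, z ∈ L y ↔ (y = 1 ∧ 2 ≤ z ∧ z ≤ n + 1) ∨
      Rel (n + 1) (col g (σ.a .inv)) (logAdj (σ.a .raw) s0 e) y z := by
    intro y z
    rw [hmem, ← hT.tree.logAdj_iff hlog]
    rfl
  have hB := hT.tree.base (A' := logAdj (σ.a .raw) s0 e) (fun _ _ => logAdj.symm)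
    fun _ _ => logAdj.symm
  have hR := Round.init hB h1 h2 hq (L := L)
    (by
      intro y z hz
      rcases (hmem' y z).1 hz with h | h
      · exact .inr (.inr (.inl h))
      · exact .inr (.inl h))
    (fun y z h => (hmem' y z).2 (.inr h))
    (fun z h h' => (hmem' 1 z).2 (.inl ⟨rfl, h, h'⟩))
  have hres : rootsReserve (n + 1) (col g (σ.a .P)) (col g (σ.a .E)) (Finset.Icc 2 (n + 1))
      (σ₁.a .num) = treeReserve (n + 1) (col g (σ.a .P)) (col g (σ.a .E)) := by
    unfold rootsReserve treeReserve
    refine Finset.sum_congr rfl fun c hc => ?_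
    simp only [Finset.mem_Icc] at hc
    rw [h1, h1]
    simp
    congr 1
    simp
    omega
  have hunf : unfinished (n + 1) (σ₁.a .fin) ≤ n + 1 := by
    unfold unfinished
    exact (Finset.card_filter_le _ _).trans (by simp)
  refine searchCode_spec hfit hB ((hT.hasTree hN hg hg1).frame hF) (L := L) ?_ hL
    (kb := n + 1 + 2 * (e - s0)) (by omega) ?_ (X := b₁ - 1 - treeReserve (n + 1) (col g (σ.a .P))
      (col g (σ.a .E)) - 2 * unit (n + 1) * n - 12 * total (n + 1) L - 12 * (n + 1)) ?_ ?_
  · rw [ht, hc]; exact hR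
  · have : (n + 1 + 2) * (n + 1 + 1) = n * n + 5 * n + 6 := by ring
    omega
  · rw [hres, ht]
    push_cast
    rw [show (n : ℤ) + 1 + 1 - 2 = n by ring]
    omega
  · intro σ₂ b₂ hF₂ hfin hb₂
    refine hQ _ _ ((Frame.trans (Frame.trans (Frame.refl _ _ σ) hF (by decide) (by decide)) hF₂
      (by decide) (by decide))) hfin ?_
    have hu := unit_ge h3
    have h4 : (3 : ℤ) * unit (n + 1) * (n + 1) = 2 * unit (n + 1) * n + unit (n + 1) * n +
      3 * unit (n + 1) := by ring
    have h5 : (60 : ℤ) * n ≤ unit (n + 1) * n := by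
      have : (60 : ℤ) ≤ unit (n + 1) := by exact_mod_cast hu
      exact mul_le_mul_of_nonneg_right this (by positivity)
    omega

/-! ### The report -/

/-- A DFS tree of the graph `A` on `0, …, n - 1`, with the additional root `n`, in terms of preorder
numbers of the vertices, of the numbers of the parents, of the ends of the intervals of
descendants, and of the parents. -/
structure VTree (n : ℕ) (A : ℕ → ℕ → Prop) (tnum tpar tfin pr : ℕ → ℕ) : Prop where
  rng : ∀ v ≤ n, 1 ≤ tnum v ∧ tnum v ≤ n + 1
  inj : ∀ u v, u ≤ n → v ≤ n → tnum u = tnum v → u = v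
  root : tnum n = 1
  root_fin : tfin n = n + 2
  fin_rng : ∀ v ≤ n, tnum v < tfin v ∧ tfin v ≤ n + 2
  par : ∀ v < n, pr v ≤ n ∧ tnum (pr v) = tpar v ∧ tpar v < tnum v ∧ (pr v = n ∨ A (pr v) v)
  mem : ∀ u v, u ≤ n → v < n →
    ((tnum u < tnum v ∧ tnum v < tfin u) ↔ (tnum u ≤ tpar v ∧ tpar v < tfin u))
  back : ∀ u v, u < n → v < n → A u v → tnum u < tnum v → tnum v < tfin u

theorem surjective_of_injective {n : ℕ} {f : ℕ → ℕ} (hr : ∀ v ≤ n, 1 ≤ f v ∧ f v ≤ n + 1)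
    (hi : ∀ u v, u ≤ n → v ≤ n → f u = f v → u = v) {j : ℕ} (h1 : 1 ≤ j) (hj : j ≤ n + 1) :
    ∃ v ≤ n, f v = j := by
  have := Finset.surj_on_of_inj_on_of_card_le (s := Finset.range (n + 1))
    (t := Finset.Icc 1 (n + 1)) (fun v _ => f v)
    (fun v hv => by
      have := hr v (by simpa [Nat.lt_succ_iff] using hv)
      simpa using this)
    (fun u v hu hv h => hi u v (by simpa [Nat.lt_succ_iff] using hu)
      (by simpa [Nat.lt_succ_iff] using hv) h)
    (by simp) j (by simp; omega)
  obtain ⟨v, hv, rfl⟩ := this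
  exact ⟨v, by simpa [Nat.lt_succ_iff] using hv, rfl⟩

/-- Stores the result of the search in terms of the vertices. -/
def outputCode : Stmt :=
  .set .i 1 ;;
  .loop .le ‡.i ‡.N
    (.set .v (.buf .inv ‡.i) ;; .set .q (.get .Q ‡.i) ;;
    .put .tnum ‡.v (.get .num ‡.i) ;; .put .tfin ‡.v (.get .fin ‡.i) ;;
    .put .tpar ‡.v (.get .num ‡.q) ;; .put .raw (‡.out + ‡.v) (.buf .inv ‡.q) ;;
    .set .i (‡.i + 1))

/-- The variables that are changed by `outputCode`. -/
abbrev outputVars : List Var := [.i, .v, .q]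

/-- The arrays that are changed by `outputCode`. -/
abbrev outputArrs : List Arr := [.tnum, .tfin, .tpar, .raw]

/-- The result is translated from base numbers back to vertices. The parents are written into `raw`
from `n * n` on; the log occupies cells below `n * n`, so it is not disturbed. -/
theorem outputCode_spec {env : Env} {n g : ℕ} (hfit : env.Fits (n + 1)) {σ : Store}
    {A A₀ A₁ : ℕ → ℕ → Prop} (hT : TreeIn n A₀ (col g (σ.a .ord)) (col g (σ.a .inv))
      (col g (σ.a .P)) (col g (σ.a .E))) (hA : ∀ u v, A u v ↔ A₀ u v ∨ A₁ u v)
    (hN : σ.v .N = n + 1) (hg : σ.v .g = g) (hg1 : g ≤ 1) (hout : σ.v .out = n * n)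
    (hfin : Finished (n + 1) (Edge (n + 1) (Rel (n + 1) (col g (σ.a .inv)) A₀)
        (Rel (n + 1) (col g (σ.a .inv)) A₁)) (σ.a .num) (σ.a .fin) (σ.a .Q))
    {a : ℤ} {Q : Store → ℤ → Prop}
    (hQ : ∀ σ' b, Frame outputVars outputArrs σ σ' →
      VTree n A (σ'.a .tnum) (σ'.a .tpar) (σ'.a .tfin) (fun v => σ'.a .raw (n * n + v)) →
      (∀ k < n * n, σ'.a .raw k = σ.a .raw k) → a - 8 * (n + 1) - 2 ≤ b → Q σ' b) :
    WP env outputCode σ a Q := by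
  obtain ⟨hM2, hM, hM0⟩ := hfit.bounds
  have h3 := hfit.three_le
  have hBN := hfit.B_eq
  have hNN : (n + 1) * (n + 1) = n * n + 2 * n + 1 := by ring
  have hNN' : (n + 1 + 1) * (n + 1 + 1) = n * n + 4 * n + 4 := by ring
  generalize hvx : col g (σ.a .inv) = vx at *
  simp only [outputCode, WP_seq, WP_set, WP_put, Ex.buf]
  simp
  refine ⟨by omega, ?_⟩
  have hQle : ∀ i, 1 ≤ i → i ≤ n + 1 → σ.a .Q i ≤ n + 1 := by
    intro i h1 h2
    rcases h1.eq_or_lt with rfl | h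
    · rw [hfin.Q_one]; omega
    · exact (hfin.par i h h2).2.1
  refine WP_while (fun σ' b => Frame outputVars outputArrs σ σ' ∧ 1 ≤ σ'.v .i ∧
    σ'.v .i ≤ n + 2 ∧ (∀ j, 1 ≤ j → j < σ'.v .i → σ'.a .tnum (vx j) = σ.a .num j ∧
      σ'.a .tfin (vx j) = σ.a .fin j ∧ σ'.a .tpar (vx j) = σ.a .num (σ.a .Q j) ∧
      σ'.a .raw (n * n + vx j) = vx (σ.a .Q j)) ∧ (∀ k < n * n, σ'.a .raw k = σ.a .raw k) ∧
      a - 1 - 8 * (σ'.v .i - 1 : ℤ) ≤ b) (a - 1 - 8 * (n + 1)) ?_ ?_ ?_ ?_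
  · rintro σ' b ⟨-, -, h1, -, -, h2⟩
    omega
  · rintro σ' b ⟨hF, hi1, hi2, htab, hraw, hb⟩ Q' hQ'
    have e1 := hF.v .N (by decide)
    have e2 := hF.v .g (by decide)
    have e3 := hF.v .out (by decide)
    have e4 := hF.a .inv (by decide)
    have e5 := hF.a .num (by decide)
    have e6 := hF.a .fin (by decide)
    have e7 := hF.a .Q (by decide)
    have hv : ∀ j, σ.a .inv (2 * j + g) = vx j := fun j => by rw [← hvx]; rfl
    generalize hi : σ'.v .i = i at *
    simp only [WP_seq, WP_set, WP_put]
    simp [e1, e2, e3, e4, e5, e6, e7, hN, hg, hout, hi, hv, Env.len]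
    intro hlt
    have hvle := hT.inv_le i (by omega) (by omega)
    have hql := hQle i (by omega) (by omega)
    repeat refine ⟨by omega, ?_⟩
    refine hQ' _ _ ⟨((((((hF.setv (by decide) _).setv (by decide) _).seta (by decide) _ _).seta
      (by decide) _ _).seta (by decide) _ _).seta (by decide) _ _).setv (by decide) _,
      ?_, ?_, ?_, ?_, ?_⟩
    · simp
    · simp; omega
    · simp
      intro j h1 h2
      by_cases hji : j = i
      · subst hji
        simp
      · have hne : vx j ≠ vx i := by
          intro h
          have o1 := hT.ord_inv j (by omega) (by omega)
          have o2 := hT.ord_inv i (by omega) (by omega)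
          rw [h] at o1
          omega
        simp [hne]
        exact htab j h1 (by omega)
    · simp
      intro k hk
      rw [Function.update_of_ne (by omega)]
      exact hraw k hk
    · simp; omega
  · refine ⟨(Frame.refl _ _ σ).setv (by decide) _, ?_, ?_, ?_, ?_, ?_⟩
    · simp
    · simp
    · simp; omega
    · simp
    · simp
  rintro σ₁ b₁ ⟨hF, hi1, hi2, htab, hraw, hb⟩ hn
  have e1 := hF.v .N (by decide)
  simp [e1, hN] at hn
  have hi : σ₁.v .i = n + 2 := by omega
  rw [hi] at htab hb
  refine hQ _ _ hF ?_ hraw (by omega)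
  -- the entries at the vertices
  have htab' : ∀ v ≤ n, ∃ j, 1 ≤ j ∧ j ≤ n + 1 ∧ vx j = v ∧ (v < n → 2 ≤ j) ∧
      σ₁.a .tnum v = σ.a .num j ∧
      σ₁.a .tfin v = σ.a .fin j ∧ σ₁.a .tpar v = σ.a .num (σ.a .Q j) ∧
      σ₁.a .raw (n * n + v) = vx (σ.a .Q j) := by
    intro v hv
    have h1 := hT.ord_rng v hv
    have h2 := hT.inv_ord v hv
    have h3 := htab _ h1.1 (by omega)
    rw [h2] at h3
    exact ⟨_, h1.1, h1.2, h2, fun h => (hT.ord_ge h).1, h3⟩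
  have hvinj : ∀ i j, 1 ≤ i → i ≤ n + 1 → 1 ≤ j → j ≤ n + 1 → vx i = vx j → i = j := by
    intro i j h1 h2 h3 h4 h
    rw [← hT.ord_inv i h1 h2, h, hT.ord_inv j h3 h4]
  have hone := htab 1 le_rfl (by omega)
  rw [hT.inv_one] at hone
  constructor
  · intro v hv
    obtain ⟨j, h1, h2, rfl, h3, h4, -⟩ := htab' v hv
    rw [h4]; exact hfin.rng j h1 h2
  · intro u v hu hv huv
    obtain ⟨i, h1, h2, rfl, h3, h4, -⟩ := htab' u hu
    obtain ⟨j, h1', h2', rfl, h3', h4', -⟩ := htab' v hv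
    rw [h4, h4'] at huv
    rw [hfin.inj i j h1 h2 h1' h2' huv]
  · rw [hone.1, hfin.num_one]
  · rw [hone.2.1]
    have hle := hfin.fin_rng 1 le_rfl (by omega)
    -- The vertex with the last number `n + 1` is a neighbour of the root, so by `back` the interval
    -- of the root reaches beyond it and must end at `n + 2`.
    obtain ⟨j, hj, hjn⟩ := surjective_of_injective (n := n) (f := fun x => σ.a .num (x + 1))
      (fun v hv => hfin.rng _ (by omega) (by omega))
      (fun u v hu hv h => by
        have := hfin.inj _ _ (by omega) (by omega) (by omega) (by omega) h
        omega) (j := n + 1) (by omega) le_rfl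
    have hj0 : j ≠ 0 := by
      rintro rfl
      simp [hfin.num_one] at hjn
      omega
    have := hfin.back 1 (j + 1) le_rfl (by omega) (.inr (.inr (.inl ⟨rfl, by omega, by omega⟩)))
      (by rw [hfin.num_one, hjn]; omega)
    omega
  · intro v hv
    obtain ⟨j, h1, h2, rfl, h3, h4, h5, -⟩ := htab' v hv
    rw [h4, h5]; exact hfin.fin_rng j h1 h2
  · intro v hv
    obtain ⟨j, h1, h2, rfl, h3, h4, h5, h6, h7⟩ := htab' v hv.le
    obtain ⟨q1, q2, q3, q4⟩ := hfin.par j (h3 hv) h2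
    have hq := htab _ q1 (by omega)
    refine ⟨?_, ?_, ?_, ?_⟩
    · simp only [h7]; exact hT.inv_le _ q1 q2
    · simp only [h7]; rw [hq.1, h6]
    · rw [h6, h4]; exact q3
    · simp only [h7]
      rw [hA]
      rcases q4 with h | h | h | h
      · exact .inr (.inl h.2.2)
      · exact .inr (.inr h.2.2)
      · rw [h.1]; exact .inl hT.inv_one
      · have := h3 hv; omega
  · intro u v hu hv
    obtain ⟨i, h1, h2, rfl, h3, h4, h5, -⟩ := htab' u hu
    obtain ⟨j, h1', h2', rfl, h3', h4', h5', h6', -⟩ := htab' v hv.le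
    rw [h4, h4', h5, h6']
    exact hfin.mem i j h1 h2 (h3' hv) h2'
  · intro u v hu hv huv
    obtain ⟨i, h1, h2, rfl, h3, h4, h5, -⟩ := htab' u hu.le
    obtain ⟨j, h1', h2', rfl, h3', h4', -⟩ := htab' v hv.le
    rw [h4, h4', h5]
    refine hfin.back i j h1 h2 ?_
    rcases (hA _ _).1 huv with h | h
    · exact .inl ⟨⟨h3 hu, h2⟩, ⟨h3' hv, h2'⟩, h⟩
    · exact .inr (.inl ⟨⟨h3 hu, h2⟩, ⟨h3' hv, h2'⟩, h⟩)


/-! ### Construction of the next base tree -/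

theorem col_update (b : ℕ) (f : ℕ → ℕ) (i x : ℕ) :
    col b (Function.update f (2 * i + b) x) = Function.update (col b f) i x := by
  funext j
  unfold col
  by_cases h : j = i
  · subst h; simp
  · rw [Function.update_of_ne h, Function.update_of_ne (by omega)]

theorem col_update_ne {b g : ℕ} (hb : b ≤ 1) (hg : g ≤ 1) (h : g ≠ b) (f : ℕ → ℕ) (i x : ℕ) :
    col g (Function.update f (2 * i + b) x) = col g f := by
  funext j
  unfold col
  rw [Function.update_of_ne (by omega)]

theorem rows_update_ne {b g : ℕ} (hb : b ≤ 1) (hg : g ≤ 1) (h : g ≠ b) (N : ℕ) (f : ℕ → ℕ)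
    (i x : ℕ) : rows N g (Function.update f (2 * i + b) x) = rows N g f := by
  funext j k
  unfold rows
  rw [Function.update_of_ne (by omega)]

theorem rows_update {N b : ℕ} (f : ℕ → ℕ) {i j k c : ℕ} (hk : k ≤ N) (hc : c ≤ N) (x : ℕ) :
    rows N b (Function.update f (2 * (j * (N + 1) + c) + b) x) i k =
      if i = j ∧ k = c then x else rows N b f i k := by
  unfold rows
  split_ifs with h
  · obtain ⟨rfl, rfl⟩ := h; simp
  · rw [Function.update_of_ne]
    intro he
    apply h
    have h1 : i * (N + 1) + k = j * (N + 1) + c := by omega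
    have h2 : (i * (N + 1) + k) / (N + 1) = i := by
      rw [mul_comm, Nat.mul_add_div (by omega), Nat.div_eq_of_lt (by omega), add_zero]
    have h3 : (j * (N + 1) + c) / (N + 1) = j := by
      rw [mul_comm, Nat.mul_add_div (by omega), Nat.div_eq_of_lt (by omega), add_zero]
    have h4 : i = j := by rw [← h2, h1, h3]
    subst h4
    omega

/-- Entry of the part of an array with two buffers that is not in use. -/
def Ex.oth (f : Arr) (i : Ex) : Ex := .get f (2 * i + (1 - ‡.g))

/-- Stores the reported tree as a base tree, without the lists of neighbours. -/
def snapCode : Stmt :=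
  .set .v 0 ;;
  .loop .le ‡.v ‡.n
    (.set .j (.get .tnum ‡.v) ;; .put .ord (2 * ‡.v + (1 - ‡.g)) ‡.j ;;
    .put .inv (2 * ‡.j + (1 - ‡.g)) ‡.v ;; .put .P (2 * ‡.j + (1 - ‡.g)) (.get .tpar ‡.v) ;;
    .put .E (2 * ‡.j + (1 - ‡.g)) (.get .tfin ‡.v) ;; .put .cnt (2 * ‡.j + (1 - ‡.g)) 0 ;;
    .put .snap ‡.v (.get .ahead ‡.v) ;; .set .v (‡.v + 1)) ;;
  .set .s1 ‡.e ;; .set .T 2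

/-- The variables that are changed by `snapCode`. -/
abbrev snapVars : List Var := [.v, .j, .s1, .T]

/-- The arrays that are changed by `snapCode`. -/
abbrev snapArrs : List Arr := [.ord, .inv, .P, .E, .cnt, .snap]

theorem VTree.num_ge {n : ℕ} {A : ℕ → ℕ → Prop} {tnum tpar tfin pr : ℕ → ℕ}
    (h : VTree n A tnum tpar tfin pr) {v : ℕ} (hv : v < n) : 2 ≤ tnum v := by
  have h1 := h.rng v hv.le
  by_contra hlt
  have := h.inj v n hv.le le_rfl (by rw [h.root]; omega)
  omega

/-- The map `tnum` is a bijection onto `1, …, n + 1`, so each number can be written as `tnum v` and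
all properties are transported. -/
theorem VTree.treeIn {n : ℕ} {A : ℕ → ℕ → Prop} {tnum tpar tfin pr ord inv P E : ℕ → ℕ}
    (h : VTree n A tnum tpar tfin pr) (ho : ∀ v ≤ n, ord v = tnum v)
    (hi : ∀ v ≤ n, inv (tnum v) = v) (hP : ∀ v ≤ n, P (tnum v) = tpar v)
    (hE : ∀ v ≤ n, E (tnum v) = tfin v) : TreeIn n A ord inv P E := by
  have hs : ∀ i, 1 ≤ i → i ≤ n + 1 → ∃ v ≤ n, tnum v = i := fun i h1 h2 =>
    surjective_of_injective h.rng h.inj h1 h2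
  have hs2 : ∀ i, 2 ≤ i → i ≤ n + 1 → ∃ v < n, tnum v = i := by
    intro i h1 h2
    obtain ⟨v, hv, rfl⟩ := hs i (by omega) h2
    refine ⟨v, lt_of_le_of_ne hv ?_, rfl⟩
    rintro rfl
    rw [h.root] at h1; omega
  constructor
  · intro v hv
    rw [ho v hv]; exact h.rng v hv
  · intro v hv
    rw [ho v hv, hi v hv]
  · intro i h1 h2
    obtain ⟨v, hv, rfl⟩ := hs i h1 h2
    rwa [hi v hv]
  · intro i h1 h2
    obtain ⟨v, hv, rfl⟩ := hs i h1 h2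
    rw [hi v hv, ho v hv]
  · rw [ho n le_rfl, h.root]
  · constructor
    · intro j h1 h2
      obtain ⟨v, hv, rfl⟩ := hs2 j h1 h2
      obtain ⟨p1, p2, -⟩ := h.par v hv
      rw [hP v hv.le, ← p2]
      exact (h.rng _ p1).1
    · intro j h1 h2
      obtain ⟨v, hv, rfl⟩ := hs2 j h1 h2
      rw [hP v hv.le]
      exact (h.par v hv).2.2.1
    · intro i h1 h2
      obtain ⟨v, hv, rfl⟩ := hs i h1 h2
      rw [hE v hv]; exact (h.fin_rng v hv).1
    · intro i h1 h2
      obtain ⟨v, hv, rfl⟩ := hs i h1 h2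
      rw [hE v hv]; exact (h.fin_rng v hv).2
    · have := hE n le_rfl
      rwa [h.root, h.root_fin] at this
    · intro i j h1 h2 h3 h4
      obtain ⟨u, hu, rfl⟩ := hs i h1 h2
      obtain ⟨v, hv, rfl⟩ := hs2 j h3 h4
      rw [hE u hu, hP v hv.le]
      exact h.mem u v hu hv
  · intro j h1 h2
    obtain ⟨v, hv, rfl⟩ := hs2 j h1 h2
    obtain ⟨p1, p2, p3, p4⟩ := h.par v hv
    rw [hP v hv.le, ← p2]
    rcases p4 with p4 | p4
    · rw [p4]; exact .inl h.root
    · by_cases hpn : pr v = n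
      · rw [hpn]; exact .inl h.root
      · refine .inr ⟨⟨h.num_ge (by omega), (h.rng _ p1).2⟩, ⟨h1, h2⟩, ?_⟩
        rwa [hi _ p1, hi v hv.le]
  · rintro i j ⟨⟨h1, h2⟩, ⟨h3, h4⟩, h5⟩ hij
    obtain ⟨u, hu, rfl⟩ := hs2 i h1 h2
    obtain ⟨v, hv, rfl⟩ := hs2 j h3 h4
    rw [hi u hu.le, hi v hv.le] at h5
    rw [hE u hu.le]
    exact h.back u v hu hv h5 hij

/-- Only the buffer `1 - g` is written, so the tree in use survives. Empty rows are correct for the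
bound 2 because the numbers of vertices other than the root start at 2. Copying the heads `ahead` to
`snap` freezes the adjacency lists. -/
theorem snapCode_spec {env : Env} {n g : ℕ} (hfit : env.Fits (n + 1)) {σ : Store}
    {A : ℕ → ℕ → Prop} {pr : ℕ → ℕ}
    (hV : VTree n A (σ.a .tnum) (σ.a .tpar) (σ.a .tfin) pr)
    (hn : σ.v .n = n) (hg : σ.v .g = g) (hg1 : g ≤ 1)
    {a : ℤ} {Q : Store → ℤ → Prop}
    (hQ : ∀ σ' b, Frame snapVars snapArrs σ σ' →
      (∀ A' T', Tree n g A' T' σ → Tree n g A' T' σ') → Tree n (1 - g) A 2 σ' →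
      (∀ v ≤ n, σ'.a .snap v = σ.a .ahead v) → σ'.v .s1 = σ.v .e → σ'.v .T = 2 →
      a - 9 * (n + 1) - 4 ≤ b → Q σ' b) :
    WP env snapCode σ a Q := by
  obtain ⟨hM2, hM, hM0⟩ := hfit.bounds
  have hb1 : 1 - g ≤ 1 := by omega
  have hgb : g ≠ 1 - g := by omega
  generalize hb : 1 - g = b at *
  simp only [snapCode, WP_seq, WP_set, WP_put]
  simp
  refine WP_while (fun σ' c => Frame snapVars snapArrs σ σ' ∧ σ'.v .v ≤ n + 1 ∧
    (∀ A' T', Tree n g A' T' σ → Tree n g A' T' σ') ∧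
    (∀ u < σ'.v .v, col b (σ'.a .ord) u = σ.a .tnum u ∧ col b (σ'.a .inv) (σ.a .tnum u) = u ∧
      col b (σ'.a .P) (σ.a .tnum u) = σ.a .tpar u ∧ col b (σ'.a .E) (σ.a .tnum u) = σ.a .tfin u ∧
      col b (σ'.a .cnt) (σ.a .tnum u) = 0 ∧ σ'.a .snap u = σ.a .ahead u) ∧
      a - 1 - 9 * (σ'.v .v : ℤ) ≤ c) (a - 1 - 9 * (n + 1)) ?_ ?_ ?_ ?_
  · rintro σ' c ⟨-, h1, -, -, h2⟩
    omega
  · rintro σ' c ⟨hF, hv1, hold, htab, hc⟩ Q' hQ'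
    have e1 := hF.v .n (by decide)
    have e2 := hF.v .g (by decide)
    have e3 := hF.a .tnum (by decide)
    have e4 := hF.a .tpar (by decide)
    have e5 := hF.a .tfin (by decide)
    have e6 := hF.a .ahead (by decide)
    generalize hv : σ'.v .v = v at *
    simp only [WP_seq, WP_set, WP_put]
    simp [e1, e2, e3, e4, e5, e6, hn, hg, hv, hb, Env.len]
    intro hlt
    have hr := hV.rng v hlt
    repeat refine ⟨by omega, ?_⟩
    refine hQ' _ _ ⟨(((((((hF.setv (by decide) _).seta (by decide) _ _).seta (by decide) _ _).seta
      (by decide) _ _).seta (by decide) _ _).seta (by decide) _ _).seta (by decide) _ _).setv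
      (by decide) _, ?_, ?_, ?_, ?_⟩
    · simp; omega
    · intro A' T' h
      refine (hold A' T' h).congr (fun _ _ => Iff.rfl) ?_ ?_ ?_ ?_ ?_ ?_ <;>
        simp [col_update_ne hb1 hg1 hgb]
    · simp [col_update]
      intro u hu
      by_cases huv : u = v
      · subst huv; simp
      · have hne : σ.a .tnum u ≠ σ.a .tnum v := fun h => huv (hV.inj u v (by omega) hlt h)
        simp [huv, hne]
        exact htab u (by omega)
    · simp; omega
  · refine ⟨(Frame.refl _ _ σ).setv (by decide) _, ?_, ?_, ?_, ?_⟩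
    · simp
    · intro A' T' h
      exact h.congr (fun _ _ => Iff.rfl) rfl rfl rfl rfl rfl rfl
    · simp
    · simp
  rintro σ₁ c₁ ⟨hF, hv1, hold, htab, hc⟩ hlt
  have e1 := hF.v .n (by decide)
  have e2 := hF.v .e (by decide)
  simp [e1, hn] at hlt
  have hv : σ₁.v .v = n + 1 := by omega
  rw [hv] at htab hc
  refine ⟨by omega, ?_⟩
  refine hQ _ _ ((hF.setv (by decide) _).setv (by decide) _) (fun A' T' h => ?_) ⟨?_, ?_⟩ ?_ ?_ ?_ ?_
  · exact (hold A' T' h).congr (fun _ _ => Iff.rfl) rfl rfl rfl rfl rfl rfl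
  · exact hV.treeIn (fun v h => (htab v (by omega)).1) (fun v h => (htab v (by omega)).2.1)
      (fun v h => (htab v (by omega)).2.2.1) (fun v h => (htab v (by omega)).2.2.2.1)
  · have hcnt : ∀ i, 2 ≤ i → i ≤ n + 1 → col b (σ₁.a .cnt) i = 0 := by
      intro i h1 h2
      obtain ⟨v, hv, rfl⟩ := surjective_of_injective hV.rng hV.inj (j := i) (by omega) h2
      exact (htab v (by omega)).2.2.2.2.1
    constructor
    · intro i h1 h2
      simp [hcnt i h1 h2]
    · intro i h1 h2
      simp [hcnt i h1 h2]
    · intro i h1 h2 r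
      simp [hcnt i h1 h2]
      intro h
      exact h.2.1.1
  · intro v h; simpa using (htab v (by omega)).2.2.2.2.2
  · simp [e2]
  · simp
  · omega

/-! ### Adjacency lists -/

/-- The lists `L` are the adjacency lists of the graph given by the first `e` edges of the log. -/
structure AdjLists (n : ℕ) (lg : ℕ → ℕ) (e : ℕ) (L : ℕ → List ℕ) : Prop where
  nodup : ∀ v < n, (L v).Nodup
  mem : ∀ v < n, ∀ z, z ∈ L v ↔ logAdj lg 0 e v z
  sum : ∑ v ∈ Finset.range n, (L v).length = 2 * e

/-- Inserts the edge between `r0` and `r1`. -/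
def addCode : Stmt :=
  .put .raw (2 * ‡.e) ‡.r0 ;; .put .raw (2 * ‡.e + 1) ‡.r1 ;;
  .put .ato (2 * ‡.e + 1) ‡.r1 ;; .put .anext (2 * ‡.e + 1) (.get .ahead ‡.r0) ;;
  .put .ahead ‡.r0 (2 * ‡.e + 1) ;;
  .put .ato (2 * ‡.e + 2) ‡.r0 ;; .put .anext (2 * ‡.e + 2) (.get .ahead ‡.r1) ;;
  .put .ahead ‡.r1 (2 * ‡.e + 2) ;; .set .e (‡.e + 1)

theorem Lists.extend {head nx dst nx' dst' : ℕ → ℕ} {m k k' : ℕ} {L : ℕ → List ℕ}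
    (h : Lists head nx dst m k L) (hk : k ≤ k') (hn : ∀ i < k, nx' i = nx i)
    (hd : ∀ i < k, dst' i = dst i) : Lists head nx' dst' m k' L :=
  ⟨by have := h.1; omega, fun y hy => (h.2 y hy).congr hk hn hd⟩

theorem sum_push {n : ℕ} (L : ℕ → List ℕ) {y : ℕ} (hy : y < n) (z : ℕ) :
    ∑ v ∈ Finset.range n, (Function.update L y (z :: L y) v).length =
      ∑ v ∈ Finset.range n, (L v).length + 1 := by
  obtain ⟨m, rfl⟩ : ∃ m, n = m + 1 := ⟨n - 1, by omega⟩
  exact total_push (N := m) L (by omega) z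

/-- The log after the insertion of an edge. -/
def logPush (lg : ℕ → ℕ) (e u v : ℕ) : ℕ → ℕ :=
  Function.update (Function.update lg (2 * e) u) (2 * e + 1) v

theorem logPush_of_lt {lg : ℕ → ℕ} {e u v k : ℕ} (h : k < 2 * e) : logPush lg e u v k = lg k := by
  unfold logPush
  rw [Function.update_of_ne (by omega), Function.update_of_ne (by omega)]

theorem logAdj_push {lg : ℕ → ℕ} {a e u v x y : ℕ} (ha : a ≤ e) :
    logAdj (logPush lg e u v) a (e + 1) x y ↔
      logAdj lg a e x y ∨ (u = x ∧ v = y) ∨ (u = y ∧ v = x) := by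
  have h1 : logPush lg e u v (2 * e) = u := by
    unfold logPush
    rw [Function.update_of_ne (by omega), Function.update_self]
  have h2 : logPush lg e u v (2 * e + 1) = v := by
    unfold logPush
    rw [Function.update_self]
  rw [logAdj_succ ha, h1, h2, logAdj_congr fun k hk => logPush_of_lt hk]

theorem AdjLists.push {n e : ℕ} {lg : ℕ → ℕ} {L : ℕ → List ℕ} (h : AdjLists n lg e L) {u v : ℕ}
    (hu : u < n) (hv : v < n) (huv : u ≠ v) (hnew : ¬ logAdj lg 0 e u v) :
    AdjLists n (logPush lg e u v) (e + 1)
      (Function.update (Function.update L u (v :: L u)) v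
        (u :: Function.update L u (v :: L u) v)) := by
  constructor
  · intro x hx
    by_cases hxv : x = v
    · subst hxv
      rw [Function.update_self, Function.update_of_ne huv.symm, List.nodup_cons]
      exact ⟨fun hm => hnew (((h.mem x hx u).1 hm).symm), h.nodup x hx⟩
    · rw [Function.update_of_ne hxv]
      by_cases hxu : x = u
      · subst hxu
        rw [Function.update_self, List.nodup_cons]
        exact ⟨fun hm => hnew ((h.mem x hx v).1 hm), h.nodup x hx⟩
      · rw [Function.update_of_ne hxu]; exact h.nodup x hx
  · intro x hx z
    rw [mem_push, mem_push, h.mem x hx, logAdj_push (Nat.zero_le _), or_assoc]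
    refine or_congr_right (or_congr ?_ ?_) <;> constructor <;> rintro ⟨rfl, rfl⟩ <;> exact ⟨rfl, rfl⟩
  · rw [sum_push _ hv, sum_push _ hu, h.sum]
    ring

/-- Edge number `e` owns the list cells `2 * e + 1` and `2 * e + 2`, so cell 0 remains free as the
end mark. Earlier cells are untouched, which keeps the snapshot valid. -/
theorem addCode_spec {env : Env} {n e u v : ℕ} (hfit : env.Fits (n + 1)) {σ : Store}
    (hu : σ.v .r0 = u) (hv : σ.v .r1 = v) (he : σ.v .e = e) (hun : u < n) (hvn : v < n)
    (hen : 2 * (e + 1) ≤ n * n) {L : ℕ → List ℕ}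
    (hL : Lists (σ.a .ahead) (σ.a .anext) (σ.a .ato) n (2 * e + 1) L)
    {a : ℤ} {Q : Store → ℤ → Prop}
    (hQ : ∀ σ', Frame [.e] [.raw, .ahead, .anext, .ato] σ σ' →
      σ'.a .raw = logPush (σ.a .raw) e u v → σ'.v .e = e + 1 →
      Lists (σ'.a .ahead) (σ'.a .anext) (σ'.a .ato) n (2 * (e + 1) + 1)
        (Function.update (Function.update L u (v :: L u)) v
          (u :: Function.update L u (v :: L u) v)) →
      (∀ i < 2 * e + 1, σ'.a .anext i = σ.a .anext i ∧ σ'.a .ato i = σ.a .ato i) →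
      Q σ' (a - 9)) :
    WP env addCode σ a Q := by
  obtain ⟨hM2, hM, hM0⟩ := hfit.bounds
  have hBN := hfit.B_eq
  have hNN : (n + 1) * (n + 1) = n * n + 2 * n + 1 := by ring
  have hNN' : (n + 1 + 1) * (n + 1 + 1) = n * n + 4 * n + 4 := by ring
  simp only [addCode, WP_seq, WP_set, WP_put]
  simp [hu, hv, he, Env.len]
  repeat refine ⟨by omega, ?_⟩
  rw [show a - 1 - 1 - 1 - 1 - 1 - 1 - 1 - 1 - 1 = a - 9 by ring]
  refine hQ _ ((((((((((Frame.refl _ _ σ).seta (by decide) _ _).seta (by decide) _ _).seta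
    (by decide) _ _).seta (by decide) _ _).seta (by decide) _ _).seta (by decide) _ _).seta
    (by decide) _ _).seta (by decide) _ _).setv (by decide) _) ?_ ?_ ?_ ?_
  · simp [logPush]
  · simp
  · have := (hL.push u v).push v u
    rw [show 2 * e + 1 + 1 = 2 * e + 2 by ring] at this
    simpa [mul_add] using this
  · intro i hi
    simp
    rw [Function.update_of_ne (by omega), Function.update_of_ne (by omega),
      Function.update_of_ne (by omega), Function.update_of_ne (by omega)]
    exact ⟨rfl, rfl⟩


/-! ### Construction of the lists of neighbours -/

/-- Appends the number `T` to the lists of all neighbours of the vertex with this number. -/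
def sliceCode : Stmt :=
  .set .v (.oth .inv ‡.T) ;; .set .p (.get .snap ‡.v) ;;
  .loop .ne ‡.p 0
    (.set .j (.oth .ord (.get .ato ‡.p)) ;;
    .put .D (2 * (‡.j * (‡.N + 1) + .oth .cnt ‡.j) + (1 - ‡.g)) ‡.T ;;
    .put .cnt (2 * ‡.j + (1 - ‡.g)) (.oth .cnt ‡.j + 1) ;;
    .set .p (.get .anext ‡.p)) ;;
  .set .T (‡.T + 1)

/-- The variables that are changed by `sliceCode`. -/
abbrev sliceVars : List Var := [.v, .p, .j, .T]

/-- The lists of neighbours while `T` is being appended; this has been done for the vertices in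
`done`. -/
structure PartialRows (n : ℕ) (A : ℕ → ℕ → Prop) (T : ℕ) (done : List ℕ) (inv cnt : ℕ → ℕ)
    (D : ℕ → ℕ → ℕ) : Prop where
  cnt_le : ∀ i, 2 ≤ i → i ≤ n + 1 → cnt i + 2 ≤ T + if inv i ∈ done then 1 else 0
  mono : ∀ i, 2 ≤ i → i ≤ n + 1 → ∀ k l, k < l → l < cnt i → D i k < D i l
  mem : ∀ i, 2 ≤ i → i ≤ n + 1 → ∀ r, ((Rel (n + 1) inv A i r ∧ r < T) ∨ (inv i ∈ done ∧ r = T)) ↔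
    ∃ k < cnt i, D i k = r

theorem Rows.start {n T : ℕ} {A : ℕ → ℕ → Prop} {inv cnt : ℕ → ℕ} {D : ℕ → ℕ → ℕ}
    (h : Rows n A T inv cnt D) : PartialRows n A T [] inv cnt D :=
  ⟨by simpa using h.cnt_le, h.mono, by simpa using h.mem⟩

theorem PartialRows.finish {n T : ℕ} {A : ℕ → ℕ → Prop} {inv cnt : ℕ → ℕ} {D : ℕ → ℕ → ℕ}
    {done : List ℕ} (h : PartialRows n A T done inv cnt D) (hT : 2 ≤ T ∧ T ≤ n + 1)
    (hd : ∀ v, v ∈ done ↔ A v (inv T)) : Rows n A (T + 1) inv cnt D := by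
  refine ⟨fun i h1 h2 => ?_, h.mono, fun i h1 h2 r => ?_⟩
  · have := h.cnt_le i h1 h2
    split_ifs at this <;> omega
  · rw [← h.mem i h1 h2, hd]
    constructor
    · rintro ⟨h3, h4⟩
      rcases (show r ≤ T by omega).eq_or_lt with rfl | hlt
      · exact .inr ⟨h3.2.2, rfl⟩
      · exact .inl ⟨h3, hlt⟩
    · rintro (⟨h3, h4⟩ | ⟨h3, rfl⟩)
      · exact ⟨h3, by omega⟩
      · exact ⟨⟨⟨h1, h2⟩, hT, h3⟩, by omega⟩

/-- A row that has not yet received `T` contains only numbers below `T`; appending `T` at its end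
keeps it increasing. This is why no sorting is needed. -/
theorem PartialRows.append {n T j : ℕ} {A : ℕ → ℕ → Prop} {inv cnt cnt' : ℕ → ℕ}
    {D D' : ℕ → ℕ → ℕ} {done : List ℕ} (h : PartialRows n A T done inv cnt D)
    (hT : T ≤ n + 1) (hj : 2 ≤ j) (hjn : j ≤ n + 1)
    (hinj : ∀ i, 2 ≤ i → i ≤ n + 1 → inv i = inv j → i = j) (hnew : inv j ∉ done)
    (hcnt : cnt' = Function.update cnt j (cnt j + 1))
    (hD : ∀ i k, k ≤ n + 1 → D' i k = if i = j ∧ k = cnt j then T else D i k) :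
    PartialRows n A T (inv j :: done) inv cnt' D' := by
  have hcl : ∀ i, 2 ≤ i → i ≤ n + 1 → cnt i ≤ n := by
    intro i h1 h2
    have := h.cnt_le i h1 h2
    split_ifs at this <;> omega
  have hD' : ∀ i, i ≠ j → ∀ k ≤ n + 1, D' i k = D i k := by
    intro i hi k hk
    rw [hD i k hk, if_neg (fun h => hi h.1)]
  have hDj : ∀ k < cnt j, D' j k = D j k := by
    intro k hk
    rw [hD j k (by have := hcl j hj hjn; omega), if_neg (by omega)]
  have hDT : D' j (cnt j) = T := by
    rw [hD j _ (by have := hcl j hj hjn; omega), if_pos ⟨rfl, rfl⟩]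
  have hother : ∀ i, 2 ≤ i → i ≤ n + 1 → i ≠ j →
      (inv i ∈ inv j :: done ↔ inv i ∈ done) ∧ cnt' i = cnt i := by
    intro i h1 h2 hij
    constructor
    · rw [List.mem_cons]
      constructor
      · rintro (h3 | h3)
        · exact absurd (hinj i h1 h2 h3) hij
        · exact h3
      · exact .inr
    · rw [hcnt, Function.update_of_ne hij]
  have hself : cnt' j = cnt j + 1 := by rw [hcnt, Function.update_self]
  have hlt : ∀ k < cnt j, D j k < T := by
    intro k hk
    rcases (h.mem j hj hjn _).2 ⟨k, hk, rfl⟩ with h1 | h1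
    · exact h1.2
    · exact absurd h1.1 hnew
  constructor
  · intro i h1 h2
    have := h.cnt_le i h1 h2
    by_cases hij : i = j
    · subst hij
      rw [if_neg hnew] at this
      rw [hself, if_pos (List.mem_cons_self ..)]
      omega
    · obtain ⟨e1, e2⟩ := hother i h1 h2 hij
      simp only [e1, e2]; exact this
  · intro i h1 h2 k l hkl hl
    by_cases hij : i = j
    · subst hij
      rw [hself] at hl
      rcases (show l ≤ cnt i by omega).eq_or_lt with rfl | hlt'
      · rw [hDT, hDj k hkl]; exact hlt k hkl
      · rw [hDj k (by omega), hDj l hlt']; exact h.mono i h1 h2 k l hkl hlt'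
    · obtain ⟨e1, e2⟩ := hother i h1 h2 hij
      rw [e2] at hl
      have := hcl i h1 h2
      rw [hD' i hij k (by omega), hD' i hij l (by omega)]
      exact h.mono i h1 h2 k l hkl hl
  · intro i h1 h2 r
    by_cases hij : i = j
    · subst hij
      have hm := h.mem i h1 h2 r
      rw [hself]
      constructor
      · rintro (h3 | ⟨-, rfl⟩)
        · obtain ⟨k, hk, hr⟩ := hm.1 (.inl h3)
          exact ⟨k, by omega, by rw [hDj k hk, hr]⟩
        · exact ⟨cnt i, by omega, hDT⟩
      · rintro ⟨k, hk, rfl⟩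
        rcases (show k ≤ cnt i by omega).eq_or_lt with rfl | hlt'
        · exact .inr ⟨List.mem_cons_self .., hDT⟩
        · rw [hDj k hlt']
          rcases (h.mem i h1 h2 _).2 ⟨k, hlt', rfl⟩ with h3 | h3
          · exact .inl h3
          · exact absurd h3.1 hnew
    · obtain ⟨e1, e2⟩ := hother i h1 h2 hij
      rw [e1, e2, h.mem i h1 h2]
      have := hcl i h1 h2
      refine exists_congr fun k => and_congr_right fun hk => ?_
      rw [hD' i hij k (by omega)]

/-- Duplicate-free adjacency lists guarantee that each row receives `T` at most once. The cost is
proportional to the degree of the vertex with number `T`, hence O(n). -/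
theorem sliceCode_spec {env : Env} {n g T : ℕ} (hfit : env.Fits (n + 1)) {σ : Store}
    {A : ℕ → ℕ → Prop} (hA : ∀ u v, A u v → A v u) (hrng : ∀ u v, A u v → u < n)
    (hTr : Tree n (1 - g) A T σ) {kk : ℕ} (hkM : kk ≤ env.M) {L : ℕ → List ℕ}
    (hL : Lists (σ.a .snap) (σ.a .anext) (σ.a .ato) n kk L) (hnd : ∀ v < n, (L v).Nodup)
    (hmem : ∀ v < n, ∀ z, z ∈ L v ↔ A v z)
    (hN : σ.v .N = n + 1) (hg : σ.v .g = g) (hg1 : g ≤ 1) (hT : σ.v .T = T) (hT2 : 2 ≤ T)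
    (hTn : T ≤ n + 1)
    {a : ℤ} {Q : Store → ℤ → Prop}
    (hQ : ∀ σ' b, Frame sliceVars [.D, .cnt] σ σ' →
      (∀ A' T', Tree n g A' T' σ → Tree n g A' T' σ') → Tree n (1 - g) A (T + 1) σ' →
      σ'.v .T = T + 1 → a - 5 * (L (σ.a .inv (2 * T + (1 - g)))).length - 4 ≤ b → Q σ' b) :
    WP env sliceCode σ a Q := by
  obtain ⟨hM2, hM, hM0⟩ := hfit.bounds
  have hb1 : 1 - g ≤ 1 := by omega
  have hgb : g ≠ 1 - g := by omega
  generalize hb : 1 - g = b at *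
  have hlt := hTr.tree.inv_lt hT2 hTn
  have hidx : ∀ j c, j ≤ n + 1 → c ≤ n + 1 → j * (n + 1 + 1) ≤ env.M ∧
      j * (n + 1 + 1) + c ≤ env.M ∧ 2 * (j * (n + 1 + 1) + c) ≤ env.M ∧
      2 * (j * (n + 1 + 1) + c) + b ≤ env.M ∧ 2 * (j * (n + 1 + 1) + c) + b < env.M := by
    intro j c h1 h2
    obtain ⟨h1, h2, h3⟩ := row_index_le (N := n + 1) h1 h2 hb1
    omega
  simp only [sliceCode, WP_seq, WP_set, WP_put, Ex.oth]
  simp [hg, hb, hT, Env.len]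
  change col b (σ.a .inv) T < n at hlt
  have hcol : col b (σ.a .inv) T = σ.a .inv (2 * T + b) := rfl
  rw [← hcol] at *
  generalize hv : col b (σ.a .inv) T = v at *
  repeat refine ⟨by omega, ?_⟩
  -- The snapshot list of `v` is split into the neighbours `done` and the rest `l`; the credits are
  -- counted by the length of `l`.
  refine WP_while (fun σ' c => Frame sliceVars [.D, .cnt] σ σ' ∧ σ'.v .T = T ∧
    (∀ A' T', Tree n g A' T' σ → Tree n g A' T' σ') ∧
    ∃ done l, IsList (σ.a .anext) (σ.a .ato) kk (σ'.v .p) l ∧ (∀ z, z ∈ L v ↔ z ∈ done ∨ z ∈ l) ∧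
      l.Nodup ∧ (∀ z ∈ l, z ∉ done) ∧
      PartialRows n A T done (col b (σ.a .inv)) (col b (σ'.a .cnt)) (rows (n + 1) b (σ'.a .D)) ∧
      a - 2 - 5 * (L v).length + 5 * l.length ≤ c) (a - 2 - 5 * (L v).length) ?_ ?_ ?_ ?_
  · rintro σ' c ⟨-, -, -, done, l, -, -, -, -, -, h⟩
    omega
  · rintro σ' c ⟨hF, hT', hold, done, l, hl, hdl, hln, hdisj, hrows, hc⟩ Q' hQ'
    have e1 := hF.v .N (by decide)
    have e2 := hF.v .g (by decide)
    have e3 := hF.a .ord (by decide)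
    have e4 := hF.a .ato (by decide)
    have e5 := hF.a .anext (by decide)
    simp only [WP_seq, WP_set, WP_put]
    simp [e1, e2, e3, e4, e5, hN, hg, hb, hT', Env.len]
    intro hp0
    generalize hp : σ'.v .p = p at *
    cases hl with
    | nil => exact absurd rfl hp0
    | @cons _ l _ hpk hl =>
    generalize hz : σ.a .ato p = z at *
    have hzL : z ∈ L v := (hdl z).2 (.inr (List.mem_cons_self ..))
    have hzA := (hmem v hlt z).1 hzL
    have hzn := hrng _ _ (hA _ _ hzA)
    have hoz := hTr.tree.ord_ge hzn
    have hiz := hTr.tree.inv_ord z hzn.le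
    have hoc : col b (σ.a .ord) z = σ.a .ord (2 * z + b) := rfl
    rw [hoc] at hoz hiz
    generalize hj : σ.a .ord (2 * z + b) = j at *
    have hcj := hrows.cnt_le j hoz.1 hoz.2
    have hcc : col b (σ'.a .cnt) j = σ'.a .cnt (2 * j + b) := rfl
    rw [hiz, if_neg (hdisj z (List.mem_cons_self ..)), hcc] at hcj
    have hi := hidx j (σ'.a .cnt (2 * j + b)) hoz.2 (by omega)
    repeat refine ⟨by omega, ?_⟩
    rw [List.nodup_cons] at hln
    refine hQ' _ _ ⟨(((hF.setv (by decide) _).seta (by decide) _ _).seta (by decide) _ _).setv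
      (by decide) _, ?_, ?_, z :: done, l, ?_, ?_, hln.2, ?_, ?_, ?_⟩
    · simp [hT']
    · intro A' T' h
      refine (hold A' T' h).congr (fun _ _ => Iff.rfl) ?_ ?_ ?_ ?_ ?_ ?_ <;>
        simp [col_update_ne hb1 hg1 hgb, rows_update_ne hb1 hg1 hgb]
    · simpa using hl
    · intro x
      rw [hdl]
      simp only [List.mem_cons]
      tauto
    · intro x hx hxd
      rcases List.mem_cons.1 hxd with rfl | hxd
      · exact hln.1 hx
      · exact hdisj x (List.mem_cons_of_mem _ hx) hxd
    · have := hrows.append (j := j) (cnt' := Function.update (col b (σ'.a .cnt)) j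
        (col b (σ'.a .cnt) j + 1)) (D' := rows (n + 1) b (Function.update (σ'.a .D)
          (2 * (j * (n + 1 + 1) + σ'.a .cnt (2 * j + b)) + b) T)) hTn hoz.1 hoz.2 (fun i h1 h2 h => by
          rw [← hTr.tree.ord_inv i (by omega) h2, h, hTr.tree.ord_inv j (by omega) hoz.2]) (by
          rw [hiz]; exact hdisj z (List.mem_cons_self ..)) rfl (fun i k hk => by
            rw [rows_update _ hk (by omega)]; rfl)
      rw [hiz] at this
      simpa [col_update, hcc] using this
    · simp at hc ⊢; omega
  · have hl := hL.2 v hlt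
    refine ⟨((Frame.refl _ _ σ).setv (by decide) _).setv (by decide) _, ?_, ?_, [], L v, ?_, ?_, ?_,
      ?_, ?_, ?_⟩
    · simp [hT]
    · intro A' T' h
      exact h.congr (fun _ _ => Iff.rfl) rfl rfl rfl rfl rfl rfl
    · simpa using hl
    · simp
    · exact hnd v hlt
    · simp
    · exact hTr.rows.start
    · omega
  rintro σ₁ c₁ ⟨hF, hT', hold, done, l, hl, hdl, hln, hdisj, hrows, hc⟩ hp0
  simp at hp0
  rw [hp0] at hl
  have hnil : l = [] := by
    generalize hz : (0 : ℕ) = z at *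
    cases hl with
    | nil => rfl
    | cons h => exact absurd hz.symm h
  subst hnil
  simp [hT']
  repeat refine ⟨by omega, ?_⟩
  refine hQ _ _ (hF.setv (by decide) _) (fun A' T' h => ?_) ⟨?_, ?_⟩ (by simp) ?_
  · exact (hold A' T' h).congr (fun _ _ => Iff.rfl) rfl rfl rfl rfl rfl rfl
  · simpa [hF.a .ord (by decide), hF.a .inv (by decide), hF.a .P (by decide),
      hF.a .E (by decide)] using hTr.tree
  · have := hrows.finish ⟨hT2, hTn⟩ (fun x => by
      have h1 := hdl x
      have h2 := hmem v hlt x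
      simp at h1
      rw [hv, ← h1, h2]
      exact ⟨hA _ _, hA _ _⟩)
    simpa [hF.a .inv (by decide)] using this
  · have hLv : (L (σ.a .inv (2 * T + b))).length = (L v).length := by rw [← hv]; rfl
    simp at hc; omega


/-! ### Insertion of an edge -/

/-- The subtrees of the children of the root are disjoint intervals within `1, …, N`. -/
theorem sum_children_le {N : ℕ} {P E : ℕ → ℕ} (hT : NumTree N P E) :
    ∑ c ∈ Finset.Icc 2 N, (if P c = 1 then E c - c else 0) ≤ N := by
  rw [← Finset.sum_filter]
  have h1 : ∀ c ∈ (Finset.Icc 2 N).filter fun c => P c = 1, E c - c = (Finset.Ico c (E c)).card :=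
    fun c _ => by simp
  rw [Finset.sum_congr rfl h1, ← Finset.card_biUnion]
  · calc _ ≤ (Finset.Icc 1 N).card := by
          refine Finset.card_le_card fun x hx => ?_
          simp only [Finset.mem_biUnion, Finset.mem_filter, Finset.mem_Icc, Finset.mem_Ico] at hx ⊢
          obtain ⟨c, ⟨⟨h1, h2⟩, -⟩, h3, h4⟩ := hx
          have := hT.end_le c (by omega) h2
          omega
      _ = N := by simp
  · intro c hc c' hc' hne
    simp only [Finset.coe_filter, Finset.mem_Icc, Set.mem_ofPred_eq] at hc hc'
    have key : ∀ c c' x, 2 ≤ c → c' ≤ N → P c' = 1 → c < c' → c' ≤ x → x < E c → False := by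
      intro c c' x h1 h2 h3 h4 h5 h6
      have := hT.le_par (y := c) (x := c') (by omega) h2 h4 (by omega)
      omega
    rw [Function.onFun, Finset.disjoint_left]
    intro x hx hx'
    simp only [Finset.mem_Ico] at hx hx'
    rcases lt_or_gt_of_ne hne with h | h
    · exact key c c' x hc.1.1 hc'.1.2 hc'.2 h hx'.1 hx.2
    · exact key c' c x hc'.1.1 hc.1.2 hc.2 h hx.1 hx'.2

theorem treeReserve_le {N : ℕ} {P E : ℕ → ℕ} (hT : NumTree N P E) {s : ℕ}
    (hs : ∀ c, 2 ≤ c → c ≤ N → P c = 1 → (E c - c).size ≤ s) :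
    treeReserve N P E ≤ unit N * s * N := by
  calc treeReserve N P E
      ≤ ∑ c ∈ Finset.Icc 2 N, unit N * s * (if P c = 1 then E c - c else 0) := by
        refine Finset.sum_le_sum fun c hc => ?_
        simp only [Finset.mem_Icc] at hc
        split_ifs with h
        · unfold reserve
          rw [mul_assoc (unit N), mul_comm s]
          exact Nat.mul_le_mul_left _ (Nat.mul_le_mul_left _ (hs c hc.1 hc.2 h))
        · simp
    _ = unit N * s * ∑ c ∈ Finset.Icc 2 N, (if P c = 1 then E c - c else 0) := by
        rw [Finset.mul_sum]
    _ ≤ _ := Nat.mul_le_mul_left _ (sum_children_le hT)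

/-- Makes the new base tree the current one, and stores the reported tree as the next one. -/
def swapCode : Stmt := .set .g (1 - ‡.g) ;; .set .s0 ‡.s1 ;; snapCode

/-- Handles the insertion of the edge between `r0` and `r1`. -/
def updCode : Stmt :=
  addCode ;; coreCode ;; outputCode ;; sliceCode ;; .ite .lt ‡.N ‡.T swapCode .skip

/-- The memory contains the graph given by the first `e` edges of the log. -/
structure HasGraph (n e : ℕ) (σ : Store) : Prop where
  n_eq : σ.v .n = n
  N_eq : σ.v .N = n + 1
  out_eq : σ.v .out = n * n
  g_le : σ.v .g ≤ 1
  e_eq : σ.v .e = e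
  e_le : 2 * e ≤ n * n
  log : ∀ k < 2 * e, σ.a .raw k < n
  adj : ∃ L, Lists (σ.a .ahead) (σ.a .anext) (σ.a .ato) n (2 * e + 1) L ∧ AdjLists n (σ.a .raw) e L
  clean : ∀ x, n + 1 < x → σ.a .num x = 0 ∧ σ.a .fin x = 0

theorem AdjLists.congr {n e : ℕ} {lg lg' : ℕ → ℕ} {L : ℕ → List ℕ} (h : AdjLists n lg e L)
    (hl : ∀ k < 2 * e, lg' k = lg k) : AdjLists n lg' e L :=
  ⟨h.nodup, fun v hv z => (h.mem v hv z).trans (logAdj_congr hl).symm, h.sum⟩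

/-- The graph with the first `e` edges of the log is stored, with the base tree of the graph with
`s0` edges, and the next base tree of the graph with `s1` edges, for which the lists of neighbours
with numbers below `T` have been made. -/
structure HasTrees (n e s0 s1 T : ℕ) (σ : Store) : Prop extends HasGraph n e σ where
  s0_eq : σ.v .s0 = s0
  s1_eq : σ.v .s1 = s1
  T_eq : σ.v .T = T
  s0_le : s0 ≤ s1
  s1_le : s1 ≤ e
  T_ge : 2 ≤ T
  cur : Tree n (σ.v .g) (logAdj (σ.a .raw) 0 s0) (n + 2) σ
  next : Tree n (1 - σ.v .g) (logAdj (σ.a .raw) 0 s1) T σ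
  snap : ∃ L, Lists (σ.a .snap) (σ.a .anext) (σ.a .ato) n (2 * e + 1) L ∧
    AdjLists n (σ.a .raw) s1 L

/-- The report of a DFS tree. -/
def Reported (n e : ℕ) (σ : Store) : Prop :=
  VTree n (logAdj (σ.a .raw) 0 e) (σ.a .tnum) (σ.a .tpar) (σ.a .tfin) fun v => σ.a .raw (n * n + v)

theorem HasGraph.congr {n e : ℕ} {σ σ' : Store} (h : HasGraph n e σ) (h1 : σ'.v .n = σ.v .n)
    (h2 : σ'.v .N = σ.v .N) (h3 : σ'.v .out = σ.v .out) (h4 : σ'.v .g ≤ 1)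
    (h5 : σ'.v .e = σ.v .e) (h6 : ∀ k < n * n, σ'.a .raw k = σ.a .raw k)
    (h7 : σ'.a .ahead = σ.a .ahead) (h8 : σ'.a .anext = σ.a .anext) (h9 : σ'.a .ato = σ.a .ato)
    (h10 : ∀ x, n + 1 < x → σ'.a .num x = 0 ∧ σ'.a .fin x = 0) : HasGraph n e σ' where
  n_eq := h1.trans h.n_eq
  N_eq := h2.trans h.N_eq
  out_eq := h3.trans h.out_eq
  g_le := h4
  e_eq := h5.trans h.e_eq
  e_le := h.e_le
  log := fun k hk => by rw [h6 k (by have := h.e_le; omega)]; exact h.log k hk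
  adj := by
    rw [h7, h8, h9]
    obtain ⟨L, hL, hA⟩ := h.adj
    exact ⟨L, hL, hA.congr fun k hk => h6 k (by have := h.e_le; omega)⟩
  clean := h10

/-- The search and the report. -/
theorem core_output_spec {env : Env} {n e s0 : ℕ} (hfit : env.Fits (n + 1)) {σ : Store}
    (h : HasGraph n e σ) (hs0 : σ.v .s0 = s0) (hs0e : s0 ≤ e)
    (hT : Tree n (σ.v .g) (logAdj (σ.a .raw) 0 s0) (n + 2) σ)
    {a : ℤ} {Q : Store → ℤ → Prop}
    (hQ : ∀ σ' b, Frame (coreVars ++ outputVars) (coreArrs ++ outputArrs) σ σ' →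
      HasGraph n e σ' → Reported n e σ' → (∀ k < n * n, σ'.a .raw k = σ.a .raw k) →
      a - treeReserve (n + 1) (col (σ.v .g) (σ.a .P)) (col (σ.v .g) (σ.a .E)) -
        3 * unit (n + 1) * (n + 1) - 36 * (e - s0 : ℕ) - 8 * (n + 1) - 2 ≤ b → Q σ' b) :
    WP env (coreCode ;; outputCode) σ a Q := by
  rw [WP_seq]
  refine coreCode_spec hfit hT h.N_eq rfl h.g_le hs0 h.e_eq hs0e h.e_le h.clean h.log ?_
  intro σ₁ b₁ hF₁ hfin hb₁
  have e1 := hF₁.v .g (by decide)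
  have e2 := hF₁.a .inv (by decide)
  have e3 := hF₁.a .raw (by decide)
  rw [← e2] at hfin
  refine outputCode_spec hfit (A := logAdj (σ.a .raw) 0 e) (hT.frame hF₁).tree
    (fun u v => logAdj_split (Nat.zero_le _) hs0e) ((hF₁.v .N (by decide)).trans h.N_eq) e1 h.g_le
    ((hF₁.v .out (by decide)).trans h.out_eq) hfin ?_
  intro σ₂ b₂ hF₂ hV hraw hb₂
  rw [e3] at hraw
  have hF : Frame (coreVars ++ outputVars) (coreArrs ++ outputArrs) σ σ₂ :=
    (Frame.trans (Frame.refl _ _ σ) hF₁ (by decide) (by decide)).trans hF₂ (by decide) (by decide)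
  refine hQ _ _ hF ?_ ?_ hraw (by omega)
  · refine h.congr (hF.v _ (by decide)) (hF.v _ (by decide)) (hF.v _ (by decide)) ?_
      (hF.v _ (by decide)) hraw (hF.a _ (by decide)) (hF.a _ (by decide)) (hF.a _ (by decide)) ?_
    · rw [hF.v .g (by decide)]; exact h.g_le
    · intro x hx
      rw [hF₂.a .num (by decide), hF₂.a .fin (by decide)]
      exact hfin.clean x (.inr hx)
  · have : logAdj (σ₂.a .raw) 0 e = logAdj (σ.a .raw) 0 e := by
      funext u v
      exact propext (logAdj_congr fun k hk => hraw k (by have := h.e_le; omega))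
    unfold Reported
    rw [this]
    exact hV

/-- The finished tree for `s1` edges comes into use, and the tree just reported, which belongs to
all `e` edges, becomes the next one under construction. -/
theorem swapCode_spec {env : Env} {n e s0 s1 : ℕ} (hfit : env.Fits (n + 1)) {σ : Store}
    (h : HasTrees n e s0 s1 (n + 2) σ) (hV : Reported n e σ)
    {a : ℤ} {Q : Store → ℤ → Prop}
    (hQ : ∀ σ' b, Frame (.g :: .s0 :: snapVars) snapArrs σ σ' → HasTrees n e s1 e 2 σ' →
      Reported n e σ' → a - 9 * (n + 1) - 6 ≤ b → Q σ' b) :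
    WP env swapCode σ a Q := by
  obtain ⟨hM2, hM, hM0⟩ := hfit.bounds
  have hg1 := h.g_le
  simp only [swapCode, WP_seq, WP_set]
  simp
  refine ⟨by omega, ?_⟩
  refine snapCode_spec (g := 1 - σ.v .g) hfit (by exact hV) ?_ ?_ (by omega) ?_
  · simp [h.n_eq]
  · simp
  intro σ₁ b₁ hF hold hnew hsnap hs1 hT hb
  have hFF : Frame (.g :: .s0 :: snapVars) snapArrs σ σ₁ :=
    (((Frame.refl _ _ σ).setv (by decide) _).setv (by decide) _).trans hF (by decide) (by decide)
  have e1 := hF.v .g (by decide)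
  have e2 := hF.v .s0 (by decide)
  simp at e1 e2 hs1 hsnap
  have hgg : 1 - (1 - σ.v .g) = σ.v .g := by omega
  rw [hgg] at hnew
  have hraw := hFF.a .raw (by decide)
  refine hQ _ _ hFF { h.toHasGraph.congr (hFF.v _ (by decide)) (hFF.v _ (by decide))
      (hFF.v _ (by decide)) (by rw [e1]; omega) (hFF.v _ (by decide)) (fun k _ => by rw [hraw])
      (hFF.a _ (by decide)) (hFF.a _ (by decide)) (hFF.a _ (by decide)) (fun x hx => by
        rw [hFF.a .num (by decide), hFF.a .fin (by decide)]; exact h.clean x hx) with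
    s0_eq := by rw [e2, h.s1_eq]
    s1_eq := by rw [hs1, h.e_eq]
    T_eq := hT
    s0_le := h.s1_le
    s1_le := le_rfl
    T_ge := le_rfl
    cur := ?_
    next := ?_
    snap := ?_ } ?_ (by omega)
  · rw [e1, hraw]
    refine hold _ _ (h.next.congr (fun _ _ => Iff.rfl) rfl rfl rfl rfl rfl rfl)
  · rw [e1, hgg, hraw]; exact hnew
  · obtain ⟨L, hL, hA⟩ := h.adj
    rw [hFF.a .anext (by decide), hFF.a .ato (by decide), hraw]
    exact ⟨L, ⟨hL.1, fun v hv => by rw [hsnap v hv.le]; exact hL.2 v hv⟩, hA⟩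
  · unfold Reported
    rw [hraw, hFF.a .tnum (by decide), hFF.a .tpar (by decide), hFF.a .tfin (by decide)]
    exact hV

/-- One more list of neighbours. -/
theorem slice_spec {env : Env} {n e s0 s1 T : ℕ} (hfit : env.Fits (n + 1)) {σ : Store}
    (h : HasTrees n e s0 s1 T σ) (hTn : T ≤ n + 1) (hV : Reported n e σ) {L : ℕ → List ℕ}
    (hL : Lists (σ.a .snap) (σ.a .anext) (σ.a .ato) n (2 * e + 1) L)
    (hA : AdjLists n (σ.a .raw) s1 L)
    {a : ℤ} {Q : Store → ℤ → Prop}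
    (hQ : ∀ σ' b, Frame sliceVars [.D, .cnt] σ σ' → HasTrees n e s0 s1 (T + 1) σ' →
      Reported n e σ' →
      a - 5 * (L (σ.a .inv (2 * T + (1 - σ.v .g)))).length - 4 ≤ b → Q σ' b) :
    WP env sliceCode σ a Q := by
  have hNN : (n + 1) * (n + 1) = n * n + 2 * n + 1 := by ring
  have hNN' : (n + 1 + 1) * (n + 1 + 1) = n * n + 4 * n + 4 := by ring
  have he := h.e_le
  have hs1 := h.s1_le
  obtain ⟨hM2, hM, hM0⟩ := hfit.bounds
  refine sliceCode_spec hfit (fun _ _ => logAdj.symm) ?_ h.next (by omega) hL hA.nodup hA.mem h.N_eq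
    rfl h.g_le h.T_eq h.T_ge hTn ?_
  · rintro u v ⟨k, h1, h2, h3⟩
    have l1 := h.log (2 * k) (by omega)
    have l2 := h.log (2 * k + 1) (by omega)
    omega
  intro σ' b hF hold hnew hT hb
  have hraw := hF.a .raw (by decide)
  have hg := hF.v .g (by decide)
  refine hQ _ _ hF { h.toHasGraph.congr (hF.v _ (by decide)) (hF.v _ (by decide))
      (hF.v _ (by decide)) (by rw [hg]; exact h.g_le) (hF.v _ (by decide)) (fun k _ => by rw [hraw])
      (hF.a _ (by decide)) (hF.a _ (by decide)) (hF.a _ (by decide)) (fun x hx => by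
        rw [hF.a .num (by decide), hF.a .fin (by decide)]; exact h.clean x hx) with
    s0_eq := by rw [hF.v .s0 (by decide), h.s0_eq]
    s1_eq := by rw [hF.v .s1 (by decide), h.s1_eq]
    T_eq := hT
    s0_le := h.s0_le
    s1_le := h.s1_le
    T_ge := by have := h.T_ge; omega
    cur := by rw [hg, hraw]; exact hold _ _ h.cur
    next := by rw [hg, hraw]; exact hnew
    snap := by
      rw [hraw, hF.a .snap (by decide), hF.a .anext (by decide), hF.a .ato (by decide)]
      exact h.snap } ?_ hb
  unfold Reported
  rw [hraw, hF.a .tnum (by decide), hF.a .tpar (by decide), hF.a .tfin (by decide)]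
  exact hV

/-- A bound for the time of `updCode`. -/
def updCost (n : ℕ) : ℕ :=
  unit (n + 1) * (n + 1).size * (n + 1) + 3 * unit (n + 1) * (n + 1) + 200 * (n + 1)

theorem AdjLists.length_le {n e : ℕ} {lg : ℕ → ℕ} {L : ℕ → List ℕ} (h : AdjLists n lg e L)
    (hlog : ∀ k < 2 * e, lg k < n) {v : ℕ} (hv : v < n) : (L v).length ≤ n := by
  rw [← List.toFinset_card_of_nodup (h.nodup v hv)]
  calc (L v).toFinset.card ≤ (Finset.range n).card := by
        refine Finset.card_le_card fun z hz => ?_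
        rw [List.mem_toFinset, h.mem v hv] at hz
        obtain ⟨k, -, h2, h3⟩ := hz
        have l1 := hlog (2 * k) (by omega)
        have l2 := hlog (2 * k + 1) (by omega)
        rw [Finset.mem_range]
        omega
    _ = n := by simp

/-- The invariant `s1 + T = e + 2` says that one row number has been handled per insertion since the
snapshot; with `T ≤ n + 1` and `s1 ≤ s0 + n`, at most `2 * n` edges are more recent than the base
tree when the search runs. Hence every single insertion meets the bound, without amortization over
insertions. -/
theorem updCode_spec {env : Env} {n e s0 s1 T : ℕ} (hfit : env.Fits (n + 1)) {σ : Store}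
    (h : HasTrees n e s0 s1 T σ) (hT : s1 + T = e + 2) (hTn : T ≤ n + 1) (hs : s1 ≤ s0 + n)
    {u v : ℕ} (hu : σ.v .r0 = u) (hv : σ.v .r1 = v) (hun : u < n) (hvn : v < n) (huv : u ≠ v)
    (hnew : ¬ logAdj (σ.a .raw) 0 e u v) (hen : 2 * (e + 1) ≤ n * n)
    {a : ℤ} {Q : Store → ℤ → Prop}
    (hQ : ∀ σ' b s0' s1' T', HasTrees n (e + 1) s0' s1' T' σ' → s1' + T' = e + 1 + 2 →
      T' ≤ n + 1 → s1' ≤ s0' + n → Reported n (e + 1) σ' →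
      (∀ x y, logAdj (σ'.a .raw) 0 (e + 1) x y ↔
        logAdj (σ.a .raw) 0 e x y ∨ (u = x ∧ v = y) ∨ (u = y ∧ v = x)) →
      a - updCost n ≤ b → Q σ' b) :
    WP env updCode σ a Q := by
  obtain ⟨hM2, hM, hM0⟩ := hfit.bounds
  have h3 := hfit.three_le
  have hs01 := h.s0_le
  have hs1e := h.s1_le
  obtain ⟨L, hL, hA⟩ := h.adj
  rw [updCode, WP_seq]
  refine addCode_spec hfit hu hv h.e_eq hun hvn hen hL ?_
  intro σ₁ hF₁ hraw₁ he₁ hL₁ hext₁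
  have hlt₁ : ∀ k < 2 * e, σ₁.a .raw k = σ.a .raw k := fun k hk => by
    rw [hraw₁, logPush_of_lt hk]
  have hA₁ := hA.push hun hvn huv hnew
  rw [← hraw₁] at hA₁
  have hadj₁ : ∀ b ≤ e, logAdj (σ₁.a .raw) 0 b = logAdj (σ.a .raw) 0 b := by
    intro b hb
    funext x y
    exact propext (logAdj_congr fun k hk => hlt₁ k (by omega))
  have hg₁ := hF₁.v .g (by decide)
  have hG₁ : HasTrees n (e + 1) s0 s1 T σ₁ := {
    n_eq := by rw [hF₁.v .n (by decide), h.n_eq]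
    N_eq := by rw [hF₁.v .N (by decide), h.N_eq]
    out_eq := by rw [hF₁.v .out (by decide), h.out_eq]
    g_le := by rw [hg₁]; exact h.g_le
    e_eq := he₁
    e_le := hen
    log := by
      intro k hk
      by_cases hk' : k < 2 * e
      · rw [hlt₁ k hk']; exact h.log k hk'
      · rw [hraw₁, logPush]
        rcases (show k = 2 * e ∨ k = 2 * e + 1 by omega) with rfl | rfl
        · rw [Function.update_of_ne (by omega), Function.update_self]; exact hun
        · rw [Function.update_self]; exact hvn
    adj := ⟨_, hL₁, hA₁⟩
    clean := by rw [hF₁.a .num (by decide), hF₁.a .fin (by decide)]; exact h.clean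
    s0_eq := by rw [hF₁.v .s0 (by decide), h.s0_eq]
    s1_eq := by rw [hF₁.v .s1 (by decide), h.s1_eq]
    T_eq := by rw [hF₁.v .T (by decide), h.T_eq]
    s0_le := hs01
    s1_le := by omega
    T_ge := h.T_ge
    cur := by rw [hg₁, hadj₁ _ (by omega)]; exact h.cur.frame hF₁
    next := by rw [hg₁, hadj₁ _ (by omega)]; exact h.next.frame hF₁
    snap := by
      obtain ⟨L', hL', hA'⟩ := h.snap
      rw [hF₁.a .snap (by decide)]
      exact ⟨L', hL'.extend (by omega) (fun i hi => (hext₁ i hi).1) (fun i hi => (hext₁ i hi).2),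
        hA'.congr fun k hk => hlt₁ k (by omega)⟩ }
  have hassoc : ∀ c d x : Stmt, ∀ a Q, WP env ((c ;; d) ;; x) σ₁ a Q → WP env (c ;; d ;; x) σ₁ a Q := by
    intro c d x a Q
    simp only [WP_seq]
    exact id
  refine hassoc _ _ _ _ _ ?_
  rw [WP_seq]
  refine core_output_spec hfit hG₁.toHasGraph hG₁.s0_eq (by omega) hG₁.cur ?_
  intro σ₂ b₂ hF₂ hG₂ hV₂ hraw₂ hb₂
  have hres := treeReserve_le hG₁.cur.tree.tree (s := (n + 1).size) (fun c h1 h2 _ =>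
    Nat.size_le_size (by have := hG₁.cur.tree.tree.end_le c (by omega) h2; omega))
  have hadj₂ : ∀ b ≤ e + 1, logAdj (σ₂.a .raw) 0 b = logAdj (σ₁.a .raw) 0 b := by
    intro b hb
    funext x y
    exact propext (logAdj_congr fun k hk => hraw₂ k (by omega))
  have hg₂ := hF₂.v .g (by decide)
  have hT₂ : HasTrees n (e + 1) s0 s1 T σ₂ := { hG₂ with
    s0_eq := by rw [hF₂.v .s0 (by decide), hG₁.s0_eq]
    s1_eq := by rw [hF₂.v .s1 (by decide), hG₁.s1_eq]
    T_eq := by rw [hF₂.v .T (by decide), hG₁.T_eq]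
    s0_le := hs01
    s1_le := by omega
    T_ge := h.T_ge
    cur := by rw [hg₂, hadj₂ _ (by omega)]; exact hG₁.cur.frame hF₂
    next := by rw [hg₂, hadj₂ _ (by omega)]; exact hG₁.next.frame hF₂
    snap := by
      obtain ⟨L', hL', hA'⟩ := hG₁.snap
      rw [hF₂.a .snap (by decide), hF₂.a .anext (by decide), hF₂.a .ato (by decide)]
      exact ⟨L', hL', hA'.congr fun k hk => hraw₂ k (by omega)⟩ }
  obtain ⟨L₂, hL₂, hA₂⟩ := hT₂.snap
  rw [WP_seq]
  refine slice_spec hfit hT₂ hTn hV₂ hL₂ hA₂ ?_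
  intro σ₃ b₃ hF₃ hT₃ hV₃ hb₃
  have hlen := hA₂.length_le (fun k hk => hT₂.log k (by omega))
    (hT₂.next.tree.inv_lt h.T_ge hTn)
  have hlen' : (L₂ (σ₂.a .inv (2 * T + (1 - σ₂.v .g)))).length ≤ n := hlen
  have hraw₃ := hF₃.a .raw (by decide)
  have hfinal : ∀ x y, logAdj (σ₃.a .raw) 0 (e + 1) x y ↔
      logAdj (σ.a .raw) 0 e x y ∨ (u = x ∧ v = y) ∨ (u = y ∧ v = x) := by
    intro x y
    rw [hraw₃, hadj₂ _ le_rfl, hraw₁, logAdj_push (Nat.zero_le _)]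
  have hcost : (updCost n : ℤ) = (unit (n + 1) * (n + 1).size * (n + 1) : ℕ) +
      3 * unit (n + 1) * (n + 1) + 200 * (n + 1) := by
    unfold updCost; push_cast; ring
  simp only [WP_ite, WP_skip]
  simp [hT₃.N_eq, hT₃.T_eq]
  constructor
  · intro hlt
    -- The last list has been made, exactly `n` insertions after the snapshot. After the swap the
    -- old `s1` is the new `s0`, the new `s1` is `e + 1`, and these differ by `n`.
    obtain rfl : T = n + 1 := by omega
    refine swapCode_spec hfit hT₃ hV₃ ?_
    intro σ₄ b₄ hF₄ hT₄ hV₄ hb₄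
    refine hQ _ _ _ _ _ hT₄ rfl (by omega) (by omega) hV₄ ?_ ?_
    · rw [hF₄.a .raw (by decide)]; exact hfinal
    · omega
  · intro hle
    refine hQ _ _ _ _ _ hT₃ (by omega) (by omega) hs hV₃ hfinal ?_
    omega


/-! ### Preprocessing -/

/-- Builds the adjacency lists from the input. -/
def readCode : Stmt :=
  .set .n ‡.r0 ;; .set .m ‡.r1 ;; .set .N (‡.n + 1) ;; .set .out (‡.n * ‡.n) ;;
  .loop .lt ‡.e ‡.m
    (.set .r0 (.get .raw (2 * ‡.e)) ;; .set .r1 (.get .raw (2 * ‡.e + 1)) ;; addCode)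

/-- Builds the DFS tree of the graph without edges. -/
def starCode : Stmt :=
  .put .ord (2 * ‡.n) 1 ;; .put .inv 2 ‡.n ;; .put .E 2 (‡.N + 1) ;;
  .set .i 2 ;;
  .loop .le ‡.i ‡.N
    (.put .ord (2 * (‡.i - 2)) ‡.i ;; .put .inv (2 * ‡.i) (‡.i - 2) ;; .put .P (2 * ‡.i) 1 ;;
    .put .E (2 * ‡.i) (‡.i + 1) ;; .set .i (‡.i + 1))

/-- The preprocessing. -/
def preCode : Stmt :=
  readCode ;; starCode ;; coreCode ;; outputCode ;; snapCode ;;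
  .loop .le ‡.T ‡.N sliceCode ;; swapCode

/-- The initial contents of the memory: the first `m` edges of the log, and zeros. -/
structure Input (n m : ℕ) (σ : Store) : Prop where
  r0 : σ.v .r0 = n
  r1 : σ.v .r1 = m
  v : ∀ x, x ≠ .r0 → x ≠ .r1 → σ.v x = 0
  a : ∀ f, f ≠ .raw → ∀ i, σ.a f i = 0
  le : 2 * m ≤ n * n
  log : ∀ k < 2 * m, σ.a .raw k < n
  ne : ∀ k < m, σ.a .raw (2 * k) ≠ σ.a .raw (2 * k + 1)
  new : ∀ k < m, ¬ logAdj (σ.a .raw) 0 k (σ.a .raw (2 * k)) (σ.a .raw (2 * k + 1))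

/-- The variables that are changed by `readCode`. -/
abbrev readVars : List Var := [.r0, .r1, .n, .m, .N, .out, .e]

theorem adjLists_nil (n : ℕ) (lg : ℕ → ℕ) : AdjLists n lg 0 fun _ => [] :=
  ⟨by simp, by simp [logAdj_self], by simp⟩

theorem readCode_spec {env : Env} {n m : ℕ} (hfit : env.Fits (n + 1)) {σ : Store}
    (h : Input n m σ) {a : ℤ} {Q : Store → ℤ → Prop}
    (hQ : ∀ σ' b, Frame readVars [.raw, .ahead, .anext, .ato] σ σ' → σ'.a .raw = σ.a .raw →
      HasGraph n m σ' → a - 12 * m - 5 ≤ b → Q σ' b) : WP env readCode σ a Q := by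
  obtain ⟨hM2, hM, hM0⟩ := hfit.bounds
  have hBN := hfit.B_eq
  have hNN : (n + 1) * (n + 1) = n * n + 2 * n + 1 := by ring
  have hNN' : (n + 1 + 1) * (n + 1 + 1) = n * n + 4 * n + 4 := by ring
  have hm := h.le
  simp only [readCode, WP_seq, WP_set]
  simp [h.r0, h.r1]
  repeat refine ⟨by omega, ?_⟩
  refine WP_while (fun σ' b => Frame readVars [.raw, .ahead, .anext, .ato] σ σ' ∧
    σ'.a .raw = σ.a .raw ∧ σ'.v .m = m ∧ σ'.v .n = n ∧ σ'.v .N = n + 1 ∧ σ'.v .out = n * n ∧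
    σ'.v .e ≤ m ∧ (∃ L, Lists (σ'.a .ahead) (σ'.a .anext) (σ'.a .ato) n (2 * σ'.v .e + 1) L ∧
      AdjLists n (σ.a .raw) (σ'.v .e) L) ∧ a - 4 - 12 * (σ'.v .e : ℤ) ≤ b) (a - 4 - 12 * m) ?_ ?_ ?_ ?_
  · rintro σ' b ⟨-, -, -, -, -, -, h1, -, h2⟩
    omega
  · rintro σ' b ⟨hF, hraw, e1, e2, e3, e4, hem, ⟨L, hL, hA⟩, hb⟩ Q' hQ'
    generalize he : σ'.v .e = e at *
    simp only [WP_seq, WP_set]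
    simp [e1, hraw, he, Env.len]
    intro hlt
    repeat refine ⟨by omega, ?_⟩
    have hlogu := h.log (2 * e) (by omega)
    have hlogv := h.log (2 * e + 1) (by omega)
    -- The input already stands at the beginning of `raw`, where the log is kept, so inserting an
    -- input edge writes back what is there.
    have hpush : logPush (σ.a .raw) e (σ.a .raw (2 * e)) (σ.a .raw (2 * e + 1)) = σ.a .raw := by
      unfold logPush
      rw [Function.update_eq_self, Function.update_eq_self]
    refine addCode_spec (n := n) (e := e) (u := σ.a .raw (2 * e)) (v := σ.a .raw (2 * e + 1)) hfit
      (by simp) (by simp) ?_ hlogu hlogv (by omega) (L := L) ?_ ?_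
    · simp [he]
    · simpa using hL
    intro σ₁ hF₁ hraw₁ he₁ hL₁ _
    simp [hraw, hpush] at hraw₁
    have hA₁ := hA.push hlogu hlogv (h.ne e hlt) (h.new e hlt)
    rw [hpush] at hA₁
    have hFF : Frame readVars [.raw, .ahead, .anext, .ato] σ σ₁ := Frame.trans
      ((hF.setv (by decide) _).setv (by decide) _) hF₁ (by decide) (by decide)
    refine hQ' _ _ ⟨hFF, hraw₁, ?_, ?_, ?_, ?_, ?_, ⟨_, by rw [he₁]; exact hL₁, by rw [he₁]; exact hA₁⟩, ?_⟩
    · rw [hF₁.v .m (by decide)]; simpa using e1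
    · rw [hF₁.v .n (by decide)]; simpa using e2
    · rw [hF₁.v .N (by decide)]; simpa using e3
    · rw [hF₁.v .out (by decide)]; simpa using e4
    · rw [he₁]; omega
    · rw [he₁]; push_cast; omega
  · have he0 := h.v .e (by decide) (by decide)
    refine ⟨((((Frame.refl _ _ σ).setv (by decide) _).setv (by decide) _).setv (by decide) _).setv
      (by decide) _, ?_, ?_, ?_, ?_, ?_, ?_, ⟨fun _ => [], ?_, ?_⟩, ?_⟩
    · simp
    · simp
    · simp
    · simp
    · simp
    · simp [he0]
    · refine ⟨by simp, fun y _ => ?_⟩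
      simp [h.a .ahead (by decide)]
      exact .nil
    · simp [he0]; exact adjLists_nil _ _
    · simp [he0]; omega
  rintro σ₁ b₁ ⟨hF, hraw, e1, e2, e3, e4, hem, ⟨L, hL, hA⟩, hb⟩ hn
  simp [e1] at hn
  have he : σ₁.v .e = m := by omega
  rw [he] at hL hA hb
  refine hQ _ _ hF hraw ⟨e2, e3, e4, ?_, he, hm, ?_, ⟨L, hL, ?_⟩, ?_⟩ (by omega)
  · rw [hF.v .g (by decide), h.v .g (by decide) (by decide)]; omega
  · rw [hraw]; exact h.log
  · rw [hraw]; exact hA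
  · intro x _
    rw [hF.a .num (by decide), hF.a .fin (by decide), h.a .num (by decide), h.a .fin (by decide)]
    exact ⟨rfl, rfl⟩

/-- In the star, vertex `v` gets the number `v + 2`. All subtrees below the root have one vertex,
and the binary length of 1 is 1, so the reserve is only one unit per vertex. This is why the
preprocessing has a single logarithm. -/
theorem starCode_spec {env : Env} {n m : ℕ} (hfit : env.Fits (n + 1)) {σ : Store}
    (h : HasGraph n m σ) (hcnt : ∀ i, σ.a .cnt i = 0)
    {a : ℤ} {Q : Store → ℤ → Prop}
    (hQ : ∀ σ' b, Frame [.i] [.ord, .inv, .P, .E] σ σ' →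
      Tree n 0 (fun _ _ => False) (n + 2) σ' → treeReserve (n + 1) (col 0 (σ'.a .P))
        (col 0 (σ'.a .E)) ≤ unit (n + 1) * (n + 1) →
      a - 6 * n - 5 ≤ b → Q σ' b) : WP env starCode σ a Q := by
  obtain ⟨hM2, hM, hM0⟩ := hfit.bounds
  have h3 := hfit.three_le
  simp only [starCode, WP_seq, WP_set, WP_put]
  simp [h.n_eq, h.N_eq, Env.len]
  repeat refine ⟨by omega, ?_⟩
  have hu : ∀ (f : ℕ → ℕ) (i x : ℕ), col 0 (Function.update f (2 * i) x) =
      Function.update (col 0 f) i x := col_update 0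
  refine WP_while (fun σ' b => Frame [.i] [.ord, .inv, .P, .E] σ σ' ∧ 2 ≤ σ'.v .i ∧
    σ'.v .i ≤ n + 2 ∧ col 0 (σ'.a .ord) n = 1 ∧ col 0 (σ'.a .inv) 1 = n ∧
    col 0 (σ'.a .E) 1 = n + 2 ∧ (∀ j, 2 ≤ j → j < σ'.v .i → col 0 (σ'.a .ord) (j - 2) = j ∧
      col 0 (σ'.a .inv) j = j - 2 ∧ col 0 (σ'.a .P) j = 1 ∧ col 0 (σ'.a .E) j = j + 1) ∧
    a - 4 - 6 * (σ'.v .i - 2 : ℤ) ≤ b) (a - 4 - 6 * n) ?_ ?_ ?_ ?_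
  · rintro σ' b ⟨-, -, h1, -, -, -, -, h2⟩
    omega
  · rintro σ' b ⟨hF, hi1, hi2, ho, hi, hE, htab, hb⟩ Q' hQ'
    have e1 := hF.v .N (by decide)
    generalize hi : σ'.v .i = i at *
    simp only [WP_seq, WP_set, WP_put]
    simp [e1, h.N_eq, hi, Env.len]
    intro hlt
    repeat refine ⟨by omega, ?_⟩
    refine hQ' _ _ ⟨((((hF.seta (by decide) _ _).seta (by decide) _ _).seta (by decide) _ _).seta
      (by decide) _ _).setv (by decide) _, ?_, ?_, ?_, ?_, ?_, ?_, ?_⟩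
    · simp; omega
    · simp; omega
    · simp [hu]; rw [Function.update_of_ne (by omega)]; exact ho
    · simp [hu]; rw [Function.update_of_ne (by omega)]; assumption
    · simp [hu]; rw [Function.update_of_ne (by omega)]; exact hE
    · simp [hu]
      intro j h1 h2
      by_cases hji : j = i
      · subst hji; simp
      · rw [Function.update_of_ne (by omega), Function.update_of_ne (by omega),
          Function.update_of_ne (by omega), Function.update_of_ne (by omega)]
        exact htab j h1 (by omega)
    · simp; omega
  · refine ⟨((((Frame.refl _ _ σ).seta (by decide) _ _).seta (by decide) _ _).seta
      (by decide) _ _).setv (by decide) _, ?_, ?_, ?_, ?_, ?_, ?_, ?_⟩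
    · simp
    · simp
    · simp [hu]
    · simp [col]
    · simp [col]
    · simp; intro j h1 h2; omega
    · simp; omega
  rintro σ₁ b₁ ⟨hF, hi1, hi2, ho, hi, hE, htab, hb⟩ hn
  have e1 := hF.v .N (by decide)
  simp [e1, h.N_eq] at hn
  have hin : σ₁.v .i = n + 2 := by omega
  rw [hin] at htab hb
  have htree : NumTree (n + 1) (col 0 (σ₁.a .P)) (col 0 (σ₁.a .E)) := by
    have hEE : ∀ i, 1 ≤ i → i ≤ n + 1 → i < col 0 (σ₁.a .E) i ∧ col 0 (σ₁.a .E) i ≤ n + 2 := by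
      intro i h1 h2
      rcases h1.eq_or_lt with rfl | h1
      · omega
      · have := (htab i h1 (by omega)).2.2.2; omega
    constructor
    · intro j h1 h2; have := htab j h1 (by omega); omega
    · intro j h1 h2; have := htab j h1 (by omega); omega
    · intro i h1 h2; exact (hEE i h1 h2).1
    · intro i h1 h2; exact (hEE i h1 h2).2
    · omega
    · intro i j h1 h2 h3 h4
      have hj := htab j h3 (by omega)
      rw [hj.2.2.1]
      rcases h1.eq_or_lt with rfl | h1
      · omega
      · have := htab i h1 (by omega)
        omega
  refine hQ _ _ hF ⟨⟨?_, ?_, ?_, ?_, ho, htree, ?_, ?_⟩, ⟨?_, ?_, ?_⟩⟩ ?_ (by omega)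
  · intro v hv
    rcases hv.eq_or_lt with rfl | hv
    · omega
    · have := (htab (v + 2) (by omega) (by omega)).1
      simp at this
      omega
  · intro v hv
    rcases hv.eq_or_lt with rfl | hv
    · rw [ho, hi]
    · have := (htab (v + 2) (by omega) (by omega))
      simp at this
      rw [this.1, this.2.1]
  · intro i h1 h2
    rcases h1.eq_or_lt with rfl | h1
    · omega
    · have := htab i h1 (by omega); omega
  · intro i h1 h2
    rcases h1.eq_or_lt with rfl | h1
    · rw [hi, ho]
    · have := htab i h1 (by omega)
      rw [this.2.1, this.1]
  · intro j h1 h2; exact .inl (htab j h1 (by omega)).2.2.1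
  · rintro i j ⟨-, -, h⟩; exact h.elim
  · intro i h1 h2
    simp [col, hF.a .cnt (by decide), hcnt]
  · intro i h1 h2
    simp [col, hF.a .cnt (by decide), hcnt]
  · intro i h1 h2 r
    simp [col, hF.a .cnt (by decide), hcnt, Rel]
  · have := treeReserve_le htree (s := 1) (fun c h1 h2 _ => by
      rw [(htab c h1 (by omega)).2.2.2]
      simp)
    simpa using this

/-- A bound for the time of the preprocessing. -/
def preCost (n m : ℕ) : ℕ := 4 * unit (n + 1) * (n + 1) + 60 * m + 100 * (n + 1)

/-- Taking the vertices in the order of their numbers only permutes the degree sum, so all slices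
together take time linear in the numbers of edges and vertices. -/
theorem sum_lists {n e : ℕ} {A : ℕ → ℕ → Prop} {ord inv P E : ℕ → ℕ} (h : TreeIn n A ord inv P E)
    {lg : ℕ → ℕ} {L : ℕ → List ℕ} (hA : AdjLists n lg e L) :
    ∑ i ∈ Finset.Ico 2 (n + 2), (L (inv i)).length = 2 * e := by
  rw [← hA.sum]
  refine Finset.sum_nbij' inv ord ?_ ?_ ?_ ?_ ?_
  · intro i hi
    simp only [Finset.mem_Ico, Finset.mem_range] at hi ⊢
    exact h.inv_lt hi.1 (by omega)
  · intro v hv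
    simp only [Finset.mem_Ico, Finset.mem_range] at hv ⊢
    have := h.ord_ge hv
    omega
  · intro i hi
    simp only [Finset.mem_Ico] at hi
    exact h.ord_inv i (by omega) (by omega)
  · intro v hv
    simp only [Finset.mem_range] at hv
    exact h.inv_ord v hv.le
  · intro i _
    rfl

/-- After the search from the star, all rows for the resulting tree are made at once and the buffers
are swapped. The same tree then serves as base tree and as the next base tree under construction, so
both snapshots stand at `m` edges and `T` is 2. -/
theorem preCode_spec {env : Env} {n m : ℕ} (hfit : env.Fits (n + 1)) {σ : Store}
    (h : Input n m σ) {a : ℤ} {Q : Store → ℤ → Prop}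
    (hQ : ∀ σ' b, HasTrees n m m m 2 σ' → Reported n m σ' →
      (∀ x y, logAdj (σ'.a .raw) 0 m x y ↔ logAdj (σ.a .raw) 0 m x y) →
      a - preCost n m ≤ b → Q σ' b) : WP env preCode σ a Q := by
  obtain ⟨hM2, hM, hM0⟩ := hfit.bounds
  have h3 := hfit.three_le
  have hm := h.le
  rw [preCode, WP_seq]
  refine readCode_spec hfit h ?_
  intro σ₁ b₁ hF₁ hraw₁ hG₁ hb₁
  have hg₁ : σ₁.v .g = 0 := by rw [hF₁.v .g (by decide), h.v .g (by decide) (by decide)]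
  rw [WP_seq]
  refine starCode_spec hfit hG₁ (by
    intro i
    rw [hF₁.a .cnt (by decide), h.a .cnt (by decide)]) ?_
  intro σ₂ b₂ hF₂ hT₂ hres₂ hb₂
  have hg₂ : σ₂.v .g = 0 := by rw [hF₂.v .g (by decide), hg₁]
  have hG₂ := hG₁.congr (hF₂.v _ (by decide)) (hF₂.v _ (by decide)) (hF₂.v _ (by decide))
    (by rw [hg₂]; omega) (hF₂.v _ (by decide)) (fun k _ => by rw [hF₂.a .raw (by decide)])
    (hF₂.a _ (by decide)) (hF₂.a _ (by decide)) (hF₂.a _ (by decide)) (fun x hx => by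
      rw [hF₂.a .num (by decide), hF₂.a .fin (by decide)]; exact hG₁.clean x hx)
  have hs₂ : σ₂.v .s0 = 0 := by
    rw [hF₂.v .s0 (by decide), hF₁.v .s0 (by decide), h.v .s0 (by decide) (by decide)]
  have hassoc : ∀ c d x : Stmt, ∀ a Q, WP env ((c ;; d) ;; x) σ₂ a Q → WP env (c ;; d ;; x) σ₂ a Q := by
    intro c d x a Q
    simp only [WP_seq]
    exact id
  have hempty : (logAdj (σ₂.a .raw) 0 0) = fun _ _ => False := by
    funext u v
    exact propext ⟨fun h => logAdj_self h, False.elim⟩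
  refine hassoc _ _ _ _ _ ?_
  rw [WP_seq]
  refine core_output_spec hfit hG₂ hs₂ (Nat.zero_le _) (by rw [hg₂, hempty]; exact hT₂) ?_
  intro σ₃ b₃ hF₃ hG₃ hV₃ hraw₃ hb₃
  rw [hg₂] at hb₃
  have hg₃ : σ₃.v .g = 0 := by rw [hF₃.v .g (by decide), hg₂]
  rw [WP_seq]
  refine snapCode_spec hfit hV₃ hG₃.n_eq hg₃ (by omega) ?_
  intro σ₄ b₄ hF₄ hold₄ hnew₄ hsnap₄ hs1₄ hT₄ hb₄
  have hraw₄ := hF₄.a .raw (by decide)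
  have hg₄ : σ₄.v .g = 0 := by rw [hF₄.v .g (by decide), hg₃]
  have hcur₃ : Tree n 0 (logAdj (σ₃.a .raw) 0 0) (n + 2) σ₃ := by
    have := hT₂.frame hF₃
    have he : (logAdj (σ₃.a .raw) 0 0) = fun _ _ => False := by
      funext u v
      exact propext ⟨fun h => logAdj_self h, False.elim⟩
    rwa [he]
  have hTT : HasTrees n m 0 m 2 σ₄ := { hG₃.congr (hF₄.v _ (by decide)) (hF₄.v _ (by decide))
      (hF₄.v _ (by decide)) (by rw [hg₄]; omega) (hF₄.v _ (by decide)) (fun k _ => by rw [hraw₄])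
      (hF₄.a _ (by decide)) (hF₄.a _ (by decide)) (hF₄.a _ (by decide)) (fun x hx => by
        rw [hF₄.a .num (by decide), hF₄.a .fin (by decide)]; exact hG₃.clean x hx) with
    s0_eq := by rw [hF₄.v .s0 (by decide), hF₃.v .s0 (by decide), hs₂]
    s1_eq := by rw [hs1₄, hG₃.e_eq]
    T_eq := hT₄
    s0_le := Nat.zero_le _
    s1_le := le_rfl
    T_ge := le_rfl
    cur := by rw [hg₄, hraw₄]; exact hold₄ _ _ hcur₃
    next := by rw [hg₄, hraw₄]; exact hnew₄
    snap := by
      obtain ⟨L, hL, hA⟩ := hG₃.adj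
      rw [hF₄.a .anext (by decide), hF₄.a .ato (by decide), hraw₄]
      exact ⟨L, ⟨hL.1, fun v hv => by rw [hsnap₄ v hv.le]; exact hL.2 v hv⟩, hA⟩ }
  have hV₄ : Reported n m σ₄ := by
    unfold Reported
    rw [hraw₄, hF₄.a .tnum (by decide), hF₄.a .tpar (by decide), hF₄.a .tfin (by decide)]
    exact hV₃
  have hadj₄ : ∀ x y, logAdj (σ₄.a .raw) 0 m x y ↔ logAdj (σ.a .raw) 0 m x y := by
    intro x y
    rw [hraw₄, ← hraw₁, ← hF₂.a .raw (by decide)]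
    exact logAdj_congr fun k hk => hraw₃ k (by omega)
  obtain ⟨L, hL, hA⟩ := hTT.snap
  have hsum := sum_lists hTT.next.tree hA
  rw [hg₄] at hsum
  rw [WP_seq]
  refine WP_while (fun σ' b => Frame sliceVars [.D, .cnt] σ₄ σ' ∧ ∃ T, T ≤ n + 2 ∧
    HasTrees n m 0 m T σ' ∧ Reported n m σ' ∧ b₄ - 10 * m - 5 * n ≤
      b - 5 * (∑ i ∈ Finset.Ico T (n + 2), (L (col 1 (σ₄.a .inv) i)).length : ℕ) -
        5 * (n + 2 - T : ℤ)) (b₄ - 10 * m - 5 * n) ?_ ?_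
    ⟨Frame.refl _ _ _, 2, by omega, hTT, hV₄, ?_⟩ ?_
  · rintro σ' b ⟨-, T, hT, -, -, hb⟩
    omega
  · rintro σ' b ⟨hF, T, hTn, hT, hV, hb⟩ Q' hQ'
    have hg : σ'.v .g = 0 := by rw [hF.v .g (by decide), hg₄]
    simp [hT.T_eq, hT.N_eq]
    intro hle
    refine slice_spec hfit hT hle hV (L := L) ?_ ?_ ?_
    · rw [hF.a .snap (by decide), hF.a .anext (by decide), hF.a .ato (by decide)]; exact hL
    · rw [hF.a .raw (by decide)]; exact hA
    intro σ₅ b₅ hF₅ hT₅ hV₅ hb₅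
    refine hQ' _ _ ⟨hF.trans hF₅ (by decide) (by decide), T + 1, by omega, hT₅, hV₅, ?_⟩
    rw [hg, hF.a .inv (by decide)] at hb₅
    change _ - 5 * ((L (col 1 (σ₄.a .inv) T)).length : ℤ) - 4 ≤ _ at hb₅
    rw [Finset.sum_eq_sum_Ico_succ_bot (show T < n + 2 by omega)] at hb
    push_cast at hb ⊢
    omega
  · have : ((∑ i ∈ Finset.Ico 2 (n + 2), (L (col 1 (σ₄.a .inv) i)).length : ℕ) : ℤ) = 2 * m := by
      rw [show (1 : ℕ) = 1 - 0 from rfl, hsum]; push_cast; ring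
    rw [this]
    push_cast
    omega
  rintro σ₅ b₅ ⟨hF, T, hTn, hT, hV, hb⟩ hn
  simp [hT.T_eq, hT.N_eq] at hn
  obtain rfl : T = n + 2 := by omega
  refine swapCode_spec hfit hT hV ?_
  intro σ₆ b₆ hF₆ hT₆ hV₆ hb₆
  refine hQ _ _ hT₆ hV₆ ?_ ?_
  · rw [hF₆.a .raw (by decide), hF.a .raw (by decide)]; exact hadj₄
  · have hres : (treeReserve (n + 1) (col 0 (σ₂.a .P)) (col 0 (σ₂.a .E)) : ℤ) ≤
        unit (n + 1) * (n + 1) := by exact_mod_cast hres₂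
    have hcost : (preCost n m : ℤ) = unit (n + 1) * (n + 1) + 3 * unit (n + 1) * (n + 1) +
        60 * m + 100 * (n + 1) := by unfold preCost; push_cast; ring
    simp at hb
    omega


/-! ### The reported tree as a graph -/

/-- The vertex with a given number. -/
def vertexOf (n : ℕ) (v : ℕ) : Option (Fin n) := if h : v < n then some ⟨v, h⟩ else none

theorem vertexCode_vertexOf {n v : ℕ} (h : v ≤ n) : vertexCode (vertexOf n v) = v := by
  unfold vertexOf
  split_ifs with h'
  · rfl
  · simp [vertexCode]; omega

theorem vertexCode_le {n : ℕ} (a : Option (Fin n)) : vertexCode a ≤ n := by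
  cases a with
  | none => exact le_rfl
  | some v => exact v.2.le

theorem vertexCode_injective {n : ℕ} {a b : Option (Fin n)} (h : vertexCode a = vertexCode b) :
    a = b := by
  cases a with
  | none =>
    cases b with
    | none => rfl
    | some v => have := v.2; simp only [vertexCode] at h; omega
  | some u =>
    cases b with
    | none => have := u.2; simp only [vertexCode] at h; omega
    | some v => simp only [vertexCode] at h; rw [Fin.ext h]

theorem addRoot_some {n : ℕ} {G : SimpleGraph (Fin n)} {u v : Fin n} :
    (addRoot G).Adj (some u) (some v) ↔ G.Adj u v := by
  unfold addRoot
  rw [SimpleGraph.fromRel_adj]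
  constructor
  · rintro ⟨-, h | h⟩
    · exact h
    · exact h.symm
  · intro h
    exact ⟨by simpa using h.ne, .inl h⟩

theorem addRoot_none {n : ℕ} {G : SimpleGraph (Fin n)} {v : Fin n} :
    (addRoot G).Adj none (some v) := by
  unfold addRoot
  rw [SimpleGraph.fromRel_adj]
  exact ⟨by simp, .inl trivial⟩

/-- The tree in which the parent of the vertex `v` is `pr v`. -/
def parentTree (n : ℕ) (pr : ℕ → ℕ) : SimpleGraph (Option (Fin n)) :=
  SimpleGraph.fromRel fun a b => ∃ v : Fin n, b = some v ∧ a = vertexOf n (pr v)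

section VTree

variable {n : ℕ} {A : ℕ → ℕ → Prop} {tnum tpar tfin pr : ℕ → ℕ}

theorem VTree.parent_num (h : VTree n A tnum tpar tfin pr) (v : Fin n) :
    tnum (vertexCode (vertexOf n (pr v))) = tpar v ∧ tpar v < tnum v := by
  obtain ⟨p1, p2, p3, -⟩ := h.par v v.2
  rw [vertexCode_vertexOf p1]
  exact ⟨p2, p3⟩

theorem VTree.parent_ne (h : VTree n A tnum tpar tfin pr) (v : Fin n) :
    vertexOf n (pr v) ≠ some v := by
  intro he
  have h1 := h.parent_num v
  rw [he] at h1
  simp only [vertexCode] at h1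
  omega

theorem VTree.adj (h : VTree n A tnum tpar tfin pr) (v : Fin n) :
    (parentTree n pr).Adj (vertexOf n (pr v)) (some v) := by
  rw [parentTree, SimpleGraph.fromRel_adj]
  exact ⟨h.parent_ne v, .inl ⟨v, rfl, rfl⟩⟩

/-- The path from the root to a vertex consists of the ancestors. -/
theorem VTree.exists_path (h : VTree n A tnum tpar tfin pr) (a : Option (Fin n)) :
    ∃ p : (parentTree n pr).Walk none a, p.IsPath ∧ ∀ u, u ∈ p.support ↔
      (tnum (vertexCode u) ≤ tnum (vertexCode a) ∧
        tnum (vertexCode a) < tfin (vertexCode u)) := by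
  induction hk : tnum (vertexCode a) using Nat.strong_induction_on generalizing a with
  | _ k ih =>
  subst hk
  cases a with
  | none =>
    refine ⟨.nil, by simp, fun u => ?_⟩
    simp only [SimpleGraph.Walk.support_nil, List.mem_singleton]
    constructor
    · rintro rfl
      exact ⟨le_rfl, (h.fin_rng n le_rfl).1⟩
    · rintro ⟨h1, -⟩
      have h2 := h.rng _ (vertexCode_le u)
      apply vertexCode_injective
      refine h.inj _ _ (vertexCode_le u) le_rfl ?_
      have h3 : tnum (vertexCode u) ≤ tnum n := h1
      have h4 := h.root
      change tnum (vertexCode u) = tnum n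
      omega
  | some v =>
    obtain ⟨h1, h2⟩ := h.parent_num v
    obtain ⟨p, hp, hs⟩ := ih _ (by rw [h1]; exact h2) _ rfl
    have hv : (some v : Option (Fin n)) ∉ p.support := by
      rw [hs, h1]
      simp only [vertexCode]
      omega
    refine ⟨p.concat (h.adj v), hp.concat hv (h.adj v), fun u => ?_⟩
    rw [SimpleGraph.Walk.support_concat, List.mem_append, hs, h1,
      List.mem_singleton]
    change _ ↔ tnum (vertexCode u) ≤ tnum v ∧ tnum v < tfin (vertexCode u)
    -- By `mem`, the ancestors of the parent of `v` are the proper ancestors of `v`; the path to `v`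
    -- adds just `v`.
    rw [← h.mem _ _ (vertexCode_le u) v.2]
    constructor
    · rintro (h3 | rfl)
      · exact ⟨h3.1.le, h3.2⟩
      · exact ⟨le_rfl, (h.fin_rng v v.2.le).1⟩
    · rintro ⟨h3, h4⟩
      rcases h3.eq_or_lt with h5 | h5
      · exact .inr (vertexCode_injective (h.inj _ _ (vertexCode_le u) v.2.le h5))
      · exact .inl ⟨h5, h4⟩

theorem VTree.isAncestor (h : VTree n A tnum tpar tfin pr) {a b : Option (Fin n)}
    (h1 : tnum (vertexCode a) ≤ tnum (vertexCode b))
    (h2 : tnum (vertexCode b) < tfin (vertexCode a)) : IsAncestor (parentTree n pr) none a b := by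
  obtain ⟨p, hp, hs⟩ := h.exists_path b
  exact ⟨p, hp, (hs a).2 ⟨h1, h2⟩⟩

theorem VTree.isParent (h : VTree n A tnum tpar tfin pr) (v : Fin n) :
    IsParent (parentTree n pr) none (vertexOf n (pr v)) (some v) := by
  refine ⟨h.adj v, h.isAncestor ?_ ?_⟩
  · rw [(h.parent_num v).1]; exact (h.parent_num v).2.le
  · obtain ⟨p1, p2, p3, -⟩ := h.par v v.2
    rw [vertexCode_vertexOf p1]
    change tnum v < _
    refine ((h.mem _ _ p1 v.2).2 ⟨p2.le, ?_⟩).2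
    rw [← p2]
    exact (h.fin_rng _ p1).1

theorem VTree.connected (h : VTree n A tnum tpar tfin pr) : (parentTree n pr).Connected := by
  rw [SimpleGraph.connected_iff_exists_forall_reachable]
  exact ⟨none, fun a => ⟨(h.exists_path a).choose⟩⟩

/-- A connected graph on `n + 1` vertices with `n` edges is a tree. The edges correspond to the
vertices other than the root, each giving the edge to its parent; two vertices cannot be parents of
each other, as parents have smaller numbers. -/
theorem VTree.isTree (h : VTree n A tnum tpar tfin pr) : (parentTree n pr).IsTree := by
  rw [SimpleGraph.isTree_iff_connected_and_card]
  refine ⟨h.connected, ?_⟩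
  have hb : Function.Bijective fun v : Fin n =>
      (⟨s(vertexOf n (pr v), some v), h.adj v⟩ : (parentTree n pr).edgeSet) := by
    constructor
    · intro u v huv
      rcases Sym2.eq_iff.1 (congrArg Subtype.val huv) with ⟨-, h1⟩ | ⟨h1, h2⟩
      · exact Option.some_injective _ h1
      · have h3 := h.parent_num u
        have h4 := h.parent_num v
        rw [h1] at h3
        rw [← h2] at h4
        simp only [vertexCode] at h3 h4
        omega
    · rintro ⟨x, hx⟩
      induction x using Sym2.ind with
      | _ a b =>
      rw [SimpleGraph.mem_edgeSet, parentTree, SimpleGraph.fromRel_adj] at hx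
      obtain ⟨-, ⟨v, rfl, rfl⟩ | ⟨v, rfl, rfl⟩⟩ := hx
      · exact ⟨v, rfl⟩
      · exact ⟨v, Subtype.ext Sym2.eq_swap⟩
  rw [← Nat.card_congr (Equiv.ofBijective _ hb)]
  simp

/-- For an edge of the graph, `back` puts the end with the larger number into the interval of the
other end, which is therefore an ancestor. Edges at the dummy vertex are back edges because it is
the root. -/
theorem VTree.isDFSTree (h : VTree n A tnum tpar tfin pr) {G : SimpleGraph (Fin n)}
    (hG : ∀ u v : Fin n, G.Adj u v ↔ A u v) :
    IsDFSTree (addRoot G) none (parentTree n pr) := by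
  have hpar : ∀ v : Fin n, (addRoot G).Adj (vertexOf n (pr v)) (some v) := by
    intro v
    obtain ⟨p1, p2, p3, p4⟩ := h.par v v.2
    by_cases hlt : pr v < n
    · rcases p4 with p4 | p4
      · omega
      · rw [vertexOf, dif_pos hlt, addRoot_some, hG]
        exact p4
    · rw [vertexOf, dif_neg hlt]
      exact addRoot_none
  refine ⟨?_, h.isTree, ?_⟩
  · intro a b hab
    rw [parentTree, SimpleGraph.fromRel_adj] at hab
    obtain ⟨-, ⟨v, rfl, rfl⟩ | ⟨v, rfl, rfl⟩⟩ := hab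
    · exact hpar v
    · exact (hpar v).symm
  · have hroot : ∀ b, IsAncestor (parentTree n pr) none none b := fun b =>
      ⟨_, (h.exists_path b).choose_spec.1, SimpleGraph.Walk.start_mem_support _⟩
    intro a b hab _
    cases a with
    | none => exact .inl (hroot b)
    | some u =>
      cases b with
      | none => exact .inr (hroot _)
      | some v =>
        have huv := addRoot_some.1 hab
        rcases le_total (tnum u) (tnum v) with hle | hle
        · refine .inl (h.isAncestor hle (h.back u v u.2 v.2 ((hG u v).1 huv) ?_))
          refine lt_of_le_of_ne hle fun he => huv.ne (Fin.ext (h.inj _ _ u.2.le v.2.le he))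
        · refine .inr (h.isAncestor hle (h.back v u v.2 u.2 ((hG v u).1 huv.symm) ?_))
          refine lt_of_le_of_ne hle fun he => huv.ne (Fin.ext (h.inj _ _ u.2.le v.2.le he.symm))

end VTree

theorem Reported.reports {env : Env} {n e : ℕ} (hfit : env.Fits (n + 1)) {σ : Store} {s : State}
    (hs : Rep env s σ) (h : Reported n e σ) (hout : σ.v .out = n * n) {G : SimpleGraph (Fin n)}
    (hG : ∀ u v : Fin n, G.Adj u v ↔ logAdj (σ.a .raw) 0 e u v) : ReportsDFSTree G s := by
  have hNN : (n + 1) * (n + 1) = n * n + 2 * n + 1 := by ring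
  have hBN := hfit.B_eq
  refine ⟨_, VTree.isDFSTree h hG, fun v => ⟨_, VTree.isParent h v, ?_⟩⟩
  have hv := v.2
  rw [vertexCode_vertexOf (h.par v v.2).1]
  have h1 : s.reg 2 = n * n := (hs.reg .out).trans hout
  rw [h1]
  exact hs.mem .raw (n * n + v) (by simp only [Env.len]; omega)

/-! ### The input -/

theorem getD_flatMap_pair {α : Type*} (f g : α → ℕ) (l : List α) {k : ℕ} (hk : k < l.length) :
    (l.flatMap fun e => [f e, g e]).getD (2 * k) 0 = f l[k] ∧
      (l.flatMap fun e => [f e, g e]).getD (2 * k + 1) 0 = g l[k] := by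
  induction l generalizing k with
  | nil => simp at hk
  | cons x l ih =>
    cases k with
    | zero => simp
    | succ k =>
      have := ih (k := k) (by simpa using hk)
      simp only [List.flatMap_cons, List.cons_append, List.nil_append, List.getElem_cons_succ]
      exact this

theorem card_edges {n : ℕ} {G : SimpleGraph (Fin n)} {l : List (Fin n × Fin n)}
    (h : EnumeratesEdges l G) : G.edgeSet.ncard = l.length := by
  classical
  have : G.edgeSet = ((l.map fun e => s(e.1, e.2)).toFinset : Set (Sym2 (Fin n))) := by
    ext x
    induction x using Sym2.ind with
    | _ a b => rw [SimpleGraph.mem_edgeSet, h.2, Finset.mem_coe, List.mem_toFinset]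
  rw [this, Set.ncard_coe_finset, List.toFinset_card_of_nodup h.1, List.length_map]

theorem two_mul_card_edges_le {n : ℕ} (G : SimpleGraph (Fin n)) : 2 * G.edgeSet.ncard ≤ n * n := by
  classical
  have h1 := G.card_edgeFinset_le_card_choose_two
  rw [Fintype.card_fin, Nat.choose_two_right] at h1
  have h2 : G.edgeSet.ncard = G.edgeFinset.card := by
    rw [← SimpleGraph.coe_edgeFinset, Set.ncard_coe_finset]
  have h3 := Nat.mul_le_mul_left n (Nat.sub_le n 1)
  have h4 := Nat.div_mul_le_self (n * (n - 1)) 2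
  omega

theorem card_edges_insert {n : ℕ} {G : SimpleGraph (Fin n)} {u v : Fin n} (huv : u ≠ v)
    (h : ¬ G.Adj u v) : (G ⊔ SimpleGraph.edge u v).edgeSet.ncard = G.edgeSet.ncard + 1 := by
  rw [SimpleGraph.edgeSet_sup, SimpleGraph.edgeSet_edge_of_ne huv, Set.union_singleton,
    Set.ncard_insert_of_notMem (by simpa using h) (Set.toFinite _)]

/-- The store for the initial state of the machine. -/
def initStore (n : ℕ) (l : List (Fin n × Fin n)) : Store where
  v x := if x = .r0 then n else if x = .r1 then l.length else 0
  a f i := if f = .raw then (l.flatMap fun e => [(e.1 : ℕ), (e.2 : ℕ)]).getD i 0 else 0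

theorem initStore_log {n : ℕ} {G : SimpleGraph (Fin n)} {l : List (Fin n × Fin n)}
    (h : EnumeratesEdges l G) (u v : Fin n) :
    G.Adj u v ↔ logAdj ((initStore n l).a .raw) 0 l.length u v := by
  have hraw : (initStore n l).a .raw =
      fun i => (l.flatMap fun e => [(e.1 : ℕ), (e.2 : ℕ)]).getD i 0 := by
    funext i; simp [initStore]
  rw [h.2, List.mem_map, hraw]
  unfold logAdj
  constructor
  · rintro ⟨x, hx, hxe⟩
    obtain ⟨k, hk, rfl⟩ := List.getElem_of_mem hx
    obtain ⟨e1, e2⟩ := getD_flatMap_pair (fun e : Fin n × Fin n => (e.1 : ℕ)) (fun e => (e.2 : ℕ)) l hk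
    refine ⟨k, Nat.zero_le _, hk, ?_⟩
    simp only [e1, e2]
    rw [Sym2.eq_iff] at hxe
    rcases hxe with ⟨h1, h2⟩ | ⟨h1, h2⟩ <;> simp [h1, h2]
  · rintro ⟨k, -, hk, h3⟩
    obtain ⟨e1, e2⟩ := getD_flatMap_pair (fun e : Fin n × Fin n => (e.1 : ℕ)) (fun e => (e.2 : ℕ)) l hk
    simp only [e1, e2] at h3
    refine ⟨l[k], List.getElem_mem hk, ?_⟩
    rw [Sym2.eq_iff]
    simpa [Fin.ext_iff] using h3

theorem initStore_input {n : ℕ} {G : SimpleGraph (Fin n)} {l : List (Fin n × Fin n)}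
    (h : EnumeratesEdges l G) : Input n l.length (initStore n l) := by
  have hlog : ∀ k (hk : k < l.length), (initStore n l).a .raw (2 * k) = l[k].1 ∧
      (initStore n l).a .raw (2 * k + 1) = l[k].2 := by
    intro k hk
    simpa [initStore] using
      getD_flatMap_pair (fun e : Fin n × Fin n => (e.1 : ℕ)) (fun e => (e.2 : ℕ)) l hk
  have hadj : ∀ k (hk : k < l.length), G.Adj l[k].1 l[k].2 := by
    intro k hk
    rw [h.2, List.mem_map]
    exact ⟨_, List.getElem_mem hk, rfl⟩
  constructor
  · simp [initStore]
  · simp [initStore]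
  · intro x h1 h2; simp [initStore, h1, h2]
  · intro f h1 i; simp [initStore, h1]
  · rw [← card_edges h]; exact two_mul_card_edges_le G
  · intro k hk
    obtain ⟨h1, h2⟩ := hlog (k / 2) (by omega)
    rcases Nat.mod_two_eq_zero_or_one k with h3 | h3
    · rw [show k = 2 * (k / 2) by omega, h1]; exact Fin.isLt _
    · rw [show k = 2 * (k / 2) + 1 by omega, h2]; exact Fin.isLt _
  · intro k hk
    obtain ⟨h1, h2⟩ := hlog k hk
    rw [h1, h2]
    exact fun he => (hadj k hk).ne (Fin.ext he)
  · rintro k hk ⟨j, -, hj, h3⟩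
    obtain ⟨h1, h2⟩ := hlog k hk
    obtain ⟨h1', h2'⟩ := hlog j (by omega)
    rw [h1, h2, h1', h2'] at h3
    have hnd := List.nodup_iff_injective_get.1 h.1
    have : (⟨j, by simp; omega⟩ : Fin (l.map fun e => s(e.1, e.2)).length) = ⟨k, by simpa using hk⟩ := by
      apply hnd
      simp only [List.get_eq_getElem, List.getElem_map, Sym2.eq_iff]
      simpa [Fin.ext_iff] using h3
    simp at this
    omega


/-! ### The running times -/

/-- Since log 2 exceeds 0.69, constants can be absorbed into log n for all `n ≥ 2`. -/
theorem half_le_log {n : ℕ} (hn : 2 ≤ n) : 1 ≤ 1.45 * Real.log n := by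
  have h1 := Real.log_two_gt_d9
  have h2 : Real.log 2 ≤ Real.log n := Real.log_le_log (by norm_num) (by exact_mod_cast hn)
  linarith

/-- The power of two with exponent one less than the binary length of `n + 1` is at most `n + 1`,
and `n + 1 ≤ n ^ 2`. So the length is at most 1 plus twice the binary logarithm of `n`. -/
theorem size_le_log {n : ℕ} (hn : 2 ≤ n) : ((n + 1).size : ℝ) ≤ 5 * Real.log n := by
  have h1 := half_le_log hn
  have h2 := Real.log_two_gt_d9
  have h3 : 2 ^ ((n + 1).size - 1) ≤ n + 1 := by
    rw [← Nat.lt_size]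
    have : 0 < (n + 1).size := Nat.size_pos.2 (Nat.succ_pos n)
    omega
  have h4 : (2 : ℝ) ^ ((n + 1).size - 1) ≤ (n : ℝ) ^ 2 := by
    have h5 : 2 ^ ((n + 1).size - 1) ≤ n ^ 2 := h3.trans (by nlinarith)
    exact_mod_cast h5
  have h5 := Real.log_le_log (by positivity) h4
  rw [Real.log_pow, Real.log_pow] at h5
  have h6 : ((n + 1).size : ℝ) ≤ ((n + 1).size - 1 : ℕ) + 1 := by
    have : (n + 1).size ≤ (n + 1).size - 1 + 1 := by omega
    exact_mod_cast this
  have h7 : (0 : ℝ) ≤ ((n + 1).size - 1 : ℕ) := Nat.cast_nonneg _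
  push_cast at h5
  nlinarith

theorem unit_le_log {n : ℕ} (hn : 2 ≤ n) : (unit (n + 1) : ℝ) ≤ 120 * Real.log n := by
  have h1 := half_le_log hn
  have h2 := size_le_log hn
  unfold unit
  push_cast
  linarith

theorem preCost_le {n m : ℕ} (hn : 2 ≤ n) :
    (preCost n m : ℝ) ≤ 2000 * (((m : ℝ) + n) * Real.log n) := by
  have h1 := half_le_log hn
  have h2 := unit_le_log hn
  have hn' : (2 : ℝ) ≤ n := by exact_mod_cast hn
  have hm : (0 : ℝ) ≤ m := Nat.cast_nonneg m
  have h3 : (unit (n + 1) : ℝ) * (n + 1) ≤ 120 * Real.log n * (2 * n) :=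
    mul_le_mul h2 (by linarith) (by linarith) (by linarith)
  have h4 := mul_le_mul_of_nonneg_left h1 hm
  have h5 := mul_le_mul_of_nonneg_left h1 (by linarith : (0 : ℝ) ≤ n)
  have h6 : (0 : ℝ) ≤ m * Real.log n := mul_nonneg hm (by linarith)
  unfold preCost
  push_cast
  nlinarith

/-- The factors `unit` and `size` contribute one logarithm each, so the cost is really O(n log² n);
the third logarithm comes from multiplying by `1 ≤ 1.45 * log n`. -/
theorem updCost_le {n : ℕ} (hn : 2 ≤ n) : (updCost n : ℝ) ≤ 9000 * (n * Real.log n ^ 3) := by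
  have h1 := half_le_log hn
  have h2 := unit_le_log hn
  have h3 := size_le_log hn
  have hn' : (2 : ℝ) ≤ n := by exact_mod_cast hn
  set x := Real.log n
  have hx : 0 ≤ x := by linarith
  have h4 : (unit (n + 1) : ℝ) * (n + 1).size ≤ 120 * x * (5 * x) :=
    mul_le_mul h2 h3 (Nat.cast_nonneg _) (by linarith)
  have h5 : (unit (n + 1) : ℝ) * (n + 1).size + 3 * unit (n + 1) + 200 ≤ 4500 * x ^ 3 := by
    have e1 : x ≤ 1.45 * x * x := by nlinarith
    have e2 : x * x ≤ 1.45 * x ^ 3 := by nlinarith [mul_le_mul_of_nonneg_left e1 hx]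
    nlinarith
  unfold updCost
  push_cast
  have h6 : (0 : ℝ) ≤ x ^ 3 := by positivity
  calc _ = ((unit (n + 1) : ℝ) * (n + 1).size + 3 * unit (n + 1) + 200) * (n + 1) := by ring
    _ ≤ 4500 * x ^ 3 * (2 * n) := mul_le_mul h5 (by linarith) (by linarith) (by positivity)
    _ = _ := by ring

/-! ### The machine -/

/-- The memory needs a constant times `n ^ 2` cells. Of the sixteen factors `n` in `n ^ 16 ≤ 2 ^ w`,
fourteen give at least `2 ^ 14`, which covers that constant. -/
theorem machine_fits {n w : ℕ} (hn : 2 ≤ n) (hw : 16 * Nat.clog 2 n ≤ w) :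
    (n + 1) * (n + 1) + 32 * (64 * ((n + 2) * (n + 2))) + 32 ≤ 2 ^ w := by
  have h1 : n ^ 16 ≤ 2 ^ w := calc
    n ^ 16 ≤ (2 ^ Nat.clog 2 n) ^ 16 := Nat.pow_le_pow_left (Nat.le_pow_clog one_lt_two n) _
    _ = 2 ^ (16 * Nat.clog 2 n) := by rw [← pow_mul, mul_comm]
    _ ≤ 2 ^ w := Nat.pow_le_pow_right two_pos hw
  have h2 : 2 ^ 14 * n ^ 2 ≤ n ^ 16 := calc
    2 ^ 14 * n ^ 2 ≤ n ^ 14 * n ^ 2 := Nat.mul_le_mul_right _ (Nat.pow_le_pow_left hn 14)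
    _ = n ^ 16 := by ring
  nlinarith

/-- Preprocessing: register `90` is set to the start of the arrays. -/
def preCmd : Cmd :=
  .seq (.const 91 1) (.seq (.arith .add 92 0 91) (.seq (.arith .mul 90 92 92) preCode.comp))

/-- The input takes `2 * m ≤ n * n` cells, so all arrays beyond `raw` start with zeros. -/
theorem initState_mem {n : ℕ} {G : SimpleGraph (Fin n)} {l : List (Fin n × Fin n)}
    (h : EnumeratesEdges l G) {i : ℕ} (hi : (n + 1) * (n + 1) ≤ i) :
    (initState n l).mem i = 0 := by
  have h1 := two_mul_card_edges_le G
  rw [card_edges h] at h1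
  refine List.getD_eq_default _ _ ?_
  have : (l.flatMap fun e => [(e.1 : ℕ), (e.2 : ℕ)]).length = l.length * 2 := by
    simp [List.length_flatMap]
  rw [this]
  nlinarith

theorem preCmd_spec {env : Env} {n : ℕ} (hfit : env.Fits (n + 1)) {G : SimpleGraph (Fin n)}
    {l : List (Fin n × Fin n)} (h : EnumeratesEdges l G) :
    ∃ t s σ, Exec env.w preCmd (initState n l) t s ∧
      t ≤ 3 + preCode.width * preCost n l.length ∧ Rep env s σ ∧
      HasTrees n l.length l.length l.length 2 σ ∧ Reported n l.length σ ∧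
      ∀ u v : Fin n, G.Adj u v ↔ logAdj (σ.a .raw) 0 l.length u v := by
  have hle := env.le_pow
  have hB := hfit.B_eq
  have hwp : WP env preCode (initStore n l) (preCost n l.length) fun σ b =>
      HasTrees n l.length l.length l.length 2 σ ∧ Reported n l.length σ ∧
      (∀ u v : Fin n, G.Adj u v ↔ logAdj (σ.a .raw) 0 l.length u v) ∧ 0 ≤ b := by
    refine preCode_spec hfit (initStore_input h) fun σ b h1 h2 h3 h4 => ?_
    exact ⟨h1, h2, fun u v => (initStore_log h u v).trans (h3 u v).symm, by omega⟩
  unfold WP at hwp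
  obtain ⟨t, σ, hrun, hT, hR, hG, ht⟩ := hwp
  have e1 : 1 % 2 ^ env.w = 1 := Nat.mod_eq_of_lt (by omega)
  have hnn : n + 1 ≤ (n + 1) * (n + 1) := Nat.le_mul_self _
  have e2 : (n + 1) % 2 ^ env.w = n + 1 := Nat.mod_eq_of_lt (by omega)
  have e3 : (n + 1) * (n + 1) % 2 ^ env.w = env.B := by
    rw [hB]; exact Nat.mod_eq_of_lt (by omega)
  obtain ⟨s, hs, hmem, hreg, h90⟩ : ∃ s, (∀ {t' s'}, Exec env.w preCode.comp s t' s' →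
      Exec env.w preCmd (initState n l) (1 + (1 + (1 + t'))) s') ∧ s.mem = (initState n l).mem ∧
      (∀ r < 90, s.reg r = (initState n l).reg r) ∧ s.reg 90 = env.B := by
    refine ⟨_, fun hx => .seq (.const _ _ _) (.seq (.arith _ _ _ _ _)
      (.seq (.arith _ _ _ _ _) hx)), rfl, fun r hr => ?_, ?_⟩
    · have h1 : r ≠ 90 := by omega
      have h2 : r ≠ 91 := by omega
      have h3 : r ≠ 92 := by omega
      simp [State.setReg, Function.update_apply, h1, h2, h3]
    · simp [State.setReg, Function.update_apply, Op.eval, initState, e1, e2, e3]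
  have hrep : Rep env s (initStore n l) := by
    refine ⟨fun x => ?_, fun f i hi => ?_, h90⟩
    · rw [hreg _ x.ctorIdx_lt]
      by_cases h0 : x = .r0
      · subst h0; rfl
      by_cases h1 : x = .r1
      · subst h1; rfl
      have h0' : x.ctorIdx ≠ 0 := fun he => h0 (Var.ctorIdx_injective he)
      have h1' : x.ctorIdx ≠ 1 := fun he => h1 (Var.ctorIdx_injective he)
      simp [initState, initStore, h0, h1, h0', h1']
    · rw [hmem]
      by_cases hf : f = .raw
      · subst hf; simp [initStore, initState, Env.addr]
      · rw [addr_of_ne_raw env hf, initState_mem h (by omega)]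
        simp [initStore, hf]
  obtain ⟨t', s', hexec, ht', hrep'⟩ := hrun.compile preCode hrep
  refine ⟨_, s', σ, hs hexec, ?_, hrep', hT, hR, hG⟩
  have : preCode.width * t ≤ preCode.width * preCost n l.length :=
    Nat.mul_le_mul_left _ (by omega)
  omega

theorem HasTrees.setv {n e s0 s1 T : ℕ} {σ : Store} (h : HasTrees n e s0 s1 T σ) (u v : ℕ) :
    HasTrees n e s0 s1 T ((σ.setv .r0 u).setv .r1 v) := by
  have hF : Frame [.r0, .r1] [] σ ((σ.setv .r0 u).setv .r1 v) :=
    ((Frame.refl _ _ σ).setv (by decide) u).setv (by decide) v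
  exact
  { toHasGraph := h.toHasGraph.congr rfl rfl rfl h.g_le rfl (fun _ _ => rfl) rfl rfl rfl h.clean
    s0_eq := h.s0_eq
    s1_eq := h.s1_eq
    T_eq := h.T_eq
    s0_le := h.s0_le
    s1_le := h.s1_le
    T_ge := h.T_ge
    cur := h.cur.frame hF
    next := h.next.frame hF
    snap := h.snap }

/-- Induction on the insertions with the invariant of `updCode_spec`. Since the graph stays simple,
the log never exceeds `n * n` cells, however many insertions are offered. -/
theorem handlesInsertions {env : Env} {n : ℕ} (hfit : env.Fits (n + 1)) {C : ℝ}
    (hC : (updCode.width * updCost n : ℝ) ≤ C) (l : List (Fin n × Fin n)) :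
    ∀ {G : SimpleGraph (Fin n)} {s : State} {σ : Store} {e s0 s1 T : ℕ}, Rep env s σ →
      HasTrees n e s0 s1 T σ → s1 + T = e + 2 → T ≤ n + 1 → s1 ≤ s0 + n →
      (∀ u v : Fin n, G.Adj u v ↔ logAdj (σ.a .raw) 0 e u v) → G.edgeSet.ncard = e →
      HandlesInsertions env.w updCode.comp C G s l := by
  induction l with
  | nil => intros; trivial
  | cons x l ih =>
    obtain ⟨u, v⟩ := x
    intro G s σ e s0 s1 T hs hT h1 h2 h3 hG hcard huv hnew
    have hcard' := card_edges_insert huv hnew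
    rw [hcard] at hcard'
    have hle := two_mul_card_edges_le (G ⊔ SimpleGraph.edge u v)
    rw [hcard'] at hle
    have hwp : WP env updCode ((σ.setv .r0 u).setv .r1 v) (updCost n) fun σ' b =>
        ∃ s0' s1' T', HasTrees n (e + 1) s0' s1' T' σ' ∧ s1' + T' = e + 1 + 2 ∧ T' ≤ n + 1 ∧
          s1' ≤ s0' + n ∧ Reported n (e + 1) σ' ∧
          (∀ a b : Fin n, (G ⊔ SimpleGraph.edge u v).Adj a b ↔
            logAdj (σ'.a .raw) 0 (e + 1) a b) ∧ 0 ≤ b := by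
      refine updCode_spec hfit (hT.setv u v) (u := (u : ℕ)) (v := (v : ℕ)) h1 h2 h3 rfl rfl u.2 v.2 (fun he => huv (Fin.ext he))
        (fun he => hnew ((hG u v).2 he)) hle ?_
      intro σ' b s0' s1' T' g1 g2 g3 g4 g5 g6 g7
      refine ⟨s0', s1', T', g1, g2, g3, g4, g5, fun a b => ?_, by omega⟩
      rw [g6, SimpleGraph.sup_adj, SimpleGraph.edge_adj, hG]
      refine or_congr Iff.rfl ?_
      simp only [Fin.ext_iff]
      constructor
      · rintro ⟨h | h, -⟩ <;> omega
      · have := Fin.val_ne_of_ne huv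
        intro h
        exact ⟨by omega, by rw [ne_eq, Fin.ext_iff]; omega⟩
    unfold WP at hwp
    obtain ⟨t, σ', hrun, s0', s1', T', g1, g2, g3, g4, g5, g6, g7⟩ := hwp
    obtain ⟨t', s', hexec, ht', hrep'⟩ := hrun.compile updCode ((hs.setv .r0 u).setv .r1 v)
    refine ⟨t', s', hexec, le_trans ?_ hC, g5.reports hfit hrep' g1.out_eq g6,
      ih hrep' g1 g2 g3 g4 g6 hcard'⟩
    have : t' ≤ updCode.width * updCost n :=
      ht'.trans (Nat.mul_le_mul_left _ (by omega))
    exact_mod_cast this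

end IncDFS

/-! ### The main theorem: choice of the constants and of the memory layout. -/

theorem mainTheorem4 :
    ∃ (pre upd : IncDFS.Cmd) (C : ℝ) (K : ℕ),
      ∀ (n : ℕ), 2 ≤ n →
      ∀ (G : SimpleGraph (Fin n)) (E : List (Fin n × Fin n)), IncDFS.EnumeratesEdges E G →
      ∀ (w : ℕ), K * Nat.clog 2 n ≤ w →
        ∃ (t : ℕ) (s : IncDFS.State),
          IncDFS.Exec w pre (IncDFS.initState n E) t s ∧
          (t : ℝ) ≤ C * ((G.edgeSet.ncard : ℝ) + n) * Real.log n ∧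
          IncDFS.ReportsDFSTree G s ∧
          ∀ insertions : List (Fin n × Fin n),
            IncDFS.HandlesInsertions w upd (C * n * Real.log n ^ 3) G s insertions := by
  refine ⟨IncDFS.preCmd, IncDFS.updCode.comp,
    9000 * ((IncDFS.preCode.width : ℝ) + IncDFS.updCode.width + 1), 16, ?_⟩
  intro n hn G E hE w hw
  -- The `(n + 1) * (n + 1)` cells of `raw` hold the log in the first `n * n` cells and the report
  -- after it; the other bound is the least that `Env.Fits` allows.
  let env : IncDFS.Env :=
    ⟨w, (n + 1) * (n + 1), 64 * ((n + 2) * (n + 2)), IncDFS.machine_fits hn hw⟩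
  have hfit : env.Fits (n + 1) := ⟨by omega, rfl, le_rfl⟩
  obtain ⟨t, s, σ, hexec, ht, hrep, hT, hR, hG⟩ := IncDFS.preCmd_spec hfit hE
  have hlog := IncDFS.half_le_log hn
  have hx : 0 ≤ Real.log n := by linarith
  have hn' : (2 : ℝ) ≤ n := by exact_mod_cast hn
  have hp : (0 : ℝ) ≤ IncDFS.preCode.width := Nat.cast_nonneg _
  have hu : (0 : ℝ) ≤ IncDFS.updCode.width := Nat.cast_nonneg _
  refine ⟨t, s, hexec, ?_, hR.reports hfit hrep hT.out_eq hG, fun l => ?_⟩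
  · have h1 := IncDFS.preCost_le (m := E.length) hn
    have h2 : (t : ℝ) ≤ 3 + IncDFS.preCode.width * IncDFS.preCost n E.length := by
      exact_mod_cast ht
    rw [IncDFS.card_edges hE]
    set X := ((E.length : ℝ) + n) * Real.log n with hX
    have hX1 : 1 ≤ X := by
      have : (0 : ℝ) ≤ E.length := Nat.cast_nonneg _
      rw [hX]
      nlinarith
    have h3 := mul_le_mul_of_nonneg_left h1 hp
    calc (t : ℝ) ≤ 3 + IncDFS.preCode.width * (2000 * X) := by linarith
      _ ≤ 9000 * ((IncDFS.preCode.width : ℝ) + IncDFS.updCode.width + 1) * X := by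
        have := mul_nonneg hp (by linarith : 0 ≤ X)
        have := mul_nonneg hu (by linarith : 0 ≤ X)
        nlinarith
      _ = _ := by rw [hX]; ring
  -- After the preprocessing both snapshots contain all edges and `T` is 2, so the invariant `s1 + T
  -- = e + 2` holds by definition.
  · refine IncDFS.handlesInsertions hfit ?_ l hrep hT rfl (by omega) (by omega) hG
      (IncDFS.card_edges hE)
    have h1 := IncDFS.updCost_le hn
    have h3 := mul_le_mul_of_nonneg_left h1 hu
    have hY : (0 : ℝ) ≤ n * Real.log n ^ 3 := by positivity
    refine h3.trans ?_
    have := mul_nonneg hp hY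
    nlinarith
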